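/- Let $d\ge 1$ be an odd integer and let $R>0$. Let $(f,g)\in \dot H^1(\mathbb R^d)\times L^2(\mathbb R^d)$ be radial, where $\dot H^1(\mathbb R^d)$ is the completion of $C_c^\infty(\mathbb R^d)$ for the norm $\|\nabla\varphi\|_{L^2}$ (so for $d=1$ its elements are functions modulo additive constants). Let $u(t,r)$, $r=|x|$, be the radial finite-energy solution of the free wave equation $$\partial_t^2u-\Delta u=0 \ \text{ on } \mathbb R\times\mathbb R^d,\qquad u(0)=f,\quad \partial_tu(0)=g,$$ that is, $(u,\partial_t u)\in C(\mathbb R;\dot H^1\times L^2)$ and the equation holds in the weak sense. Let $(\dot H^1\times L^2)(r\ge R;\,r^{d-1}dr)$ be the Hilbert space of radial pairs on $r\ge R$ with norm $$\|(f,g)\|^2=\int_R^\infty\big(|f'(r)|^2+|g(r)|^2\big)\,r^{d-1}\,dr ,$$ let $P(R)$ be its finite-dimensional subspace $$P(R)=\mathrm{span}\Big\{(r^{2k_1-d},0),\ (0,r^{2k_2-d})\ :\ 1\le k_1\le\Big\lfloor\frac{d+2}{4}\Big\rfloor,\ 1\le k_2\le\Big\lfloor\frac d4\Big\rfloor\Big\}$$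 (so $P(R)=\{0\}$ if $d=1$), and let $\pi^\perp_{P(R)}$ be the orthogonal projection of this Hilbert space onto the orthogonal complement of $P(R)$. Then the limits $$L_\pm=\lim_{t\to\pm\infty}\int_{r\ge|t|+R}\big(|\partial_ru(t,r)|^2+|\partial_tu(t,r)|^2\big)\,r^{d-1}\,dr$$ exist and are finite, and $$\max(L_+,L_-)\ \ge\ \frac12\,\big\|\pi^\perp_{P(R)}(f,g)\big\|^2_{\dot H^1\times L^2(r\ge R;\,r^{d-1}dr)} .$$ The inequality is an equality for data of the form $(f,0)$ and of the form $(0,g)$. Moreover, $\max(L_+,L_-)=0$ if and only if the restriction of $(f,g)$ to $r\ge R$ belongs to $P(R)$. -/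

import Mathlib

open MeasureTheory Filter Topology
open scoped ContDiff ENNReal

noncomputable section

namespace RadialWave

/-- Euclidean space `ℝ^d`. -/
abbrev E (d : ℕ) : Type := EuclideanSpace ℝ (Fin d)

/-- The partial derivative `∂_i φ (x)` of a differentiable function on `ℝ^d`. -/
def partialD {F : Type*} [NormedAddCommGroup F] [NormedSpace ℝ F] {d : ℕ}
    (i : Fin d) (φ : E d → F) (x : E d) : F :=
  fderiv ℝ φ x (EuclideanSpace.single i 1)

/-- `f` belongs to the homogeneous Sobolev space `Ḣ¹(ℝ^d)`, with (weak) gradient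
`G = (G_1, …, G_d)` in `L²`.

`Ḣ¹` is the completion of `C_c^∞(ℝ^d)` for the norm `‖∇φ‖_{L²}`, realized by locally
integrable functions: `f` is a limit in `L¹_loc` of test functions whose gradients converge to
`G` in `L²`.  (For `d ≥ 3` the limit of gradients determines `f`; for `d = 1` it determines `f`
up to an additive constant, and every constant has norm `0`.) -/
structure HasDotH1Gradient {𝕜 : Type*} [RCLike 𝕜] {d : ℕ}
    (f : E d → 𝕜) (G : Fin d → E d → 𝕜) : Prop where
  locallyIntegrable : LocallyIntegrable f volume
  gradient_memLp : ∀ i, MemLp (G i) 2 volume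
  approx : ∃ φ : ℕ → E d → 𝕜,
    (∀ n, ContDiff ℝ ∞ (φ n) ∧ HasCompactSupport (φ n)) ∧
    (∀ K : Set (E d), IsCompact K →
      Tendsto (fun n => eLpNorm (fun x => φ n x - f x) 1 (volume.restrict K)) atTop (𝓝 0)) ∧
    (∀ i, Tendsto (fun n => eLpNorm (fun x => partialD i (φ n) x - G i x) 2 volume) atTop (𝓝 0))

/-- `U : ℝ × ℝ^d → 𝕜` is a finite-energy solution of the Cauchy problem
`∂_t² U = Δ U`, `U(0) = f`, `∂_t U(0) = g`, with spatial gradient `DU` and time derivative `Ut`: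
`(U, Ut)` is a continuous curve in `Ḣ¹ × L²`, and `∂_t U = Ut`, `∂_t Ut = Δ U` hold weakly in
space, that is, against every test function `φ ∈ C_c^∞(ℝ^d)`. -/
structure IsEnergySolution {𝕜 : Type*} [RCLike 𝕜] {d : ℕ} (f g : E d → 𝕜)
    (U : ℝ → E d → 𝕜) (DU : ℝ → Fin d → E d → 𝕜) (Ut : ℝ → E d → 𝕜) : Prop where
  dotH1 : ∀ t, HasDotH1Gradient (U t) (DU t)
  memLp_timeDeriv : ∀ t, MemLp (Ut t) 2 volume
  continuous_gradient : ∀ t i,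
    Tendsto (fun s => eLpNorm (fun x => DU s i x - DU t i x) 2 volume) (𝓝 t) (𝓝 0)
  continuous_timeDeriv : ∀ t,
    Tendsto (fun s => eLpNorm (fun x => Ut s x - Ut t x) 2 volume) (𝓝 t) (𝓝 0)
  timeDeriv : ∀ φ : E d → ℝ, ContDiff ℝ ∞ φ → HasCompactSupport φ → ∀ t,
    HasDerivAt (fun s => ∫ x, φ x • U s x) (∫ x, φ x • Ut t x) t
  wave : ∀ φ : E d → ℝ, ContDiff ℝ ∞ φ → HasCompactSupport φ → ∀ t,
    HasDerivAt (fun s => ∫ x, φ x • Ut s x)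
      (-∑ i, ∫ x, partialD i φ x • DU t i x) t
  initial_position : U 0 =ᵐ[volume] f
  initial_velocity : Ut 0 =ᵐ[volume] g

/-- The radial function `x ↦ h(|x|)` on `ℝ^d` with profile `h`. -/
def radial {𝕜 : Type*} (d : ℕ) (h : ℝ → 𝕜) : E d → 𝕜 := fun x => h ‖x‖

/-- The radial vector field `x ↦ h(|x|) x/|x|` on `ℝ^d`: the gradient of a radial function whose
radial derivative is `h`. -/
def radialGrad {𝕜 : Type*} [RCLike 𝕜] (d : ℕ) (h : ℝ → 𝕜) : Fin d → E d → 𝕜 :=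
  fun i x => (x i / ‖x‖) • h ‖x‖

/-- The energy density `|∇_{t,x} u|² r^{d-1} = (|∂_r u|² + |∂_t u|²) r^{d-1}` at time `t`. -/
def energyDensity {𝕜 : Type*} [RCLike 𝕜] (d : ℕ) (ur ut : ℝ → ℝ → 𝕜) (t r : ℝ) : ℝ :=
  (‖ur t r‖ ^ 2 + ‖ut t r‖ ^ 2) * r ^ (d - 1)

/-- The exterior energy `∫_{r ≥ |t| + R} |∇_{t,x} u|² r^{d-1} dr` at time `t`. -/
def extEnergy {𝕜 : Type*} [RCLike 𝕜] (d : ℕ) (R : ℝ) (ur ut : ℝ → ℝ → 𝕜) (t : ℝ) : ℝ :=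
  ∫ r in Set.Ici (|t| + R), energyDensity d ur ut t r

/-- The measure `r^{d-1} dr` on `r ≥ R`. -/
def extMeasure (d : ℕ) (R : ℝ) : Measure ℝ :=
  (volume.restrict (Set.Ici R)).withDensity (fun r => ENNReal.ofReal (r ^ (d - 1)))

/-- The Hilbert space `(Ḣ¹ × L²)(r ≥ R; r^{d-1} dr)`.  Since the `Ḣ¹` norm of `f` is the `L²` norm
of `f_r`, the pair `(f, g)` is represented by `(f_r, g) ∈ L² × L²`. -/
abbrev ExtSpace (𝕜 : Type*) [RCLike 𝕜] (d : ℕ) (R : ℝ) : Type _ :=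
  WithLp 2 (Lp 𝕜 2 (extMeasure d R) × Lp 𝕜 2 (extMeasure d R))

/-- The element `(f, g)` of `(Ḣ¹ × L²)(r ≥ R; r^{d-1} dr)`, where `fr = ∂_r f`. -/
def toExt {𝕜 : Type*} [RCLike 𝕜] {d : ℕ} {R : ℝ} {fr g : ℝ → 𝕜}
    (hf : MemLp fr 2 (extMeasure d R)) (hg : MemLp g 2 (extMeasure d R)) : ExtSpace 𝕜 d R :=
  WithLp.toLp 2 (hf.toLp fr, hg.toLp g)

/-- The function `r ↦ r^{2k-d}`. -/
def powFun (d k : ℕ) (r : ℝ) : ℝ := r ^ (2 * (k : ℤ) - (d : ℤ))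

theorem memLp_zpow (𝕜 : Type*) [RCLike 𝕜] {d : ℕ} (hd : Odd d) {R : ℝ} (hR : 0 < R) (n : ℤ)
    (hn : 2 * n + d < 0) :
    MemLp (fun r : ℝ => ((r ^ n : ℝ) : 𝕜)) 2 (extMeasure d R) := by
  have hmeas : Measurable (fun r : ℝ => ((r ^ n : ℝ) : 𝕜)) :=
    RCLike.measurable_ofReal.comp (measurable_id.pow_const n)
  rw [memLp_two_iff_integrable_sq_norm hmeas.aestronglyMeasurable, extMeasure]
  have hdm : Measurable (fun r : ℝ => ENNReal.ofReal (r ^ (d - 1))) := by fun_prop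
  rw [integrable_withDensity_iff hdm (by simp)]
  have hI : IntegrableOn (fun r : ℝ => r ^ (((2 * n + d - 1 : ℤ)) : ℝ)) (Set.Ici R) :=
    integrableOn_Ici_iff_integrableOn_Ioi (by simp) |>.mpr
      (integrableOn_Ioi_rpow_of_lt (by exact_mod_cast (by omega)) hR)
  refine hI.congr_fun (fun r hr => ?_) measurableSet_Ici
  have hr0 : 0 < r := hR.trans_le hr
  have h1 : ((d - 1 : ℕ) : ℤ) = d - 1 := by
    have := hd.pos
    omega
  simp only [RCLike.norm_ofReal]
  rw [ENNReal.toReal_ofReal (by positivity), sq_abs, Real.rpow_intCast, ← zpow_natCast r (d - 1),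
    h1, ← zpow_natCast (r ^ n) 2, ← zpow_mul, ← zpow_add₀ hr0.ne']
  congr 1
  push_cast
  ring

theorem memLp_powFun (𝕜 : Type*) [RCLike 𝕜] {d : ℕ} (hd : Odd d) {R : ℝ} (hR : 0 < R) {k : ℕ}
    (hk : k ∈ Set.Icc 1 (d / 4)) :
    MemLp (fun r : ℝ => ((powFun d k r : ℝ) : 𝕜)) 2 (extMeasure d R) := by
  refine memLp_zpow 𝕜 hd hR _ ?_
  obtain ⟨m, rfl⟩ := hd
  have := hk.2
  omega

theorem memLp_deriv_powFun (𝕜 : Type*) [RCLike 𝕜] {d : ℕ} (hd : Odd d) {R : ℝ} (hR : 0 < R) {k : ℕ}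
    (hk : k ∈ Set.Icc 1 ((d + 2) / 4)) :
    MemLp (fun r : ℝ => ((deriv (powFun d k) r : ℝ) : 𝕜)) 2 (extMeasure d R) := by
  have h := (memLp_zpow 𝕜 hd hR (2 * (k : ℤ) - d - 1) (by
    obtain ⟨m, rfl⟩ := hd
    have := hk.2
    omega)).const_mul ((((2 * (k : ℤ) - d : ℤ) : ℝ)) : 𝕜)
  convert h using 2 with r
  have : deriv (powFun d k) r = ((2 * (k : ℤ) - d : ℤ) : ℝ) * r ^ (2 * (k : ℤ) - d - 1) :=
    deriv_zpow _ _
  rw [this, RCLike.ofReal_mul]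

theorem memLp_null (𝕜 : Type*) [RCLike 𝕜] (d : ℕ) (R : ℝ) :
    MemLp (fun _ : ℝ => (0 : 𝕜)) 2 (extMeasure d R) := MemLp.zero'

/-- The subspace `P(R)` of `(Ḣ¹ × L²)(r ≥ R; r^{d-1} dr)` spanned by the pairs `(r^{2k-d}, 0)`,
`1 ≤ k ≤ ⌊(d+2)/4⌋`, and `(0, r^{2k-d})`, `1 ≤ k ≤ ⌊d/4⌋`. -/
def P (𝕜 : Type*) [RCLike 𝕜] {d : ℕ} (hd : Odd d) {R : ℝ} (hR : 0 < R) :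
    Submodule 𝕜 (ExtSpace 𝕜 d R) :=
  Submodule.span 𝕜
    (Set.range (fun k : Set.Icc 1 ((d + 2) / 4) =>
        toExt (memLp_deriv_powFun 𝕜 hd hR k.2) (memLp_null 𝕜 d R)) ∪
      Set.range (fun k : Set.Icc 1 (d / 4) =>
        toExt (memLp_null 𝕜 d R) (memLp_powFun 𝕜 hd hR k.2)))

instance instFiniteDimensionalP (𝕜 : Type*) [RCLike 𝕜] {d : ℕ} (hd : Odd d) {R : ℝ} (hR : 0 < R) :
    FiniteDimensional 𝕜 (P 𝕜 hd hR) :=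
  FiniteDimensional.span_of_finite 𝕜 ((Set.finite_range _).union (Set.finite_range _))

/-- The orthogonal projection `π_{P(R)}^⊥` onto the orthogonal complement of `P(R)`. -/
def projPerp (𝕜 : Type*) [RCLike 𝕜] {d : ℕ} (hd : Odd d) {R : ℝ} (hR : 0 < R) :
    ExtSpace 𝕜 d R →L[𝕜] ExtSpace 𝕜 d R :=
  ((P 𝕜 hd hR)ᗮ).starProjection

end RadialWave

end

/-! Write d = 2m+1, A = r^m ∂_r u, B = r^m ∂_t u and N = r⁻¹∂_r. On r > 0 the pair (A, B) solves ∂_t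
A = (∂_r - m/r)B, ∂_t B = (∂_r + m/r)A weakly in L²(dr). Since N^m intertwines ∂_r² with the radial
Laplacian (`conj_D_mul_N_pow`), the quantity ⟨r^(m+1) N^(m+1) φ_t, A(t)⟩ - ⟨r^m N^m ∂_r φ_t, B(t)⟩
with φ_t(r) = φ(r-t) is conserved (`hasDerivAt_pairing`).

The sharp constant comes from the identity ‖r^n N^n φ‖ = ‖∂_r^n φ‖ in L²
(`integral_norm_sq_xpow_mul_N_pow`). It makes ∂_r^n φ ↦ r^n N^n φ extend to an isometry T_n of L²(ρ,
∞). The orthogonal complement of its range is spanned by the square-integrable ones among the powers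
r^(2j+1-n), j < n. For n = m+1 and n = m these are, after multiplication by r^m, exactly the
generators of P(R), whence ‖π^⊥(f, g)‖² = ‖T_{m+1}^* A‖² + ‖T_m^* B‖² at time 0
(`norm_sq_projPerp`).

Let F = T_{m+1}^* A - T_m^* B on r > R+t, and let F' be the same with B replaced by -B. By
conservation ‖F‖ does not depend on t ≥ 0 (`norm_radiation_eq`), while ‖F'‖ at time t is at most its
value for the initial data on r > R+2t, which tends to 0 (`tendsto_norm_radiation_neg`). By
Pythagoras and the parallelogram law the exterior energy is (‖F‖² + ‖F'‖²)/2 plus the squared norms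
of the components of A and B orthogonal to the ranges of T_{m+1} and T_m. Those components lie in a
finite-dimensional, scale-invariant family, so they cannot concentrate near r = R+t; away from that
boundary the energy disappears because exterior energy decreases along cones (`exteriorEnergy_le`).
Hence they tend to 0 (`tendsto_norm_defect`).

So L₊ = ‖F(0)‖²/2, and by time reversal L₋ = ‖F'(0)‖²/2. Their sum is ‖π^⊥(f, g)‖², so the maximum
is at least half of it and vanishes only if the projection does. If f or g is zero, then L₊ = L₋ and
the maximum is exactly half the sum. -/

noncomputable section

namespace RadialWave

open Set

set_option autoImplicit false

/-! ### Test functions on (0, ∞) and the operators ∂_r, r^k, r⁻¹∂_r. -/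

section

section TestFunctions

variable (𝕜 : Type*) [RCLike 𝕜]

/-- The space `C_c^∞((0, ∞); 𝕜)`, extended by zero to the real line, as a space of functions. -/
def testSubmodule : Submodule 𝕜 (ℝ → 𝕜) where
  carrier := {φ | ContDiff ℝ ∞ φ ∧ HasCompactSupport φ ∧ tsupport φ ⊆ Ioi 0}
  add_mem' := fun {φ ψ} hφ hψ => ⟨hφ.1.add hψ.1, hφ.2.1.add hψ.2.1,
    (tsupport_add φ ψ).trans (union_subset hφ.2.2 hψ.2.2)⟩
  zero_mem' := ⟨contDiff_const, HasCompactSupport.zero, by simp [tsupport]⟩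
  smul_mem' := fun c φ hφ => ⟨contDiff_const.smul hφ.1, hφ.2.1.smul_left (f := fun _ => c),
    (tsupport_smul_subset_right (fun _ => c) φ).trans hφ.2.2⟩

/-- The space `C_c^∞((0, ∞); 𝕜)`. -/
def Test : Type _ := testSubmodule 𝕜

variable {𝕜}

namespace Test

instance : AddCommGroup (Test 𝕜) := inferInstanceAs (AddCommGroup (testSubmodule 𝕜))
instance : Module 𝕜 (Test 𝕜) := inferInstanceAs (Module 𝕜 (testSubmodule 𝕜))
instance : FunLike (Test 𝕜) ℝ 𝕜 where
  coe φ := φ.1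
  coe_injective _ _ h := Subtype.ext h

/-- Bundle a smooth function with compact support in `(0, ∞)`. -/
def mk (φ : ℝ → 𝕜) (h : ContDiff ℝ ∞ φ) (h' : HasCompactSupport φ) (h'' : tsupport φ ⊆ Ioi 0) :
    Test 𝕜 := ⟨φ, h, h', h''⟩

@[simp] theorem add_apply (φ ψ : Test 𝕜) (r : ℝ) : (φ + ψ) r = φ r + ψ r := rfl
@[simp] theorem sub_apply (φ ψ : Test 𝕜) (r : ℝ) : (φ - ψ) r = φ r - ψ r := rfl
@[simp] theorem smul_apply (c : 𝕜) (φ : Test 𝕜) (r : ℝ) : (c • φ) r = c * φ r := rfl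
@[ext] theorem ext {φ ψ : Test 𝕜} (h : ∀ r, φ r = ψ r) : φ = ψ := DFunLike.ext _ _ h

theorem contDiff (φ : Test 𝕜) : ContDiff ℝ ∞ φ := φ.2.1
theorem hasCompactSupport (φ : Test 𝕜) : HasCompactSupport φ := φ.2.2.1
theorem tsupport_subset (φ : Test 𝕜) : tsupport φ ⊆ Ioi 0 := φ.2.2.2
theorem continuous (φ : Test 𝕜) : Continuous φ := φ.contDiff.continuous
theorem differentiable (φ : Test 𝕜) : Differentiable ℝ φ := φ.contDiff.differentiable (by simp)

theorem eq_zero_of_nonpos (φ : Test 𝕜) {r : ℝ} (hr : r ≤ 0) : φ r = 0 := by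
  by_contra h
  exact absurd (φ.tsupport_subset (subset_tsupport _ h)) (not_lt.2 hr)

theorem integrable (φ : Test 𝕜) : Integrable φ :=
  φ.continuous.integrable_of_hasCompactSupport φ.hasCompactSupport

theorem memLp (φ : Test 𝕜) (μ : Measure ℝ) [IsFiniteMeasureOnCompacts μ] (p : ℝ≥0∞) :
    MemLp φ p μ :=
  φ.continuous.memLp_of_hasCompactSupport φ.hasCompactSupport

/-- The derivative of a test function. -/
def D : Module.End 𝕜 (Test 𝕜) where
  toFun φ := mk (deriv φ) (contDiff_infty_iff_deriv.1 φ.contDiff).2 φ.hasCompactSupport.deriv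
    (tsupport_deriv_subset.trans φ.tsupport_subset)
  map_add' φ ψ := by
    ext r
    exact deriv_add (φ.differentiable r) (ψ.differentiable r)
  map_smul' c φ := by
    ext r
    exact deriv_const_smul c (φ.differentiable r)

@[simp] theorem coe_D (φ : Test 𝕜) : ⇑(D φ) = deriv φ := rfl

theorem hasDerivAt (φ : Test 𝕜) (r : ℝ) : HasDerivAt φ (D φ r) r :=
  (φ.differentiable r).hasDerivAt

theorem contDiff_of_contDiffAt_tsupport {f : ℝ → 𝕜} (h : ∀ r ∈ tsupport f, ContDiffAt ℝ ∞ f r) :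
    ContDiff ℝ ∞ f := by
  refine contDiff_iff_contDiffAt.2 fun r => ?_
  by_cases hr : r ∈ tsupport f
  · exact h r hr
  · exact contDiffAt_const.congr_of_eventuallyEq (notMem_tsupport_iff_eventuallyEq.1 hr)

theorem contDiffAt_zpow {k : ℤ} {r : ℝ} (hr : r ≠ 0) : ContDiffAt ℝ ∞ (fun x : ℝ => x ^ k) r := by
  cases k with
  | ofNat n => simpa using contDiffAt_id.pow n
  | negSucc n =>
    simp only [zpow_negSucc]
    exact (contDiffAt_id.pow (n + 1)).inv (pow_ne_zero _ hr)

theorem tsupport_zpow_smul_subset (k : ℤ) (φ : Test 𝕜) :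
    tsupport (fun r : ℝ => (r ^ k) • φ r) ⊆ tsupport φ :=
  tsupport_smul_subset_right (fun r : ℝ => r ^ k) φ

/-- Multiplication of test functions by `r ^ k`. -/
def xpow (k : ℤ) : Module.End 𝕜 (Test 𝕜) where
  toFun φ := mk (fun r => (r ^ k) • φ r)
    (contDiff_of_contDiffAt_tsupport fun r hr =>
      (contDiffAt_zpow (φ.tsupport_subset (tsupport_zpow_smul_subset k φ hr)).ne').smul
        φ.contDiff.contDiffAt)
    (φ.hasCompactSupport.smul_left (f := fun r : ℝ => r ^ k))
    ((tsupport_zpow_smul_subset k φ).trans φ.tsupport_subset)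
  map_add' φ ψ := by
    ext r
    exact smul_add _ _ _
  map_smul' c φ := by
    ext r
    exact mul_smul_comm _ _ _ |>.symm

@[simp] theorem xpow_apply (k : ℤ) (φ : Test 𝕜) (r : ℝ) : xpow k φ r = (r ^ k) • φ r := rfl

/-- Test functions vanish for r ≤ 0, so identities involving negative powers of r need checking only
where r is invertible. -/
theorem ext_pos {φ ψ : Test 𝕜} (h : ∀ r : ℝ, 0 < r → φ r = ψ r) : φ = ψ := by
  ext r
  rcases le_or_gt r 0 with hr | hr
  · rw [φ.eq_zero_of_nonpos hr, ψ.eq_zero_of_nonpos hr]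
  · exact h r hr

theorem xpow_zero : (xpow 0 : Module.End 𝕜 (Test 𝕜)) = 1 := by
  ext φ r; simp

theorem xpow_mul_xpow (k l : ℤ) : (xpow k * xpow l : Module.End 𝕜 (Test 𝕜)) = xpow (k + l) := by
  ext1 φ
  refine ext_pos fun r hr => ?_
  simp [zpow_add₀ hr.ne', mul_smul]

theorem D_mul_xpow (k : ℤ) : (D * xpow k : Module.End 𝕜 (Test 𝕜)) = xpow k * D + (k : 𝕜) • xpow (k - 1) := by
  ext1 φ
  refine ext_pos fun r hr => ?_
  have h := (hasDerivAt_zpow k r (Or.inl hr.ne')).smul (φ.hasDerivAt r)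
  have : deriv (xpow k φ) r = _ := h.deriv
  simp only [Module.End.mul_apply, coe_D, LinearMap.add_apply, LinearMap.smul_apply, add_apply,
    smul_apply, xpow_apply] at this ⊢
  rw [this, RCLike.real_smul_eq_coe_mul, RCLike.real_smul_eq_coe_mul, RCLike.real_smul_eq_coe_mul]
  push_cast
  ring

theorem xpow_mul_xpow_assoc (k l : ℤ) (O : Module.End 𝕜 (Test 𝕜)) : xpow k * (xpow l * O) = xpow (k + l) * O := by
  rw [← mul_assoc, xpow_mul_xpow]

/-- The operator `r⁻¹ ∂_r`. -/
def N : Module.End 𝕜 (Test 𝕜) := xpow (-1) * D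

theorem integral_D (φ : Test 𝕜) : ∫ r, D φ r = 0 :=
  integral_eq_zero_of_hasDerivAt_of_integrable φ.hasDerivAt (D φ).integrable φ.integrable

/-- Local operators do not enlarge the support. -/
def IsLocal (O : Module.End 𝕜 (Test 𝕜)) : Prop :=
  ∀ φ, tsupport (O φ) ⊆ tsupport φ

theorem IsLocal.mul {O O' : Module.End 𝕜 (Test 𝕜)} (h : IsLocal O) (h' : IsLocal O') :
    IsLocal (O * O') := fun φ => (h (O' φ)).trans (h' φ)

theorem IsLocal.pow {O : Module.End 𝕜 (Test 𝕜)} (h : IsLocal O) (n : ℕ) : IsLocal (O ^ n) := by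
  induction n with
  | zero => exact fun φ => subset_rfl
  | succ n ih => rw [pow_succ]; exact ih.mul h

theorem isLocal_D : IsLocal (D : Module.End 𝕜 (Test 𝕜)) := fun _ => tsupport_deriv_subset

theorem isLocal_xpow (k : ℤ) : IsLocal (xpow k : Module.End 𝕜 (Test 𝕜)) :=
  tsupport_zpow_smul_subset k

theorem isLocal_N : IsLocal (N : Module.End 𝕜 (Test 𝕜)) := (isLocal_xpow _).mul isLocal_D

/-- With θ = r∂_r, the conjugated derivatives are θ + 2m+1 and θ + 2m+3, and Nθ = (θ+2)N because N
is homogeneous of degree -2. Each passage through N raises the dimension by two. -/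
theorem N_mul_conj_D (m : ℕ) :
    (N * (xpow (-(2 * m)) * (D * xpow (2 * m + 1))) : Module.End 𝕜 (Test 𝕜)) =
      xpow (-(2 * m) - 2) * (D * xpow (2 * m + 3)) * N := by
  have h1 : (D * xpow (1 : ℤ) : Module.End 𝕜 (Test 𝕜)) = xpow 1 * D + 1 := by
    simpa [xpow_zero] using D_mul_xpow (𝕜 := 𝕜) 1
  have h2 : (xpow (-(2 * m)) * (D * xpow (2 * m + 1)) : Module.End 𝕜 (Test 𝕜)) =
      xpow 1 * D + ((2 * m + 1 : ℤ) : 𝕜) • 1 := by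
    rw [D_mul_xpow, mul_add, xpow_mul_xpow_assoc, mul_smul_comm, xpow_mul_xpow, ← xpow_zero]
    congr 3 <;> ring_nf
  have h3 : (xpow (-(2 * m) - 2) * (D * xpow (2 * m + 3)) : Module.End 𝕜 (Test 𝕜)) =
      xpow 1 * D + ((2 * m + 3 : ℤ) : 𝕜) • 1 := by
    rw [D_mul_xpow, mul_add, xpow_mul_xpow_assoc, mul_smul_comm, xpow_mul_xpow, ← xpow_zero]
    congr 3 <;> ring_nf
  have h4 : (N * (xpow 1 * D) : Module.End 𝕜 (Test 𝕜)) = D * D + N := by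
    rw [N, mul_assoc, ← mul_assoc D, h1, add_mul, mul_add, mul_assoc, xpow_mul_xpow_assoc]
    simp [xpow_zero]
  have h5 : (xpow 1 * D * N : Module.End 𝕜 (Test 𝕜)) = D * D - N := by
    rw [N, mul_assoc, ← mul_assoc D, D_mul_xpow, add_mul, mul_add, mul_assoc, xpow_mul_xpow_assoc,
      smul_mul_assoc, mul_smul_comm, xpow_mul_xpow_assoc]
    simp [xpow_zero, sub_eq_add_neg]
  rw [h2, h3, mul_add, add_mul, h4, h5, mul_smul_comm, smul_mul_assoc, mul_one, one_mul]
  push_cast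
  module

/-- The radial wave operator is intertwined by `(r⁻¹ ∂_r)^m` with `∂_r²`. -/
theorem conj_D_mul_N_pow (m : ℕ) :
    (xpow (-(2 * m)) * (D * xpow (2 * m + 1)) * N ^ (m + 1) : Module.End 𝕜 (Test 𝕜)) = N ^ m * D * D := by
  induction m with
  | zero => simp [xpow_zero, N, ← mul_assoc, xpow_mul_xpow, mul_assoc D (xpow 1)]
  | succ m ih =>
    have h := N_mul_conj_D (𝕜 := 𝕜) m
    have e : (N ^ (m + 1) * D * D : Module.End 𝕜 (Test 𝕜)) = N * (N ^ m * D * D) := by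
      rw [pow_succ']
      simp only [mul_assoc]
    have e1 : (-(2 * ((m + 1 : ℕ) : ℤ))) = -(2 * m) - 2 := by push_cast; ring
    have e2 : (2 * ((m + 1 : ℕ) : ℤ) + 1) = 2 * m + 3 := by push_cast; ring
    rw [e, ← ih, ← mul_assoc N, h, e1, e2, pow_succ' N (m + 1), mul_assoc _ N]

/-- Together with `D_sub_mul`, this gives the two cancellations behind the conserved pairing: the
spatial operators of the system send one component of the test pair to the r-derivative of the
other. -/
theorem D_add_mul (m : ℕ) :
    ((D + (m : 𝕜) • xpow (-1)) * xpow (m + 1) * N ^ (m + 1) : Module.End 𝕜 (Test 𝕜)) =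
      xpow m * N ^ m * D * D := by
  rw [mul_assoc (xpow m), mul_assoc (xpow m), ← conj_D_mul_N_pow, ← mul_assoc (xpow m), ← mul_assoc (xpow m),
    xpow_mul_xpow, D_mul_xpow, mul_add, ← mul_assoc, xpow_mul_xpow, add_mul, D_mul_xpow, smul_mul_assoc, xpow_mul_xpow,
    mul_smul_comm, xpow_mul_xpow]
  congr 1
  have e1 : (m + (-(2 * m)) + (2 * m + 1) : ℤ) = m + 1 := by ring
  have e2 : (m + (-(2 * m)) + (2 * m + 1 - 1) : ℤ) = m := by ring
  have e3 : (m + 1 - 1 : ℤ) = m := by ring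
  have e4 : (-1 + (m + 1) : ℤ) = m := by ring
  rw [e1, e2, e3, e4, add_assoc, ← add_smul]
  push_cast
  ring_nf

theorem D_sub_mul (m : ℕ) :
    ((D - (m : 𝕜) • xpow (-1)) * xpow m * N ^ m * D : Module.End 𝕜 (Test 𝕜)) =
      xpow (m + 1) * N ^ (m + 1) * D := by
  rw [sub_mul, D_mul_xpow, smul_mul_assoc, xpow_mul_xpow, show (-1 + m : ℤ) = m - 1 by ring]
  simp only [Int.cast_natCast, add_sub_cancel_right]
  rw [pow_succ', N, ← mul_assoc, ← mul_assoc, xpow_mul_xpow]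
  simp

end Test
end TestFunctions

end

/-! ### The Euler operator and the identity ‖r^n (r⁻¹∂_r)^n φ‖ = ‖∂_r^n φ‖. -/

section

namespace Test

variable {𝕜 : Type*} [RCLike 𝕜]

/-- The Euler operator `r ∂_r`. -/
def euler : Module.End 𝕜 (Test 𝕜) := xpow 1 * D

/-- The formal adjoint of θ + a on L²(dr) is -(θ + 1 - a), which commutes with it. Concretely, the
two integrands differ by (2a - 1) times the derivative of r|φ|². -/
theorem integral_norm_sq_euler_add (a : ℝ) (φ : Test 𝕜) :
    ∫ r, ‖(euler φ + (a : 𝕜) • φ) r‖ ^ 2 = ∫ r, ‖(euler φ + ((1 - a : ℝ) : 𝕜) • φ) r‖ ^ 2 := by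
  have hint : ∀ ψ : Test 𝕜, Integrable fun r => ‖ψ r‖ ^ 2 := fun ψ =>
    (memLp_two_iff_integrable_sq_norm ψ.continuous.aestronglyMeasurable).1 (ψ.memLp volume 2)
  have hd : ∀ r : ℝ, HasDerivAt (fun r : ℝ => r * ‖φ r‖ ^ 2)
      (1 * ‖φ r‖ ^ 2 + r * (2 * inner ℝ (φ r) (D φ r))) r := fun r =>
    (hasDerivAt_id r).mul (φ.hasDerivAt r).norm_sq
  have hpt : ∀ (b r : ℝ), ‖(euler φ + (b : 𝕜) • φ) r‖ ^ 2 =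
      r ^ 2 * ‖D φ r‖ ^ 2 + 2 * b * r * inner ℝ (φ r) (D φ r) + b ^ 2 * ‖φ r‖ ^ 2 := by
    intro b r
    have : (euler φ + (b : 𝕜) • φ) r = r • D φ r + b • φ r := by
      simp [euler, RCLike.real_smul_eq_coe_mul]
    rw [this, norm_add_sq_real, norm_smul, norm_smul, real_inner_smul_left, real_inner_smul_right,
      real_inner_comm, mul_pow, mul_pow, Real.norm_eq_abs, Real.norm_eq_abs, sq_abs, sq_abs]
    ring
  have hcs : Continuous fun r : ℝ => r * (2 * inner ℝ (φ r) (D φ r)) :=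
    continuous_id.mul (continuous_const.mul (φ.continuous.inner (D φ).continuous))
  have hI : Integrable fun r : ℝ => r * (2 * inner ℝ (φ r) (D φ r)) := by
    refine hcs.integrable_of_hasCompactSupport (φ.hasCompactSupport.mono fun r hr => ?_)
    simp only [Function.mem_support] at hr ⊢
    rintro h
    simp [h] at hr
  have hcs2 : Continuous fun r : ℝ => r * ‖φ r‖ ^ 2 :=
    continuous_id.mul (φ.continuous.norm.pow 2)
  have hI2 : Integrable fun r : ℝ => r * ‖φ r‖ ^ 2 := by
    refine hcs2.integrable_of_hasCompactSupport (φ.hasCompactSupport.mono fun r hr => ?_)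
    simp only [Function.mem_support] at hr ⊢
    rintro h
    simp [h] at hr
  have h0 : ∫ r : ℝ, (1 * ‖φ r‖ ^ 2 + r * (2 * inner ℝ (φ r) (D φ r))) = 0 :=
    integral_eq_zero_of_hasDerivAt_of_integrable hd (((hint φ).const_mul 1).add hI) hI2
  rw [← sub_eq_zero, ← integral_sub (hint _) (hint _)]
  calc _ = ∫ r : ℝ, (2 * a - 1) * (1 * ‖φ r‖ ^ 2 + r * (2 * inner ℝ (φ r) (D φ r))) := by
        congr 1 with r
        rw [hpt, hpt]
        ring
    _ = 0 := by rw [integral_const_mul, h0, mul_zero]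

open Polynomial in
theorem integral_norm_sq_aeval_mul (a : ℝ) (p : 𝕜[X]) (φ : Test 𝕜) :
    ∫ r, ‖aeval euler ((X + C (a : 𝕜)) * p) φ r‖ ^ 2 =
      ∫ r, ‖aeval euler ((X + C ((1 - a : ℝ) : 𝕜)) * p) φ r‖ ^ 2 := by
  have := integral_norm_sq_euler_add a (aeval euler p φ)
  have h : ∀ b : 𝕜, aeval euler ((X + C b) * p) φ =
      euler (aeval euler p φ) + b • aeval euler p φ := fun b => by
    simp [add_mul, Module.algebraMap_end_apply]
  rwa [h, h]

open Polynomial in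
theorem integral_norm_sq_aeval_prod (a : ℕ → ℝ) (n : ℕ) (p : 𝕜[X]) (φ : Test 𝕜) :
    ∫ r, ‖aeval euler ((∏ k ∈ Finset.range n, (X + C (a k : 𝕜))) * p) φ r‖ ^ 2 =
      ∫ r, ‖aeval euler ((∏ k ∈ Finset.range n, (X + C ((1 - a k : ℝ) : 𝕜))) * p) φ r‖ ^ 2 := by
  induction n generalizing p with
  | zero => simp
  | succ n ih =>
    rw [Finset.prod_range_succ, Finset.prod_range_succ, mul_assoc, ih, mul_left_comm,
      integral_norm_sq_aeval_mul, mul_left_comm, mul_assoc]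

open Polynomial in
-- Each factor θ + a may be replaced by θ + 1 - a without changing the norm. In the induction,
-- reflecting all n+1 factors produces the product for n times θ - n; the induction hypothesis
-- treats the former and a last reflection turns θ - n into θ + n + 1.
theorem integral_norm_sq_aeval_step (n : ℕ) (φ : Test 𝕜) :
    ∫ r, ‖aeval euler (∏ k ∈ Finset.range n, (X + C ((n - 2 * k : ℝ) : 𝕜))) φ r‖ ^ 2 =
      ∫ r, ‖aeval euler (∏ k ∈ Finset.range n, (X + C ((n - k : ℝ) : 𝕜))) φ r‖ ^ 2 := by
  induction n generalizing φ with
  | zero => simp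
  | succ n ih =>
    have h1 := integral_norm_sq_aeval_prod (𝕜 := 𝕜)
      (fun k => ((n + 1 : ℕ) : ℝ) - 2 * k) (n + 1) 1 φ
    rw [mul_one, mul_one] at h1
    rw [h1, ← Finset.prod_range_reflect]
    have h2 : ∏ j ∈ Finset.range (n + 1), (X + C ((1 - (((n + 1 : ℕ) : ℝ) - 2 *
        ((n + 1 - 1 - j : ℕ) : ℝ)) : ℝ) : 𝕜)) =
        (∏ k ∈ Finset.range n, (X + C ((n - 2 * k : ℝ) : 𝕜))) * (X + C ((-n : ℝ) : 𝕜)) := by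
      rw [← show ((n : ℝ) - 2 * n) = -n by ring,
        ← Finset.prod_range_succ (fun k : ℕ => (X + C ((n - 2 * k : ℝ) : 𝕜)))]
      refine Finset.prod_congr rfl fun k hk => ?_
      have : k ≤ n := Nat.lt_succ_iff.1 (Finset.mem_range.1 hk)
      congr 3
      rw [Nat.add_sub_cancel, Nat.cast_sub this]
      push_cast
      ring
    have h3 := ih (aeval euler ((X : 𝕜[X]) + C ((-n : ℝ) : 𝕜)) φ)
    rw [← Module.End.mul_apply, ← Module.End.mul_apply, ← map_mul, ← map_mul] at h3
    rw [h2, h3, mul_comm, integral_norm_sq_aeval_mul, Finset.prod_range_succ']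
    rw [mul_comm]
    have h4 : ∀ k : ℕ, ((n + 1 : ℕ) : ℝ) - (k + 1 : ℕ) = n - k := fun k => by push_cast; ring
    have h5 : ((n + 1 : ℕ) : ℝ) - (0 : ℕ) = 1 - -n := by push_cast; ring
    simp only [h4, h5]

open Polynomial in
-- This iterates r^j θ = (θ - j) r^j.
theorem xpow_mul_aeval_prod (j : ℤ) (a : ℕ → 𝕜) (n : ℕ) :
    (xpow j * aeval euler (∏ k ∈ Finset.range n, (X + C (a k))) : Module.End 𝕜 (Test 𝕜)) =
      aeval euler (∏ k ∈ Finset.range n, (X + C (a k - j))) * xpow j := by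
  induction n with
  | zero => simp
  | succ n ih =>
    rw [Finset.prod_range_succ, Finset.prod_range_succ, map_mul, map_mul, ← mul_assoc, ih,
      mul_assoc, mul_assoc]
    congr 1
    have h : (euler * xpow j : Module.End 𝕜 (Test 𝕜)) =
        xpow j * euler + (j : 𝕜) • xpow j := by
      rw [euler, mul_assoc, D_mul_xpow, mul_add, xpow_mul_xpow_assoc, mul_smul_comm, xpow_mul_xpow, xpow_mul_xpow_assoc,
        add_comm 1 j]
      congr 3
      ring
    simp only [map_add, aeval_X, aeval_C, mul_add, add_mul, h, Algebra.algebraMap_eq_smul_one,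
      mul_smul_comm, smul_mul_assoc, mul_one, one_mul, sub_mul, sub_smul]
    abel

open Polynomial in
-- Since r^(1-c)∂_r = r^(-c)θ, collecting the powers of r on the left shifts the successive Euler
-- factors by multiples of c. The case c = 1 describes ∂_r^n and c = 2 describes N^n.
theorem pow_eq_xpow_mul_aeval (c : ℤ) (n : ℕ) :
    ((xpow (1 - c) * D) ^ n : Module.End 𝕜 (Test 𝕜)) =
      xpow (-(c * n)) * aeval euler (∏ k ∈ Finset.range n, (X + C (-(c * k : 𝕜)))) := by
  induction n with
  | zero => simp [xpow_zero]
  | succ n ih =>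
    rw [pow_succ', ih, Finset.prod_range_succ_comm, map_mul, mul_assoc, ← mul_assoc D, D_mul_xpow,
      ← mul_assoc, ← mul_assoc]
    congr 1
    simp only [map_add, aeval_X, aeval_C, mul_add, Algebra.algebraMap_eq_smul_one, mul_smul_comm,
      mul_one, xpow_mul_xpow, euler, xpow_mul_xpow_assoc]
    push_cast
    congr! 3
    · ring
    · ring

/-- The operators `r^n (r⁻¹ ∂_r)^n` and `∂_r^n` have the same `L²` norms. -/
theorem integral_norm_sq_xpow_mul_N_pow (n : ℕ) (φ : Test 𝕜) :
    ∫ r, ‖xpow n ((N ^ n) φ) r‖ ^ 2 = ∫ r, ‖(D ^ n) φ r‖ ^ 2 := by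
  have hN := pow_eq_xpow_mul_aeval (𝕜 := 𝕜) 2 n
  have hD := pow_eq_xpow_mul_aeval (𝕜 := 𝕜) 1 n
  have e : (xpow n * N ^ n : Module.End 𝕜 (Test 𝕜)) = _ := congrArg (xpow (n : ℤ) * ·) hN
  simp only [sub_self, xpow_zero, one_mul] at hD
  simp only [xpow_mul_xpow_assoc, show (n + -(2 * n) : ℤ) = -n by ring] at e
  rw [xpow_mul_aeval_prod] at e hD
  have e2 : ∀ k : ℕ, (-(((2 : ℤ) : 𝕜) * k) - ((-n : ℤ) : 𝕜)) = ((n - 2 * k : ℝ) : 𝕜) := fun k => by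
    push_cast; ring
  have e3 : ∀ k : ℕ, (-(((1 : ℤ) : 𝕜) * k) - ((-n : ℤ) : 𝕜)) = ((n - k : ℝ) : 𝕜) := fun k => by
    push_cast; ring
  simp only [e2, e3] at e hD
  rw [← Module.End.mul_apply, e, hD, Module.End.mul_apply, Module.End.mul_apply]
  exact integral_norm_sq_aeval_step n (xpow (-(n : ℤ)) φ)

end Test

end

/-! ### Moments, and functionals that annihilate the range of (r^(1-c)∂_r)^n. -/

section

namespace Test

variable {𝕜 : Type*} [RCLike 𝕜]

/-- Test functions supported in `(ρ, ∞)`. -/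
def supportedOn (𝕜 : Type*) [RCLike 𝕜] (ρ : ℝ) : Submodule 𝕜 (Test 𝕜) where
  carrier := {φ | tsupport φ ⊆ Ioi ρ}
  add_mem' := fun {φ ψ} hφ hψ => (tsupport_add φ ψ).trans (union_subset hφ hψ)
  zero_mem' := by
    change tsupport (0 : ℝ → 𝕜) ⊆ _
    simp [tsupport]
  smul_mem' := fun c φ hφ => (tsupport_smul_subset_right (fun _ => c) φ).trans hφ

theorem mem_supportedOn {ρ : ℝ} {φ : Test 𝕜} : φ ∈ supportedOn 𝕜 ρ ↔ tsupport φ ⊆ Ioi ρ := Iff.rfl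

theorem IsLocal.mem {O : Module.End 𝕜 (Test 𝕜)} (h : IsLocal O) {ρ : ℝ} {φ : Test 𝕜}
    (hφ : φ ∈ supportedOn 𝕜 ρ) : O φ ∈ supportedOn 𝕜 ρ := (h φ).trans hφ

theorem exists_tsupport_subset_Icc {ρ : ℝ} {φ : Test 𝕜} (hφ : φ ∈ supportedOn 𝕜 ρ) :
    ∃ a b, ρ < a ∧ a ≤ b ∧ tsupport φ ⊆ Icc a b := by
  rcases (tsupport φ).eq_empty_or_nonempty with h | h
  · exact ⟨ρ + 1, ρ + 1, by linarith, le_rfl, by simp [h]⟩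
  · have hc : IsCompact (tsupport φ) := φ.hasCompactSupport
    obtain ⟨a, ha⟩ := hc.exists_isLeast h
    obtain ⟨b, hb⟩ := hc.exists_isGreatest h
    exact ⟨a, b, hφ ha.1, ha.2 hb.1, fun x hx => ⟨ha.2 hx, hb.2 hx⟩⟩

/-- The primitive starting at 0 vanishes to the left of the support of θ; to the right it equals the
total integral, so it has compact support exactly because that integral is zero. -/
theorem exists_D_eq {ρ : ℝ} (hρ : 0 ≤ ρ) {θ : Test 𝕜} (hθ : θ ∈ supportedOn 𝕜 ρ)
    (h0 : ∫ r, θ r = 0) : ∃ φ ∈ supportedOn 𝕜 ρ, D φ = θ := by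
  obtain ⟨a, b, ha, hab, hsub⟩ := exists_tsupport_subset_Icc hθ
  have hz : ∀ x, x ∉ Icc a b → θ x = 0 := fun x hx => by
    by_contra h
    exact hx (hsub (subset_tsupport _ h))
  have hder : ∀ r, HasDerivAt (fun r => ∫ x in (0 : ℝ)..r, θ x) (θ r) r := fun r =>
    intervalIntegral.integral_hasDerivAt_right (θ.continuous.intervalIntegrable _ _)
      (θ.continuous.stronglyMeasurableAtFilter _ _) θ.continuous.continuousAt
  have hsupp : tsupport (fun r => ∫ x in (0 : ℝ)..r, θ x) ⊆ Icc a b := by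
    refine closure_minimal (fun r hr => ?_) isClosed_Icc
    by_contra hr'
    apply hr
    rcases lt_or_ge r a with h | h
    · refine intervalIntegral.integral_zero_ae (Eventually.of_forall fun x hx => hz x fun hx' => ?_)
      have h2 := hx.2
      have h3 := hx'.1
      rcases max_choice 0 r with h4 | h4 <;> rw [h4] at h2 <;> linarith
    · have hrb : b < r := by
        by_contra hb
        exact hr' ⟨h, not_lt.1 hb⟩
      change ∫ x in (0 : ℝ)..r, θ x = 0
      rw [intervalIntegral.integral_eq_integral_of_support_subset, h0]
      intro x hx
      have := hsub (subset_tsupport _ hx)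
      exact ⟨by linarith [this.1], by linarith [this.2]⟩
  refine ⟨mk (fun r => ∫ x in (0 : ℝ)..r, θ x) ?_ ?_ ?_, ?_, ?_⟩
  · refine contDiff_infty_iff_deriv.2 ⟨fun r => (hder r).differentiableAt, ?_⟩
    rw [show deriv (fun r => ∫ x in (0 : ℝ)..r, θ x) = θ from funext fun r => (hder r).deriv]
    exact θ.contDiff
  · exact HasCompactSupport.of_support_subset_isCompact isCompact_Icc
      ((subset_tsupport _).trans hsupp)
  · exact hsupp.trans fun x hx => lt_of_lt_of_le (by linarith) hx.1
  · exact hsupp.trans fun x hx => lt_of_lt_of_le ha hx.1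
  · ext r
    exact (hder r).deriv

/-- The moments `φ ↦ ∫ r^k φ(r) dr`. -/
def moment (k : ℤ) : Test 𝕜 →ₗ[𝕜] 𝕜 where
  toFun φ := ∫ r, xpow k φ r
  map_add' φ ψ := by
    rw [map_add]
    exact integral_add (xpow k φ).integrable (xpow k ψ).integrable
  map_smul' c φ := by
    rw [map_smul]
    exact integral_const_mul c _

theorem moment_apply (k : ℤ) (φ : Test 𝕜) : moment k φ = ∫ r, xpow k φ r := rfl

theorem moment_xpow (k l : ℤ) (φ : Test 𝕜) : moment k (xpow l φ) = moment (k + l) φ := by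
  rw [moment_apply, moment_apply, ← xpow_mul_xpow, Module.End.mul_apply]

theorem moment_D (k : ℤ) (φ : Test 𝕜) : moment k (D φ) = -(k * moment (k - 1) φ) := by
  have h := integral_D (xpow k φ)
  rw [← Module.End.mul_apply, D_mul_xpow] at h
  have h2 : moment k (D φ) + k * moment (k - 1) φ = 
      ∫ r, (xpow k * D + (k : 𝕜) • xpow (k - 1) : Module.End 𝕜 (Test 𝕜)) φ r := by
    rw [moment_apply, moment_apply, ← integral_const_mul]
    exact (integral_add (xpow k (D φ)).integrable (((k : 𝕜) • xpow (k - 1) φ).integrable)).symm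
  rw [h] at h2
  exact eq_neg_of_add_eq_zero_left h2

theorem exists_moment_zero_eq_one {ρ : ℝ} (hρ : 0 ≤ ρ) :
    ∃ η ∈ supportedOn 𝕜 ρ, moment 0 η = 1 := by
  let f : ContDiffBump (ρ + 2) := ⟨1 / 2, 1, by norm_num, by norm_num⟩
  have hs : tsupport (fun r => ((f.normed volume r : ℝ) : 𝕜)) ⊆ Metric.closedBall (ρ + 2) 1 := by
    refine (closure_mono ?_).trans (f.tsupport_normed_eq (μ := volume)).le
    intro x hx hx'
    exact hx (by simp [hx'])
  have hs' : tsupport (fun r => ((f.normed volume r : ℝ) : 𝕜)) ⊆ Ioi ρ := hs.trans fun x hx => by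
    rw [Metric.mem_closedBall, Real.dist_eq, abs_le] at hx
    simp only [mem_Ioi]
    linarith [hx.1]
  refine ⟨mk (fun r => ((f.normed volume r : ℝ) : 𝕜))
    ((RCLike.ofRealCLM (K := 𝕜)).contDiff.comp (f.contDiff_normed (μ := volume))) ?_ (hs'.trans (Ioi_subset_Ioi hρ)), hs', ?_⟩
  · exact HasCompactSupport.of_support_subset_isCompact (isCompact_closedBall _ _)
      ((subset_tsupport _).trans hs)
  · rw [moment_apply, xpow_zero]
    change ∫ r, ((f.normed volume r : ℝ) : 𝕜) = 1
    rw [integral_ofReal, f.integral_normed]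
    simp

/-- A functional annihilating derivatives is a multiple of the integral. -/
theorem exists_eq_mul_moment_zero {ρ : ℝ} (hρ : 0 ≤ ρ) (Λ : Test 𝕜 →ₗ[𝕜] 𝕜)
    (h : ∀ φ ∈ supportedOn 𝕜 ρ, Λ (D φ) = 0) :
    ∃ c : 𝕜, ∀ θ ∈ supportedOn 𝕜 ρ, Λ θ = c * moment 0 θ := by
  obtain ⟨η, hη, h1⟩ := exists_moment_zero_eq_one (𝕜 := 𝕜) hρ
  refine ⟨Λ η, fun θ hθ => ?_⟩
  have hm : θ - moment 0 θ • η ∈ supportedOn 𝕜 ρ :=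
    Submodule.sub_mem _ hθ (Submodule.smul_mem _ _ hη)
  have h0 : moment 0 (θ - moment 0 θ • η) = 0 := by simp [h1]
  rw [moment_apply, xpow_zero] at h0
  obtain ⟨φ, hφ, e⟩ := exists_D_eq hρ hm h0
  have := h φ hφ
  rw [e, map_sub, map_smul, sub_eq_zero, smul_eq_mul] at this
  rw [this, mul_comm]

/-- The operator `r^(1-c) ∂_r`. -/
def powOp (c : ℕ) : Module.End 𝕜 (Test 𝕜) := xpow (1 - c) * D

theorem powOp_one : (powOp 1 : Module.End 𝕜 (Test 𝕜)) = D := by simp [powOp, xpow_zero]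

theorem powOp_two : (powOp 2 : Module.End 𝕜 (Test 𝕜)) = N := rfl

/-- Each integration by parts lowers the exponent by c and yields a factor -c(n+1), nonzero as c ≠
0. The top moment of the n-th power thus retains the first obstruction to being in the range of one
more power. -/
theorem exists_moment_pow (c : ℕ) (hc : c ≠ 0) (n : ℕ) :
    ∃ κ : 𝕜, κ ≠ 0 ∧ ∀ φ : Test 𝕜,
      moment (c * n + c - 1) ((powOp c ^ n) φ) = κ * moment (c - 1) φ := by
  induction n with
  | zero => exact ⟨1, one_ne_zero, fun φ => by simp⟩
  | succ n ih =>
    obtain ⟨κ, hκ, h⟩ := ih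
    refine ⟨κ * -((c * (n + 1) : ℕ) : 𝕜), mul_ne_zero hκ (neg_ne_zero.2 ?_), fun φ => ?_⟩
    · exact Nat.cast_ne_zero.2 (mul_ne_zero hc n.succ_ne_zero)
    · rw [pow_succ', Module.End.mul_apply, powOp, Module.End.mul_apply, ← powOp, moment_xpow, moment_D]
      rw [show (c * ((n + 1 : ℕ) : ℤ) + c - 1 + (1 - c) - 1) = c * n + c - 1 by push_cast; ring, h,
        show (c * ((n + 1 : ℕ) : ℤ) + c - 1 + (1 - c)) = ((c * (n + 1) : ℕ) : ℤ) by push_cast; ring,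
        Int.cast_natCast]
      ring

/-- A functional annihilating the range of `(r^(1-c) ∂_r)^n` is given by a linear combination of
powers of `r`. -/
theorem exists_eq_sum_moment {ρ : ℝ} (hρ : 0 ≤ ρ) (c : ℕ) (hc : c ≠ 0) (n : ℕ)
    (Λ : Test 𝕜 →ₗ[𝕜] 𝕜)
    (h : ∀ φ ∈ supportedOn 𝕜 ρ, Λ ((powOp c ^ n) φ) = 0) :
    ∃ b : ℕ → 𝕜, ∀ θ ∈ supportedOn 𝕜 ρ,
      Λ θ = ∑ j ∈ Finset.range n, b j * moment (c * j + c - 1) θ := by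
  induction n generalizing Λ with
  | zero => exact ⟨0, fun θ hθ => by simpa using h θ hθ⟩
  | succ n ih =>
    obtain ⟨κ, hκ, hm⟩ := exists_moment_pow (𝕜 := 𝕜) c hc n
    -- Factoring r^(1-c)∂_r out of the (n+1)-st power on the right shows that this composite
    -- annihilates derivatives.
    obtain ⟨a, ha⟩ := exists_eq_mul_moment_zero hρ
      (Λ ∘ₗ (powOp c ^ n : Module.End 𝕜 (Test 𝕜)) ∘ₗ (xpow (1 - c)))
      (fun φ hφ => by simpa [pow_succ, powOp, mul_assoc] using h φ hφ)
    have hpow : IsLocal (xpow (c - 1) : Module.End 𝕜 (Test 𝕜)) := isLocal_xpow _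
    have ha' : ∀ θ ∈ supportedOn 𝕜 ρ,
        Λ ((powOp c ^ n) θ) = a * moment (c - 1) θ := fun θ hθ => by
      have := ha (xpow (c - 1) θ) (hpow.mem hθ)
      simp only [LinearMap.comp_apply, moment_xpow, zero_add] at this
      rw [← this, ← Module.End.mul_apply (xpow (1 - (c : ℤ))), xpow_mul_xpow]
      simp [xpow_zero]
    -- The coefficient a/κ is chosen so that the corrected functional annihilates the range of the
    -- n-th power.
    obtain ⟨b, hb⟩ := ih (Λ - (a / κ) • moment (c * n + c - 1)) fun φ hφ => by
      rw [LinearMap.sub_apply, LinearMap.smul_apply, hm, ha' φ hφ, smul_eq_mul]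
      field_simp
      simp
    refine ⟨Function.update b n (a / κ), fun θ hθ => ?_⟩
    rw [Finset.sum_range_succ, Function.update_self, Finset.sum_congr rfl fun j hj => by
      rw [Function.update_of_ne (Finset.mem_range.1 hj).ne], ← hb θ hθ]
    simp

/-- Each integration by parts lowers j by one, and at j = 0 it differentiates a constant. With j < n
there are enough derivatives to get there. -/
theorem moment_pow_eq_zero (c : ℕ) (n j : ℕ) (hj : j < n) (φ : Test 𝕜) :
    moment (c * j + c - 1) ((powOp c ^ n) φ) = (0 : 𝕜) := by
  induction n generalizing j with
  | zero => simp at hj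
  | succ n ih =>
    rw [pow_succ', Module.End.mul_apply, powOp, Module.End.mul_apply, ← powOp, moment_xpow, moment_D]
    cases j with
    | zero => simp
    | succ j =>
      rw [show (c * ((j + 1 : ℕ) : ℤ) + c - 1 + (1 - c) - 1) = c * j + c - 1 by push_cast; ring,
        ih j (by omega)]
      simp

end Test

/-- At infinity the highest power with nonzero coefficient dominates. If its exponent is
nonnegative, the sum stays bounded below in modulus there and is not square-integrable. -/
theorem eq_zero_of_memLp_sum_zpow {𝕜 : Type*} [RCLike 𝕜] {ρ : ℝ} (n : ℕ) (b : ℕ → 𝕜) (e : ℕ → ℤ)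
    (he : StrictMono e)
    (h : MemLp (fun r : ℝ => ∑ j ∈ Finset.range n, b j * ((r ^ e j : ℝ) : 𝕜)) 2
      (volume.restrict (Ioi ρ))) : ∀ j < n, 0 ≤ e j → b j = 0 := by
  induction n with
  | zero => intro j hj; omega
  | succ n ih =>
    by_cases hb : b n = 0
    · intro j hj hej
      simp only [Finset.sum_range_succ, hb, zero_mul, add_zero] at h
      rcases Nat.lt_succ_iff_lt_or_eq.1 hj with h' | h'
      · exact ih h j h' hej
      · rw [h', hb]
    · intro j hj hej
      exfalso
      have hen : 0 ≤ e n := hej.trans (he.monotone (Nat.lt_succ_iff.1 hj))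
      have ht : Tendsto (fun r : ℝ => ∑ j ∈ Finset.range (n + 1),
          b j * ((r ^ (e j - e n) : ℝ) : 𝕜)) atTop (𝓝 (b n)) := by
        rw [show b n = ∑ j ∈ Finset.range (n + 1), if j = n then b n else 0 by simp]
        refine tendsto_finsetSum _ fun i hi => ?_
        split_ifs with hin
        · subst hin; simp
        · have : i < n := lt_of_le_of_ne (Nat.lt_succ_iff.1 (Finset.mem_range.1 hi)) hin
          have h1 : Tendsto (fun r : ℝ => r ^ (e i - e n)) atTop (𝓝 0) :=
            tendsto_zpow_atTop_zero (by have := he this; omega)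
          have h2 : Tendsto (fun r : ℝ => ((r ^ (e i - e n) : ℝ) : 𝕜)) atTop (𝓝 ((0 : ℝ) : 𝕜)) :=
            (RCLike.continuous_ofReal.tendsto 0).comp h1
          simpa using h2.const_mul (b i)
      have hbn : 0 < ‖b n‖ := norm_pos_iff.2 hb
      have hev := (ht.norm.eventually (lt_mem_nhds (half_lt_self hbn))).and
        -- Requiring r ≥ 1 makes r^(e n) ≥ 1; requiring r ≥ ρ + 1 keeps the half-line inside (ρ, ∞).
        (eventually_ge_atTop (max 1 (ρ + 1)))
      obtain ⟨M, hM⟩ := eventually_atTop.1 hev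
      have hMρ : ρ < M := by
        have := (hM M le_rfl).2
        linarith [le_max_right 1 (ρ + 1)]
      have hsq := (memLp_two_iff_integrable_sq_norm h.1).1 h
      have hI : IntegrableOn (fun r : ℝ =>
          ‖∑ j ∈ Finset.range (n + 1), b j * ((r ^ e j : ℝ) : 𝕜)‖ ^ 2) (Ioi M) :=
        IntegrableOn.mono_set hsq (Ioi_subset_Ioi hMρ.le)
      have hc : IntegrableOn (fun _ : ℝ => (‖b n‖ / 2) ^ 2) (Ioi M) := by
        refine Integrable.mono' hI aestronglyMeasurable_const ?_
        filter_upwards [ae_restrict_mem measurableSet_Ioi] with r hr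
        obtain ⟨h1, h2⟩ := hM r (le_of_lt hr)
        have hr1 : 1 ≤ r := (le_max_left _ _).trans h2
        have hr0 : 0 < r := by linarith
        rw [Real.norm_eq_abs, abs_of_nonneg (by positivity)]
        have : ∑ j ∈ Finset.range (n + 1), b j * ((r ^ e j : ℝ) : 𝕜) =
            ((r ^ e n : ℝ) : 𝕜) * ∑ j ∈ Finset.range (n + 1), b j * ((r ^ (e j - e n) : ℝ) : 𝕜) := by
          rw [Finset.mul_sum]
          refine Finset.sum_congr rfl fun i _ => ?_
          rw [mul_left_comm, ← RCLike.ofReal_mul, ← zpow_add₀ hr0.ne']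
          congr 4
          ring
        rw [this, norm_mul, RCLike.norm_ofReal, abs_of_pos (by positivity)]
        have h3 : (1 : ℝ) ≤ r ^ e n := one_le_zpow₀ hr1 hen
        gcongr
        nlinarith [norm_nonneg (∑ j ∈ Finset.range (n + 1), b j * ((r ^ (e j - e n) : ℝ) : 𝕜))]
      rw [integrableOn_const_iff] at hc
      simp [hb] at hc

end

/-! ### The isometry T_n of L²(ρ, ∞) and the complement of its range. -/

section

open scoped InnerProduct

variable {𝕜 : Type*} [RCLike 𝕜]

/-- The space `L²(ρ, ∞)`. -/
abbrev L2Ioi (𝕜 : Type*) [RCLike 𝕜] (ρ : ℝ) : Type _ := Lp 𝕜 2 (volume.restrict (Ioi ρ))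

namespace Test

/-- The class of a test function in `L²(μ)`. -/
def toLp (μ : Measure ℝ) [IsFiniteMeasureOnCompacts μ] : Test 𝕜 →ₗ[𝕜] Lp 𝕜 2 μ where
  toFun φ := (φ.memLp μ 2).toLp φ
  map_add' _ _ := rfl
  map_smul' _ _ := rfl

theorem coeFn_toLp (μ : Measure ℝ) [IsFiniteMeasureOnCompacts μ] (φ : Test 𝕜) :
    toLp μ φ =ᵐ[μ] φ := MemLp.coeFn_toLp (φ.memLp μ 2)

theorem inner_toLp (μ : Measure ℝ) [IsFiniteMeasureOnCompacts μ] (φ : Test 𝕜) (A : Lp 𝕜 2 μ) :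
    inner 𝕜 (toLp μ φ) A = ∫ r, inner 𝕜 (φ r) (A r) ∂μ := by
  rw [L2.inner_def]
  refine integral_congr_ae ?_
  filter_upwards [coeFn_toLp μ φ] with r hr
  rw [hr]

theorem norm_sq_toLp (μ : Measure ℝ) [IsFiniteMeasureOnCompacts μ] (φ : Test 𝕜) :
    ‖toLp μ φ‖ ^ 2 = ∫ r, ‖φ r‖ ^ 2 ∂μ := by
  rw [← inner_self_eq_norm_sq (𝕜 := 𝕜), L2.inner_def, ← integral_re (L2.integrable_inner _ _)]
  refine integral_congr_ae ?_
  filter_upwards [coeFn_toLp μ φ] with r hr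
  rw [hr, inner_self_eq_norm_sq]

theorem eq_zero_of_notMem_Ioi {ρ : ℝ} {φ : Test 𝕜} (hφ : φ ∈ supportedOn 𝕜 ρ) {r : ℝ}
    (hr : r ∉ Ioi ρ) : φ r = 0 := by
  by_contra h
  exact hr (hφ (subset_tsupport _ h))

theorem setIntegral_inner {ρ : ℝ} {φ : Test 𝕜} (hφ : φ ∈ supportedOn 𝕜 ρ) (F : ℝ → 𝕜) :
    ∫ r in Ioi ρ, inner 𝕜 (φ r) (F r) = ∫ r, inner 𝕜 (φ r) (F r) :=
  setIntegral_eq_integral_of_forall_compl_eq_zero fun r hr => by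
    rw [eq_zero_of_notMem_Ioi hφ hr, inner_zero_left]

theorem norm_sq_toLp_restrict {ρ : ℝ} {φ : Test 𝕜} (hφ : φ ∈ supportedOn 𝕜 ρ) :
    ‖toLp (volume.restrict (Ioi ρ)) φ‖ ^ 2 = ∫ r, ‖φ r‖ ^ 2 := by
  rw [norm_sq_toLp]
  exact setIntegral_eq_integral_of_forall_compl_eq_zero fun r hr => by
    rw [eq_zero_of_notMem_Ioi hφ hr]; simp

theorem norm_toLp_xpow_mul_N_pow {ρ : ℝ} (n : ℕ) {φ : Test 𝕜} (hφ : φ ∈ supportedOn 𝕜 ρ) :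
    ‖toLp (volume.restrict (Ioi ρ)) (xpow n ((N ^ n) φ))‖ =
      ‖toLp (volume.restrict (Ioi ρ)) ((D ^ n) φ)‖ := by
  rw [← sq_eq_sq₀ (norm_nonneg _) (norm_nonneg _),
    norm_sq_toLp_restrict ((isLocal_xpow _).mem ((isLocal_N.pow n).mem hφ)),
    norm_sq_toLp_restrict ((isLocal_D.pow n).mem hφ), integral_norm_sq_xpow_mul_N_pow]

/-- The complexification of a real smooth function with compact support in `(0, ∞)`. -/
def ofReal (g : ℝ → ℝ) (h : ContDiff ℝ ∞ g) (h' : HasCompactSupport g) (h'' : tsupport g ⊆ Ioi 0) :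
    Test 𝕜 :=
  mk (fun r => (g r : 𝕜)) ((RCLike.ofRealCLM (K := 𝕜)).contDiff.comp h)
    (h'.comp_left (g := fun x : ℝ => (x : 𝕜)) (by simp))
    ((closure_mono (Function.support_comp_subset (g := fun x : ℝ => (x : 𝕜)) (by simp) g)).trans h'')

/-- An `L²` function orthogonal to the range of `r^s (r^(1-c) ∂_r)^n` is a linear combination of
decaying powers of `r`. -/
theorem exists_ae_eq_sum_zpow {ρ : ℝ} (hρ : 0 ≤ ρ) (c : ℕ) (hc : c ≠ 0) (n : ℕ) (s : ℤ)
    (A : L2Ioi 𝕜 ρ)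
    (h : ∀ φ ∈ supportedOn 𝕜 ρ,
      inner 𝕜 A (toLp (volume.restrict (Ioi ρ)) (xpow s ((powOp c ^ n) φ))) = 0) :
    ∃ b : ℕ → 𝕜, (∀ j < n, 0 ≤ (c * j + c - 1 - s : ℤ) → b j = 0) ∧
      A =ᵐ[volume.restrict (Ioi ρ)]
        fun r => ∑ j ∈ Finset.range n, b j * ((r ^ (c * j + c - 1 - s : ℤ) : ℝ) : 𝕜) := by
  obtain ⟨b, hb⟩ := exists_eq_sum_moment hρ c hc n
    ((innerSL 𝕜 A : L2Ioi 𝕜 ρ →ₗ[𝕜] 𝕜) ∘ₗ toLp (volume.restrict (Ioi ρ)) ∘ₗ xpow s) h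
  have hb' : ∀ ψ ∈ supportedOn 𝕜 ρ, ∫ r, inner 𝕜 (ψ r) (A r) ∂(volume.restrict (Ioi ρ)) =
      ∑ j ∈ Finset.range n, starRingEnd 𝕜 (b j * moment (c * j + c - 1 - s) ψ) := by
    intro ψ hψ
    -- Testing with r^(-s)ψ removes the weight r^s and shifts every exponent by -s.
    have := hb (xpow (-s) ψ) ((isLocal_xpow _).mem hψ)
    simp only [LinearMap.comp_apply, moment_xpow, ← sub_eq_add_neg] at this
    rw [← Module.End.mul_apply, xpow_mul_xpow, add_neg_cancel, xpow_zero] at this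
    rw [← inner_toLp, ← inner_conj_symm, ← map_sum, ← this]
    rfl
  have hA : MemLp (A : ℝ → 𝕜) 2 (volume.restrict (Ioi ρ)) := Lp.memLp A
  have hAloc : LocallyIntegrableOn (A : ℝ → 𝕜) (Ioi ρ) volume :=
    locallyIntegrableOn_of_locallyIntegrable_restrict (hA.locallyIntegrable (by norm_num))
  have hterm : ∀ j : ℕ, ContinuousOn (fun r : ℝ =>
      starRingEnd 𝕜 (b j) * ((r ^ (c * j + c - 1 - s : ℤ) : ℝ) : 𝕜)) (Ioi ρ) := fun j =>
    continuousOn_const.mul (RCLike.continuous_ofReal.comp_continuousOn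
      (continuousOn_id.zpow₀ _ fun r hr => Or.inl (hρ.trans_lt hr).ne'))
  have hsum : ContinuousOn (fun r : ℝ => ∑ j ∈ Finset.range n,
      starRingEnd 𝕜 (b j) * ((r ^ (c * j + c - 1 - s : ℤ) : ℝ) : 𝕜)) (Ioi ρ) :=
    continuousOn_finsetSum _ fun j _ => hterm j
  have key := isOpen_Ioi.ae_eq_zero_of_integral_contDiff_smul_eq_zero
    (hAloc.sub (hsum.locallyIntegrableOn measurableSet_Ioi)) (μ := volume) fun g hg hg' hg'' => by
      have hg0 : tsupport g ⊆ Ioi 0 := hg''.trans (Ioi_subset_Ioi hρ)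
      let ψ : Test 𝕜 := ofReal g hg hg' hg0
      have hψ : ψ ∈ supportedOn 𝕜 ρ :=
        (closure_mono (Function.support_comp_subset (g := fun x : ℝ => (x : 𝕜)) (by simp) g)).trans
          hg''
      have hψr : ∀ r, ψ r = (g r : 𝕜) := fun r => rfl
      have h1 := hb' ψ hψ
      have hmom : ∀ j : ℕ, starRingEnd 𝕜 (b j * moment (c * j + c - 1 - s) ψ) =
          ∫ r, starRingEnd 𝕜 (b j) * (xpow (c * j + c - 1 - s) ψ) r := fun j => by
        rw [moment_apply, map_mul, integral_const_mul, ← integral_conj]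
        congr 2 with r
        simp [hψr, RCLike.real_smul_eq_coe_mul]
      simp only [hmom] at h1
      have hsumI := integral_finsetSum (μ := volume) (Finset.range n)
        (f := fun (j : ℕ) r => starRingEnd 𝕜 (b j) * (xpow (c * j + c - 1 - s) ψ) r)
        fun j _ => (xpow (c * j + c - 1 - s) ψ).integrable.const_mul _
      rw [setIntegral_inner hψ, ← hsumI] at h1
      have hi1 : Integrable fun r => inner 𝕜 (ψ r) (A r) := by
        have : IntegrableOn (fun r => inner 𝕜 (ψ r) (A r)) (Ioi ρ) := by
          have := L2.integrable_inner (𝕜 := 𝕜) (toLp (volume.restrict (Ioi ρ)) ψ) A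
          refine this.congr ?_
          filter_upwards [coeFn_toLp (volume.restrict (Ioi ρ)) ψ] with r hr
          rw [hr]
        refine this.integrable_of_forall_notMem_eq_zero fun r hr => ?_
        rw [eq_zero_of_notMem_Ioi hψ hr, inner_zero_left]
      have hi2 : Integrable fun r => ∑ j ∈ Finset.range n,
          starRingEnd 𝕜 (b j) * (xpow (c * j + c - 1 - s) ψ) r :=
        integrable_finsetSum _ fun j _ => (xpow (c * j + c - 1 - s) ψ).integrable.const_mul _
      rw [← sub_eq_zero, ← integral_sub hi1 hi2] at h1
      rw [← h1]
      refine integral_congr_ae (Eventually.of_forall fun r => ?_)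
      simp only [Pi.sub_apply, hψr, RCLike.real_smul_eq_coe_mul, RCLike.inner_apply, xpow_apply,
        RCLike.conj_ofReal, mul_sub, Finset.mul_sum, mul_comm (A r)]
      congr 1
      refine Finset.sum_congr rfl fun j _ => ?_
      ring
  have hAeq : A =ᵐ[volume.restrict (Ioi ρ)] fun r => ∑ j ∈ Finset.range n,
      starRingEnd 𝕜 (b j) * ((r ^ (c * j + c - 1 - s : ℤ) : ℝ) : 𝕜) := by
    filter_upwards [ae_restrict_of_ae key, ae_restrict_mem measurableSet_Ioi] with r h1 h2
    exact sub_eq_zero.1 (h1 h2)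
  refine ⟨fun j => starRingEnd 𝕜 (b j), ?_, hAeq⟩
  refine eq_zero_of_memLp_sum_zpow (ρ := ρ) n (fun j => starRingEnd 𝕜 (b j))
    (fun j => (c * j + c - 1 - s : ℤ)) (strictMono_nat_of_lt_succ fun j => ?_) (hA.ae_eq hAeq)
  have : 0 < c := Nat.pos_of_ne_zero hc
  push_cast
  nlinarith

/-- As r^n · r^(2j+1-n) = r^(2j+1), the inner product is the conjugate of a moment of N^n φ, which
vanishes by `moment_pow_eq_zero` with c = 2. -/
theorem xpow_orthogonal {ρ : ℝ} {n j : ℕ} (hj : j < n) {φ : Test 𝕜} (hφ : φ ∈ supportedOn 𝕜 ρ)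
    {A : L2Ioi 𝕜 ρ}
    (hA : A =ᵐ[volume.restrict (Ioi ρ)] fun r => ((r ^ (2 * j + 1 - n : ℤ) : ℝ) : 𝕜)) :
    inner 𝕜 A (toLp (volume.restrict (Ioi ρ)) (xpow n ((N ^ n) φ))) = 0 := by
  have hm := moment_pow_eq_zero 2 n j hj φ
  have hφ' : xpow n ((N ^ n) φ) ∈ supportedOn 𝕜 ρ :=
    (isLocal_xpow _).mem ((isLocal_N.pow n).mem hφ)
  rw [inner_eq_zero_symm, inner_toLp]
  have h1 : ∫ r in Ioi ρ, inner 𝕜 (xpow n ((N ^ n) φ) r) (A r) =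
      ∫ r in Ioi ρ, inner 𝕜 (xpow n ((N ^ n) φ) r) ((r ^ (2 * j + 1 - n : ℤ) : ℝ) : 𝕜) := by
    refine integral_congr_ae ?_
    filter_upwards [hA] with r hr
    rw [hr]
  rw [h1, setIntegral_inner hφ', ← RingHom.map_zero (starRingEnd 𝕜), ← hm, moment_apply,
    ← integral_conj]
  congr 1 with r
  rcases le_or_gt r 0 with hr | hr
  · rw [eq_zero_of_nonpos _ hr, eq_zero_of_nonpos _ hr]; simp
  · simp only [xpow_apply, RCLike.inner_apply, RCLike.real_smul_eq_coe_mul, map_mul,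
      RCLike.conj_ofReal, powOp_two]
    rw [← mul_assoc, ← RCLike.ofReal_mul, ← zpow_add₀ hr.ne']
    congr 4
    push_cast
    ring

end Test

open Test

/-- The map `φ ↦ ∂_r^n φ` into `L²(ρ, ∞)`. -/
def derivLp (𝕜 : Type*) [RCLike 𝕜] (n : ℕ) (ρ : ℝ) : supportedOn 𝕜 ρ →ₗ[𝕜] L2Ioi 𝕜 ρ :=
  toLp (volume.restrict (Ioi ρ)) ∘ₗ (D ^ n) ∘ₗ (supportedOn 𝕜 ρ).subtype

/-- The map `φ ↦ r^n (r⁻¹ ∂_r)^n φ` into `L²(ρ, ∞)`. -/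
def radialDerivLp (𝕜 : Type*) [RCLike 𝕜] (n : ℕ) (ρ : ℝ) : supportedOn 𝕜 ρ →ₗ[𝕜] L2Ioi 𝕜 ρ :=
  toLp (volume.restrict (Ioi ρ)) ∘ₗ xpow n ∘ₗ (N ^ n) ∘ₗ (supportedOn 𝕜 ρ).subtype

theorem derivLp_apply (n : ℕ) (ρ : ℝ) (φ : supportedOn 𝕜 ρ) :
    derivLp 𝕜 n ρ φ = toLp (volume.restrict (Ioi ρ)) ((D ^ n) φ) := by
  rw [derivLp, LinearMap.comp_apply, LinearMap.comp_apply, Submodule.subtype_apply]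

theorem radialDerivLp_apply (n : ℕ) (ρ : ℝ) (φ : supportedOn 𝕜 ρ) :
    radialDerivLp 𝕜 n ρ φ = toLp (volume.restrict (Ioi ρ)) (xpow n ((N ^ n) φ)) := by
  rw [radialDerivLp, LinearMap.comp_apply, LinearMap.comp_apply, LinearMap.comp_apply,
    Submodule.subtype_apply]

/-- Functions `∂_r^n φ` are dense in `L²(ρ, ∞)`. -/
theorem denseRange_derivLp {ρ : ℝ} (hρ : 0 ≤ ρ) (n : ℕ) : DenseRange (derivLp 𝕜 n ρ) := by
  rw [DenseRange, ← LinearMap.coe_range, ← Submodule.dense_iff_topologicalClosure_eq_top.symm,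
    Submodule.topologicalClosure_eq_top_iff, Submodule.eq_bot_iff]
  intro A hA
  obtain ⟨b, hb, hAb⟩ := exists_ae_eq_sum_zpow hρ 1 one_ne_zero n 0 A fun φ hφ => by
    rw [powOp_one, xpow_zero, Module.End.one_apply]
    have := Submodule.inner_left_of_mem_orthogonal
      (LinearMap.mem_range_self (derivLp 𝕜 n ρ) ⟨φ, hφ⟩) hA
    rwa [derivLp_apply] at this
  rw [Lp.eq_zero_iff_ae_eq_zero]
  filter_upwards [hAb] with r hr
  rw [hr]
  refine Finset.sum_eq_zero fun j hj => ?_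
  -- For c = 1 and s = 0 the exponents are j ≥ 0: the complement consists of square-integrable
  -- polynomials, hence is trivial.
  rw [hb j (Finset.mem_range.1 hj) (by push_cast; linarith [Int.natCast_nonneg j]), zero_mul]

/-- The isometry of `L²(ρ, ∞)` which maps `∂_r^n φ` to `r^n (r⁻¹ ∂_r)^n φ`. -/
def transmutation (𝕜 : Type*) [RCLike 𝕜] (n : ℕ) (ρ : ℝ) : L2Ioi 𝕜 ρ →L[𝕜] L2Ioi 𝕜 ρ :=
  (radialDerivLp 𝕜 n ρ).extendOfNorm (derivLp 𝕜 n ρ)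

theorem transmutation_D_pow {n : ℕ} {ρ : ℝ} (hρ : 0 ≤ ρ) {φ : Test 𝕜} (hφ : φ ∈ supportedOn 𝕜 ρ) :
    transmutation 𝕜 n ρ (toLp (volume.restrict (Ioi ρ)) ((D ^ n) φ)) =
      toLp (volume.restrict (Ioi ρ)) (xpow n ((N ^ n) φ)) := by
  have h : ∃ C, ∀ x : supportedOn 𝕜 ρ, ‖radialDerivLp 𝕜 n ρ x‖ ≤ C * ‖derivLp 𝕜 n ρ x‖ := by
    refine ⟨1, fun x => ?_⟩
    rw [one_mul, radialDerivLp_apply, derivLp_apply, norm_toLp_xpow_mul_N_pow n x.2]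
  have := LinearMap.extendOfNorm_eq (f := radialDerivLp 𝕜 n ρ) (e := derivLp 𝕜 n ρ)
    (denseRange_derivLp hρ n) h (⟨φ, hφ⟩ : supportedOn 𝕜 ρ)
  rwa [radialDerivLp_apply, derivLp_apply] at this

theorem induction_D_pow {n : ℕ} {ρ : ℝ} (hρ : 0 ≤ ρ) {p : L2Ioi 𝕜 ρ → Prop}
    (hp : IsClosed {x | p x})
    (h : ∀ φ ∈ supportedOn 𝕜 ρ, p (toLp (volume.restrict (Ioi ρ)) ((D ^ n) φ))) (x : L2Ioi 𝕜 ρ) :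
    p x :=
  (denseRange_derivLp hρ n).induction_on x hp fun φ => by
    rw [derivLp_apply]
    exact h φ φ.2

theorem norm_transmutation {n : ℕ} {ρ : ℝ} (hρ : 0 ≤ ρ) (x : L2Ioi 𝕜 ρ) :
    ‖transmutation 𝕜 n ρ x‖ = ‖x‖ := by
  refine induction_D_pow (n := n) hρ (p := fun x => ‖transmutation 𝕜 n ρ x‖ = ‖x‖)
    (isClosed_eq (by fun_prop) (by fun_prop)) (fun φ hφ => ?_) x
  rw [transmutation_D_pow hρ hφ, norm_toLp_xpow_mul_N_pow n hφ]

theorem adjoint_transmutation_apply {n : ℕ} {ρ : ℝ} (hρ : 0 ≤ ρ) (x : L2Ioi 𝕜 ρ) :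
    (transmutation 𝕜 n ρ).adjoint (transmutation 𝕜 n ρ x) = x := by
  have := (ContinuousLinearMap.norm_map_iff_adjoint_comp_self (transmutation 𝕜 n ρ)).1
    (norm_transmutation hρ)
  exact congrArg (fun f => f x) this

theorem inner_adjoint_transmutation {n : ℕ} {ρ : ℝ} (hρ : 0 ≤ ρ) {φ : Test 𝕜}
    (hφ : φ ∈ supportedOn 𝕜 ρ) (A : L2Ioi 𝕜 ρ) :
    inner 𝕜 (toLp (volume.restrict (Ioi ρ)) ((D ^ n) φ)) ((transmutation 𝕜 n ρ).adjoint A) =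
      inner 𝕜 (toLp (volume.restrict (Ioi ρ)) (xpow n ((N ^ n) φ))) A := by
  rw [ContinuousLinearMap.adjoint_inner_right, transmutation_D_pow hρ hφ]

/-- By density of the functions ∂_r^n φ the bound extends to all vectors, and it is then applied to
y itself. -/
theorem norm_le_of_inner_D_pow_le {n : ℕ} {ρ : ℝ} (hρ : 0 ≤ ρ) {C : ℝ} {y : L2Ioi 𝕜 ρ} (hC : 0 ≤ C)
    (h : ∀ φ ∈ supportedOn 𝕜 ρ, ‖inner 𝕜 (toLp (volume.restrict (Ioi ρ)) ((D ^ n) φ)) y‖ ≤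
      ‖toLp (volume.restrict (Ioi ρ)) ((D ^ n) φ)‖ * C) : ‖y‖ ≤ C := by
  have := induction_D_pow (n := n) hρ (p := fun x => ‖inner 𝕜 x y‖ ≤ ‖x‖ * C)
    (isClosed_le (by fun_prop) (by fun_prop)) h y
  rw [inner_self_eq_norm_sq_to_K, norm_pow, RCLike.norm_ofReal, abs_norm, sq] at this
  rcases (norm_nonneg y).eq_or_lt with h0 | h0
  · rwa [← h0]
  · exact le_of_mul_le_mul_left this h0

/-- The component of `A` orthogonal to the range of the transmutation operator. -/
def defect (n : ℕ) (ρ : ℝ) (A : L2Ioi 𝕜 ρ) : L2Ioi 𝕜 ρ :=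
  A - transmutation 𝕜 n ρ ((transmutation 𝕜 n ρ).adjoint A)

theorem inner_defect {n : ℕ} {ρ : ℝ} (hρ : 0 ≤ ρ) (A x : L2Ioi 𝕜 ρ) :
    inner 𝕜 (defect n ρ A) (transmutation 𝕜 n ρ x) = 0 := by
  rw [defect, inner_sub_left, ← ContinuousLinearMap.adjoint_inner_left,
    ← ContinuousLinearMap.adjoint_inner_left, adjoint_transmutation_apply hρ, sub_self]

theorem norm_sq_defect {n : ℕ} {ρ : ℝ} (hρ : 0 ≤ ρ) (A : L2Ioi 𝕜 ρ) :
    ‖A‖ ^ 2 = ‖defect n ρ A‖ ^ 2 + ‖(transmutation 𝕜 n ρ).adjoint A‖ ^ 2 := by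
  have h : A = defect n ρ A + transmutation 𝕜 n ρ ((transmutation 𝕜 n ρ).adjoint A) := by
    simp [defect]
  conv_lhs => rw [h]
  rw [sq, norm_add_sq_eq_norm_sq_add_norm_sq_of_inner_eq_zero _ _ (inner_defect hρ A _),
    norm_transmutation hρ, sq, sq]

/-- The defect is orthogonal to every r^n N^n φ, so `exists_ae_eq_sum_zpow` applies with c = 2 and s
= n. The vanishing coefficients are those of nonnegative exponent. -/
theorem defect_ae_eq {n : ℕ} {ρ : ℝ} (hρ : 0 ≤ ρ) (A : L2Ioi 𝕜 ρ) :
    ∃ b : ℕ → 𝕜, (∀ j < n, n ≤ 2 * j + 1 → b j = 0) ∧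
      defect n ρ A =ᵐ[volume.restrict (Ioi ρ)]
        fun r => ∑ j ∈ Finset.range n, b j * ((r ^ (2 * j + 1 - n : ℤ) : ℝ) : 𝕜) := by
  obtain ⟨b, hb, h⟩ := exists_ae_eq_sum_zpow hρ 2 two_ne_zero n n (defect n ρ A) fun φ hφ => by
    rw [powOp_two, ← transmutation_D_pow hρ hφ, inner_defect hρ]
  have e : ∀ j : ℕ, (((2 : ℕ) : ℤ) * j + (2 : ℕ) - 1 - n) = 2 * j + 1 - n := fun j => by
    push_cast; ring
  simp only [e] at h hb
  exact ⟨b, fun j hj hj' => hb j hj (by omega), h⟩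

/-- Converse to `defect_ae_eq`: the square-integrable powers are orthogonal to the whole range, by
density from `xpow_orthogonal`. -/
theorem inner_xpow_transmutation {n j : ℕ} {ρ : ℝ} (hρ : 0 ≤ ρ) (hj : j < n) {A : L2Ioi 𝕜 ρ}
    (hA : A =ᵐ[volume.restrict (Ioi ρ)] fun r => ((r ^ (2 * j + 1 - n : ℤ) : ℝ) : 𝕜))
    (x : L2Ioi 𝕜 ρ) : inner 𝕜 A (transmutation 𝕜 n ρ x) = 0 :=
  induction_D_pow (n := n) hρ (p := fun x => inner 𝕜 A (transmutation 𝕜 n ρ x) = 0)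
    (isClosed_eq (by fun_prop) (by fun_prop))
    (fun φ hφ => by rw [transmutation_D_pow hρ hφ, xpow_orthogonal hj hφ hA]) x

end

/-! ### Translated test functions, the first-order radial system and its conserved pairing. -/

section

open Test Asymptotics

variable {𝕜 : Type*} [RCLike 𝕜]

namespace Test

/-- The differential operators whose coefficients are Laurent polynomials in `r`. -/
def laurentOps (𝕜 : Type*) [RCLike 𝕜] : Submodule 𝕜 (Module.End 𝕜 (Test 𝕜)) :=
  Submodule.span 𝕜 (range fun p : ℤ × ℕ => xpow p.1 * D ^ p.2)

theorem xpow_mul_D_pow_mem (k : ℤ) (i : ℕ) : xpow k * D ^ i ∈ laurentOps 𝕜 :=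
  Submodule.subset_span ⟨(k, i), rfl⟩

theorem xpow_mul_mem (j : ℤ) {O : Module.End 𝕜 (Test 𝕜)} (hO : O ∈ laurentOps 𝕜) :
    xpow j * O ∈ laurentOps 𝕜 := by
  induction hO using Submodule.span_induction with
  | mem O h =>
    obtain ⟨p, rfl⟩ := h
    rw [xpow_mul_xpow_assoc]
    exact xpow_mul_D_pow_mem _ _
  | zero => simp
  | add O O' _ _ h h' => rw [mul_add]; exact add_mem h h'
  | smul c O _ h => rw [mul_smul_comm]; exact Submodule.smul_mem _ _ h

theorem D_mul_mem {O : Module.End 𝕜 (Test 𝕜)} (hO : O ∈ laurentOps 𝕜) : D * O ∈ laurentOps 𝕜 := by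
  induction hO using Submodule.span_induction with
  | mem O h =>
    obtain ⟨p, rfl⟩ := h
    rw [← mul_assoc, D_mul_xpow, add_mul, mul_assoc, ← pow_succ', smul_mul_assoc]
    exact add_mem (xpow_mul_D_pow_mem _ _) (Submodule.smul_mem _ _ (xpow_mul_D_pow_mem _ _))
  | zero => simp
  | add O O' _ _ h h' => rw [mul_add]; exact add_mem h h'
  | smul c O _ h => rw [mul_smul_comm]; exact Submodule.smul_mem _ _ h

theorem mul_D_mem {O : Module.End 𝕜 (Test 𝕜)} (hO : O ∈ laurentOps 𝕜) : O * D ∈ laurentOps 𝕜 := by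
  induction hO using Submodule.span_induction with
  | mem O h =>
    obtain ⟨p, rfl⟩ := h
    rw [mul_assoc, ← pow_succ]
    exact xpow_mul_D_pow_mem _ _
  | zero => simp
  | add O O' _ _ h h' => rw [add_mul]; exact add_mem h h'
  | smul c O _ h => rw [smul_mul_assoc]; exact Submodule.smul_mem _ _ h

theorem N_pow_mem (n : ℕ) : N ^ n ∈ laurentOps 𝕜 := by
  induction n with
  | zero => simpa [xpow_zero] using xpow_mul_D_pow_mem (𝕜 := 𝕜) 0 0
  | succ n ih =>
    rw [pow_succ', N, mul_assoc, ← N]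
    exact xpow_mul_mem _ (D_mul_mem ih)

theorem tsupport_comp_sub {φ : ℝ → 𝕜} (s : ℝ) :
    tsupport (fun r => φ (r - s)) = (fun r => r - s) ⁻¹' tsupport φ := by
  have := (Homeomorph.subRight s).preimage_closure (Function.support φ)
  exact this.symm

theorem hasCompactSupport_comp_sub {φ : ℝ → 𝕜} (h : HasCompactSupport φ) (s : ℝ) :
    HasCompactSupport fun r => φ (r - s) :=
  h.comp_homeomorph (Homeomorph.subRight s)

open Classical in
/-- The translate `φ(· - s)` of a test function (zero if its support leaves `(0, ∞)`). -/
def shift (s : ℝ) (φ : Test 𝕜) : Test 𝕜 :=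
  if h : φ ∈ supportedOn 𝕜 (-s) then
    mk (fun r => φ (r - s)) (φ.contDiff.comp (contDiff_id.sub contDiff_const))
      (hasCompactSupport_comp_sub φ.hasCompactSupport s) (by
        rw [tsupport_comp_sub]
        intro r hr
        have : -s < r - s := h hr
        simp only [mem_Ioi]
        linarith)
  else 0

theorem shift_apply {s : ℝ} {φ : Test 𝕜} (h : φ ∈ supportedOn 𝕜 (-s)) (r : ℝ) :
    shift s φ r = φ (r - s) := by
  rw [shift, dif_pos h]
  rfl

theorem D_shift {s : ℝ} {φ : Test 𝕜} (h : φ ∈ supportedOn 𝕜 (-s)) :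
    D (shift s φ) = shift s (D φ) := by
  ext r
  rw [shift_apply (isLocal_D.mem h), coe_D, coe_D]
  have : (shift s φ : ℝ → 𝕜) = fun r => φ (r - s) := funext (shift_apply h)
  rw [this, deriv_comp_sub_const]

theorem D_pow_shift {s : ℝ} {φ : Test 𝕜} (h : φ ∈ supportedOn 𝕜 (-s)) (n : ℕ) :
    (D ^ n) (shift s φ) = shift s ((D ^ n) φ) := by
  induction n generalizing φ with
  | zero => rfl
  | succ n ih =>
    rw [pow_succ, Module.End.mul_apply, Module.End.mul_apply, D_shift h, ih (isLocal_D.mem h)]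

theorem shift_mem {ρ s : ℝ} {φ : Test 𝕜} (h : φ ∈ supportedOn 𝕜 (-s)) (hρ : φ ∈ supportedOn 𝕜 ρ) :
    shift s φ ∈ supportedOn 𝕜 (ρ + s) := by
  have : (shift s φ : ℝ → 𝕜) = fun r => φ (r - s) := funext (shift_apply h)
  rw [mem_supportedOn, this, tsupport_comp_sub]
  intro r hr
  have : ρ < r - s := hρ hr
  simp only [mem_Ioi]
  linarith

theorem supportedOn_mono {ρ ρ' : ℝ} (h : ρ' ≤ ρ) {φ : Test 𝕜} (hφ : φ ∈ supportedOn 𝕜 ρ) :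
    φ ∈ supportedOn 𝕜 ρ' := Subset.trans hφ (Ioi_subset_Ioi h)

theorem mem_supportedOn_of_nonpos {ρ : ℝ} (h : ρ ≤ 0) (φ : Test 𝕜) : φ ∈ supportedOn 𝕜 ρ :=
  supportedOn_mono h φ.tsupport_subset

theorem shift_neg_shift {ρ s : ℝ} (hρ : 0 ≤ ρ) {φ : Test 𝕜}
    (h : φ ∈ supportedOn 𝕜 (ρ + s)) (hs : 0 ≤ s) :
    shift s (shift (-s) φ) = φ := by
  have h1 : φ ∈ supportedOn 𝕜 (-(-s)) := supportedOn_mono (by linarith) h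
  ext r
  rw [shift_apply (mem_supportedOn_of_nonpos (by linarith) _), shift_apply h1]
  congr 1
  ring

theorem integral_norm_sq_shift {s : ℝ} {φ : Test 𝕜} (h : φ ∈ supportedOn 𝕜 (-s)) :
    ∫ r, ‖shift s φ r‖ ^ 2 = ∫ r, ‖φ r‖ ^ 2 := by
  simp only [shift_apply h]
  exact integral_sub_right_eq_self (fun r => ‖φ r‖ ^ 2) s

theorem norm_sub_sub_le (φ : Test 𝕜) :
    ∃ M, 0 ≤ M ∧ ∀ x h : ℝ, ‖φ (x - h) - φ x + h • D φ x‖ ≤ M * h ^ 2 := by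
  obtain ⟨M, hM⟩ := (D (D φ)).hasCompactSupport.exists_bound_of_continuous (D (D φ)).continuous
  have hM0 : 0 ≤ M := (norm_nonneg _).trans (hM 0)
  have hL : ∀ x y : ℝ, ‖D φ y - D φ x‖ ≤ M * ‖y - x‖ := fun x y =>
    Convex.norm_image_sub_le_of_norm_hasDerivWithin_le (s := univ)
      (fun z _ => ((D φ).hasDerivAt z).hasDerivWithinAt) (fun z _ => hM z) convex_univ
      (mem_univ x) (mem_univ y)
  refine ⟨M, hM0, fun x h => ?_⟩
  have hder : ∀ y ∈ segment ℝ x (x - h), HasDerivWithinAt (fun y => φ y - y • D φ x)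
      (D φ y - D φ x) (segment ℝ x (x - h)) y := fun y _ => by
    have := (φ.hasDerivAt y).sub ((hasDerivAt_id y).smul_const (D φ x))
    rw [one_smul] at this
    exact this.hasDerivWithinAt
  have hb : ∀ y ∈ segment ℝ x (x - h), ‖D φ y - D φ x‖ ≤ M * |h| := fun y hy => by
    refine (hL x y).trans (mul_le_mul_of_nonneg_left ?_ hM0)
    have := norm_sub_le_of_mem_segment hy
    simpa using this
  have := (convex_segment x (x - h)).norm_image_sub_le_of_norm_hasDerivWithin_le hder hb
    (left_mem_segment ℝ _ _) (right_mem_segment ℝ _ _)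
  rw [show φ (x - h) - (x - h) • D φ x - (φ x - x • D φ x) = φ (x - h) - φ x + h • D φ x by
    module] at this
  refine this.trans_eq ?_
  rw [sub_sub_cancel_left, norm_neg, Real.norm_eq_abs, mul_assoc, ← sq, sq_abs]

theorem norm_toLp_le {a b c : ℝ} {φ : Test 𝕜} (hab : a ≤ b) (h : ∀ r, r ∉ Icc a b → φ r = 0)
    (hc : ∀ r ∈ Icc a b, ‖φ r‖ ≤ c) : ‖toLp volume φ‖ ≤ c * √(b - a) := by
  have hc0 : 0 ≤ c := (norm_nonneg _).trans (hc a ⟨le_rfl, hab⟩)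
  refine abs_le_of_sq_le_sq' ?_ (by positivity) |>.2
  rw [norm_sq_toLp, mul_pow, Real.sq_sqrt (by linarith),
    ← setIntegral_eq_integral_of_forall_compl_eq_zero (s := Icc a b) fun r hr => by simp [h r hr]]
  have := norm_setIntegral_le_of_norm_le_const (μ := volume) (s := Icc a b) (C := c ^ 2)
    (f := fun r => ‖φ r‖ ^ 2) (by simp) fun r hr => by
      rw [Real.norm_eq_abs, abs_of_nonneg (by positivity)]
      exact pow_le_pow_left₀ (norm_nonneg _) (hc r hr) 2
  rw [Real.volume_real_Icc_of_le hab] at this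
  exact (le_abs_self _).trans this

theorem eventually_mem_supportedOn {t : ℝ} {φ : Test 𝕜} (h : φ ∈ supportedOn 𝕜 (-t)) :
    ∀ᶠ s in 𝓝 t, φ ∈ supportedOn 𝕜 (-s) := by
  obtain ⟨a, b, ha, -, hsub⟩ := exists_tsupport_subset_Icc h
  filter_upwards [lt_mem_nhds (show -a < t by linarith)] with s hs
  exact hsub.trans fun x hx => by
    simp only [mem_Ioi]
    linarith [hx.1]

/-- Near t all translates live in one compact subset of (0, ∞), where r^k is bounded, so the
second-order Taylor bound for φ gives an error O((s - t)²) in L². -/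
theorem isLittleO_xpow_shift (k : ℤ) {t : ℝ} {φ : Test 𝕜} (h : φ ∈ supportedOn 𝕜 (-t)) :
    (fun s => toLp volume (xpow k (shift s φ)) - toLp volume (xpow k (shift t φ)) +
      ((s - t : ℝ) : 𝕜) • toLp volume (xpow k (shift t (D φ)))) =o[𝓝 t] fun s => s - t := by
  obtain ⟨a, b, ha, hab, hsub⟩ := exists_tsupport_subset_Icc h
  have hz : ∀ x, x ∉ Icc a b → φ x = 0 := fun x hx => by
    by_contra h
    exact hx (hsub (subset_tsupport _ h))
  have hz' : ∀ x, x ∉ Icc a b → D φ x = 0 := fun x hx => by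
    by_contra h
    exact hx (hsub (isLocal_D φ (subset_tsupport _ h)))
  obtain ⟨M, hM0, hM⟩ := norm_sub_sub_le φ
  -- Half the distance from 0 to the lower bound a + t for the translated support.
  set δ := (a + t) / 2 with hδ
  have hδ0 : 0 < δ := by linarith
  obtain ⟨C, hC⟩ := isCompact_Icc.exists_bound_of_continuousOn (f := fun r : ℝ => r ^ k)
    (s := Icc (a + t - δ) (b + t + δ))
    (continuousOn_id.zpow₀ k fun r hr => Or.inl (by
      have := hr.1
      simp only [id]
      linarith))
  have hC0 : 0 ≤ C := (norm_nonneg _).trans (hC (a + t - δ) ⟨le_rfl, by linarith⟩)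
  have hO : (fun s => toLp volume (xpow k (shift s φ)) - toLp volume (xpow k (shift t φ)) +
      ((s - t : ℝ) : 𝕜) • toLp volume (xpow k (shift t (D φ)))) =O[𝓝 t] fun s => (s - t) ^ 2 := by
    refine IsBigO.of_bound (C * M * √(b + t + δ - (a + t - δ))) ?_
    filter_upwards [eventually_mem_supportedOn h, Metric.ball_mem_nhds t hδ0] with s hs hst
    rw [Metric.mem_ball, Real.dist_eq, abs_lt] at hst
    rw [← map_sub, ← map_smul, ← map_add, ← map_sub, ← map_smul, ← map_add]
    have hval : ∀ r, (shift s φ - shift t φ + ((s - t : ℝ) : 𝕜) • shift t (D φ)) r =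
        φ ((r - t) - (s - t)) - φ (r - t) + (s - t) • D φ (r - t) := fun r => by
      rw [add_apply, sub_apply, smul_apply, shift_apply hs, shift_apply h,
        shift_apply (isLocal_D.mem h), RCLike.real_smul_eq_coe_mul]
      congr 3
      ring
    refine (norm_toLp_le (a := a + t - δ) (b := b + t + δ) (c := C * (M * (s - t) ^ 2))
      (by linarith) (fun r hr => ?_) (fun r hr => ?_)).trans_eq ?_
    · rw [xpow_apply, hval]
      rw [mem_Icc, not_and_or, not_le, not_le] at hr
      rw [hz _ fun h => ?_, hz _ fun h => ?_, hz' _ fun h => ?_]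
      · simp
      all_goals
        rcases hr with hr | hr <;> linarith [h.1, h.2]
    · rw [xpow_apply, hval, norm_smul]
      exact mul_le_mul (hC r hr) (hM _ _) (norm_nonneg _) hC0
    · rw [Real.norm_eq_abs, abs_of_nonneg (sq_nonneg _)]
      ring
  refine hO.trans_isLittleO ?_
  have : (fun s => (s - t) ^ 2) = fun s => (s - t) * (s - t) := by ext; ring
  rw [this]
  have h1 : (fun s : ℝ => s - t) =o[𝓝 t] fun _ => (1 : ℝ) := by
    rw [isLittleO_one_iff]
    have : Tendsto (fun s : ℝ => s - t) (𝓝 t) (𝓝 (t - t)) := tendsto_id.sub_const t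
    simpa using this
  simpa using h1.mul_isBigO (isBigO_refl (fun s : ℝ => s - t) (𝓝 t))

/-- Translation commutes with ∂_r but not with r^k. Expanding the operator into terms r^k ∂_r^i
reduces the claim to `isLittleO_xpow_shift` for ∂_r^i φ. -/
theorem isLittleO_shift {O : Module.End 𝕜 (Test 𝕜)} (hO : O ∈ laurentOps 𝕜) {t : ℝ} {φ : Test 𝕜}
    (h : φ ∈ supportedOn 𝕜 (-t)) :
    (fun s => toLp volume (O (shift s φ)) - toLp volume (O (shift t φ)) -
      ((s - t : ℝ) : 𝕜) • -toLp volume (O (shift t (D φ)))) =o[𝓝 t] fun s => s - t := by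
  simp only [smul_neg, sub_neg_eq_add]
  induction hO using Submodule.span_induction with
  | mem O hO =>
    obtain ⟨p, rfl⟩ := hO
    refine (isLittleO_xpow_shift p.1 ((isLocal_D.pow p.2).mem h)).congr' ?_ .rfl
    filter_upwards [eventually_mem_supportedOn h] with s hs
    simp only [Module.End.mul_apply]
    rw [D_pow_shift hs, D_pow_shift h, D_pow_shift (isLocal_D.mem h), ← Module.End.mul_apply D,
      ← Module.End.mul_apply _ D, ← pow_succ, ← pow_succ']
  | zero => simp
  | add O O' _ _ h h' =>
    refine (h.add h').congr' (Eventually.of_forall fun s => ?_) .rfl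
    simp only [LinearMap.add_apply, map_add, smul_add]
    abel
  | smul c O _ h =>
    refine (h.const_smul_left c).congr' (Eventually.of_forall fun s => ?_) .rfl
    simp only [LinearMap.smul_apply, map_smul, Pi.smul_apply, smul_add, smul_sub, smul_comm c]

end Test

/-- A product rule in which only ξ is differentiable in norm. For x, continuity and
differentiability of its pairing with the frozen vector ξ(t) suffice, which is what a weak solution
offers. -/
theorem hasDerivAt_inner_of_isLittleO {H : Type*} [NormedAddCommGroup H] [InnerProductSpace 𝕜 H]
    {ξ x : ℝ → H} {ξ' : H} {w : 𝕜} {t : ℝ}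
    (hξ : (fun s => ξ s - ξ t - ((s - t : ℝ) : 𝕜) • ξ') =o[𝓝 t] fun s => s - t)
    (hx : ContinuousAt x t) (hw : HasDerivAt (fun s => inner 𝕜 (ξ t) (x s)) w t) :
    HasDerivAt (fun s => inner 𝕜 (ξ s) (x s)) (w + inner 𝕜 ξ' (x t)) t := by
  rw [hasDerivAt_iff_isLittleO] at hw ⊢
  have h1 : (fun s => inner 𝕜 (ξ s - ξ t - ((s - t : ℝ) : 𝕜) • ξ') (x s)) =o[𝓝 t]
      fun s => s - t := by
    have hb : (fun s => ‖x s‖) =O[𝓝 t] fun _ => (1 : ℝ) := hx.norm.isBigO_one ℝ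
    have := hξ.norm_left.mul_isBigO hb
    simp only [mul_one] at this
    exact (IsBigO.of_bound 1 (Eventually.of_forall fun s => by
      rw [one_mul, Real.norm_eq_abs, abs_of_nonneg (by positivity)]
      exact norm_inner_le_norm _ _)).trans_isLittleO this
  have h2 : (fun s => ((s - t : ℝ) : 𝕜) * inner 𝕜 ξ' (x s - x t)) =o[𝓝 t] fun s => s - t := by
    have h3 : (fun s => inner 𝕜 ξ' (x s - x t)) =o[𝓝 t] fun _ => (1 : ℝ) := by
      rw [isLittleO_one_iff]
      have : Tendsto (fun s => inner 𝕜 ξ' (x s - x t)) (𝓝 t) (𝓝 (inner 𝕜 ξ' (x t - x t))) :=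
        (tendsto_const_nhds).inner (hx.tendsto.sub_const _)
      simpa using this
    have h4 : (fun s => ((s - t : ℝ) : 𝕜)) =O[𝓝 t] fun s => s - t :=
      IsBigO.of_bound 1 (Eventually.of_forall fun s => by
        rw [one_mul, RCLike.norm_ofReal, Real.norm_eq_abs])
    simpa using h4.mul_isLittleO h3
  refine ((hw.add h1).add h2).congr' (Eventually.of_forall fun s => ?_) .rfl
  simp only [inner_sub_left, inner_sub_right, inner_smul_left, RCLike.conj_ofReal,
    RCLike.real_smul_eq_coe_mul]
  ring

/-- Weak solutions in `C(ℝ; L²)` of the system `∂_t A = (∂_r - m/r) B`, `∂_t B = (∂_r + m/r) A` on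
`r > 0`; for a radial solution `u` of the wave equation in dimension `2m + 1`, the pair
`(A, B) = r^m (∂_r u, ∂_t u)` satisfies it. -/
structure IsRadialSolution (m : ℕ) (A B : ℝ → Lp 𝕜 2 (volume : Measure ℝ)) : Prop where
  continuous_fst : Continuous A
  continuous_snd : Continuous B
  hasDerivAt_fst : ∀ (ζ : Test 𝕜) (t : ℝ), HasDerivAt (fun s => inner 𝕜 (toLp volume ζ) (A s))
    (-inner 𝕜 (toLp volume ((D + (m : 𝕜) • xpow (-1) : Module.End 𝕜 (Test 𝕜)) ζ)) (B t)) t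
  hasDerivAt_snd : ∀ (ζ : Test 𝕜) (t : ℝ), HasDerivAt (fun s => inner 𝕜 (toLp volume ζ) (B s))
    (-inner 𝕜 (toLp volume ((D - (m : 𝕜) • xpow (-1) : Module.End 𝕜 (Test 𝕜)) ζ)) (A t)) t

namespace IsRadialSolution

variable {m : ℕ} {A B : ℝ → Lp 𝕜 2 (volume : Measure ℝ)}

/-- Reversing time changes the sign of ∂_t u only. -/
theorem reverse (h : IsRadialSolution m A B) (T : ℝ) :
    IsRadialSolution m (fun t => A (T - t)) (fun t => -B (T - t)) where
  continuous_fst := h.continuous_fst.comp (continuous_const.sub continuous_id)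
  continuous_snd := (h.continuous_snd.comp (continuous_const.sub continuous_id)).neg
  hasDerivAt_fst ζ t := by
    have := (h.hasDerivAt_fst ζ (T - t)).scomp t ((hasDerivAt_id t).const_sub T)
    simpa [inner_neg_right, Function.comp_def] using this
  hasDerivAt_snd ζ t := by
    have := ((h.hasDerivAt_snd ζ (T - t)).scomp t ((hasDerivAt_id t).const_sub T)).neg
    have h2 : HasDerivAt (fun s => -inner 𝕜 (toLp volume ζ) (B (T - s))) _ t := this
    simpa [inner_neg_right] using h2

/-- The pairing of `(A, B)` with the outgoing wave of profile `φ`; replacing `B` by `-B` gives the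
pairing with the incoming one. -/
def pairing (m : ℕ) (φ : Test 𝕜) (A B : Lp 𝕜 2 (volume : Measure ℝ)) : 𝕜 :=
  inner 𝕜 (toLp volume (xpow (m + 1) ((N ^ (m + 1)) φ))) A -
    inner 𝕜 (toLp volume (xpow m ((N ^ m) (D φ)))) B

/-- Translating the test pair contributes a minus r-derivative; the equation contributes the
operators of `D_add_mul` and `D_sub_mul`. The A-terms and the B-terms cancel separately. -/
theorem hasDerivAt_pairing (h : IsRadialSolution m A B) {φ : Test 𝕜} {t : ℝ}
    (hφ : φ ∈ supportedOn 𝕜 (-t)) :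
    HasDerivAt (fun s => pairing m (shift s φ) (A s) (B s)) 0 t := by
  have hO1 : xpow (m + 1) * N ^ (m + 1) ∈ laurentOps 𝕜 := xpow_mul_mem _ (N_pow_mem _)
  have hO2 : xpow m * N ^ m * D ∈ laurentOps 𝕜 := mul_D_mem (xpow_mul_mem _ (N_pow_mem _))
  have h1 := hasDerivAt_inner_of_isLittleO (isLittleO_shift hO1 hφ) h.continuous_fst.continuousAt
    (h.hasDerivAt_fst _ t)
  have h2 := hasDerivAt_inner_of_isLittleO (isLittleO_shift hO2 hφ) h.continuous_snd.continuousAt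
    (h.hasDerivAt_snd _ t)
  have h3 := h1.sub h2
  simp only [← D_shift hφ] at h3
  have e1 := congrArg (fun O : Module.End 𝕜 (Test 𝕜) => O (shift t φ)) (D_add_mul (𝕜 := 𝕜) m)
  have e2 := congrArg (fun O : Module.End 𝕜 (Test 𝕜) => O (shift t φ)) (D_sub_mul (𝕜 := 𝕜) m)
  simp only [mul_assoc] at e1 e2
  simp only [Module.End.mul_apply] at e1 e2 h3
  rw [e1, e2] at h3
  simp only [inner_neg_left] at h3
  refine h3.congr_deriv ?_
  ring

theorem pairing_shift (h : IsRadialSolution m A B) (φ : Test 𝕜) {T : ℝ} (hT : 0 ≤ T) :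
    pairing m (shift T φ) (A T) (B T) = pairing m φ (A 0) (B 0) := by
  have hd : ∀ t ∈ Icc 0 T, HasDerivAt (fun s => pairing m (shift s φ) (A s) (B s)) 0 t :=
    fun t ht => h.hasDerivAt_pairing (mem_supportedOn_of_nonpos (by linarith [ht.1]) φ)
  have := constant_of_has_deriv_right_zero (a := 0) (b := T)
    (fun t ht => (hd t ht).continuousAt.continuousWithinAt)
    (fun t ht => (hd t (Ico_subset_Icc_self ht)).hasDerivWithinAt) T ⟨hT, le_rfl⟩
  have h0 : shift 0 φ = φ := by
    ext r
    rw [shift_apply (mem_supportedOn_of_nonpos (by simp) φ), sub_zero]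
  rw [this, h0]

/-- This is conservation for the solution run backwards from time T, which ends at the initial data.
Supports again move outward, now from time T to time 0. -/
theorem pairing_neg_shift (h : IsRadialSolution m A B) (φ : Test 𝕜) {T : ℝ} (hT : 0 ≤ T) :
    pairing m (shift T φ) (A 0) (-B 0) = pairing m φ (A T) (-B T) := by
  have := (h.reverse T).pairing_shift φ hT
  simpa using this

end IsRadialSolution

end

/-! ### Restriction, translation in L², and decrease of the exterior energy along cones. -/

section

open Test Asymptotics

variable {𝕜 : Type*} [RCLike 𝕜]

/-- Restriction to `(ρ, ∞)`. -/
def restrictIoi (𝕜 : Type*) [RCLike 𝕜] (ρ : ℝ) :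
    Lp 𝕜 2 (volume : Measure ℝ) →L[𝕜] L2Ioi 𝕜 ρ :=
  LpToLpRestrictCLM ℝ 𝕜 𝕜 volume 2 (Ioi ρ)

theorem coeFn_restrictIoi (ρ : ℝ) (f : Lp 𝕜 2 (volume : Measure ℝ)) :
    restrictIoi 𝕜 ρ f =ᵐ[volume.restrict (Ioi ρ)] f :=
  LpToLpRestrictCLM_coeFn 𝕜 (Ioi ρ) f

theorem norm_sq_eq_integral {α : Type*} [MeasurableSpace α] {μ : Measure α} (f : Lp 𝕜 2 μ) : ‖f‖ ^ 2 = ∫ r, ‖f r‖ ^ 2 ∂μ := by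
  rw [← inner_self_eq_norm_sq (𝕜 := 𝕜), L2.inner_def, ← integral_re (L2.integrable_inner _ _)]
  simp only [inner_self_eq_norm_sq]

theorem integrable_norm_sq {α : Type*} [MeasurableSpace α] {μ : Measure α} (f : Lp 𝕜 2 μ) : Integrable (fun r => ‖f r‖ ^ 2) μ :=
  (memLp_two_iff_integrable_sq_norm (Lp.aestronglyMeasurable f)).1 (Lp.memLp f)

theorem norm_sq_restrictIoi (ρ : ℝ) (f : Lp 𝕜 2 (volume : Measure ℝ)) :
    ‖restrictIoi 𝕜 ρ f‖ ^ 2 = ∫ r in Ioi ρ, ‖f r‖ ^ 2 := by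
  rw [norm_sq_eq_integral]
  refine integral_congr_ae ?_
  filter_upwards [coeFn_restrictIoi ρ f] with r hr
  rw [hr]

theorem norm_sq_restrictIoi_anti {ρ ρ' : ℝ} (h : ρ ≤ ρ') (f : Lp 𝕜 2 (volume : Measure ℝ)) :
    ‖restrictIoi 𝕜 ρ' f‖ ^ 2 ≤ ‖restrictIoi 𝕜 ρ f‖ ^ 2 := by
  rw [norm_sq_restrictIoi, norm_sq_restrictIoi]
  exact setIntegral_mono_set (integrable_norm_sq f).integrableOn
    (Eventually.of_forall fun r => by positivity) (Ioi_subset_Ioi h).eventuallyLE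

theorem inner_toLp_restrictIoi {ρ : ℝ} {ζ : Test 𝕜} (hζ : ζ ∈ supportedOn 𝕜 ρ)
    (f : Lp 𝕜 2 (volume : Measure ℝ)) :
    inner 𝕜 (toLp (volume.restrict (Ioi ρ)) ζ) (restrictIoi 𝕜 ρ f) = inner 𝕜 (toLp volume ζ) f := by
  rw [inner_toLp, inner_toLp, ← setIntegral_inner hζ]
  refine integral_congr_ae ?_
  filter_upwards [coeFn_restrictIoi ρ f] with r hr
  rw [hr]

/-- The translate `f(σ + ·)` of an `L²` function. -/
def translate (σ : ℝ) (f : Lp 𝕜 2 (volume : Measure ℝ)) : Lp 𝕜 2 (volume : Measure ℝ) :=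
  DomAddAct.mk σ +ᵥ f

theorem coeFn_translate (σ : ℝ) (f : Lp 𝕜 2 (volume : Measure ℝ)) :
    translate σ f =ᵐ[volume] fun r => f (σ + r) :=
  DomAddAct.vadd_Lp_ae_eq (DomAddAct.mk σ) f

theorem continuous_translate {X : Type*} [TopologicalSpace X] {σ : X → ℝ}
    {f : X → Lp 𝕜 2 (volume : Measure ℝ)} (hσ : Continuous σ) (hf : Continuous f) :
    Continuous fun x => translate (σ x) (f x) := by
  have h : Continuous fun x => DomAddAct.mk (σ x) := DomAddAct.continuous_mk.comp hσ
  have : Fact ((2 : ℝ≥0∞) ≠ ⊤) := ⟨ENNReal.ofNat_ne_top⟩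
  exact h.vadd hf

theorem translate_zero (f : Lp 𝕜 2 (volume : Measure ℝ)) : translate 0 f = f := by
  refine Lp.ext ?_
  filter_upwards [coeFn_translate 0 f] with r hr
  rw [hr, zero_add]

theorem norm_sq_restrictIoi_translate (ρ σ : ℝ) (f : Lp 𝕜 2 (volume : Measure ℝ)) :
    ‖restrictIoi 𝕜 ρ (translate σ f)‖ ^ 2 = ‖restrictIoi 𝕜 (ρ + σ) f‖ ^ 2 := by
  rw [norm_sq_restrictIoi, norm_sq_restrictIoi]
  have : ∫ r in Ioi ρ, ‖translate σ f r‖ ^ 2 = ∫ r in Ioi ρ, ‖f (σ + r)‖ ^ 2 := by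
    refine integral_congr_ae ?_
    filter_upwards [ae_restrict_of_ae (coeFn_translate σ f)] with r hr
    rw [hr]
  rw [this, ← integral_indicator measurableSet_Ioi, ← integral_indicator measurableSet_Ioi,
    ← integral_add_left_eq_self (μ := volume) ((Ioi (ρ + σ)).indicator fun r => ‖f r‖ ^ 2) σ]
  congr 1 with r
  by_cases hr : ρ < r
  · rw [indicator_of_mem (by simpa using hr), indicator_of_mem (by simp only [mem_Ioi]; linarith)]
  · rw [indicator_of_notMem (by simpa using hr),
      indicator_of_notMem (by simp only [mem_Ioi]; linarith)]

theorem inner_toLp_translate {s : ℝ} {ζ : Test 𝕜} (hζ : ζ ∈ supportedOn 𝕜 (-s))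
    (f : Lp 𝕜 2 (volume : Measure ℝ)) :
    inner 𝕜 (toLp volume ζ) (translate s f) = inner 𝕜 (toLp volume (shift s ζ)) f := by
  rw [inner_toLp, inner_toLp]
  have : ∫ r, inner 𝕜 (ζ r) (translate s f r) = ∫ r, inner 𝕜 (ζ r) (f (s + r)) := by
    refine integral_congr_ae ?_
    filter_upwards [coeFn_translate s f] with r hr
    rw [hr]
  rw [this, ← integral_add_left_eq_self (μ := volume) (fun r => inner 𝕜 (shift s ζ r) (f r)) s]
  congr 1 with r
  rw [shift_apply hζ, add_sub_cancel_left]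

/-- Multiplication by a bounded function, as an operator on `L²`. -/
theorem exists_mul_clm {w : ℝ → ℝ} (hw : Measurable w) {C : ℝ} (hC : ∀ r, |w r| ≤ C) :
    ∃ M : Lp 𝕜 2 (volume : Measure ℝ) →L[𝕜] Lp 𝕜 2 (volume : Measure ℝ),
      ∀ f, M f =ᵐ[volume] fun r => (w r : 𝕜) * f r := by
  have hmem : ∀ f : Lp 𝕜 2 (volume : Measure ℝ), MemLp (fun r => (w r : 𝕜) * f r) 2 volume :=
    fun f => (Lp.memLp f).of_le_mul (c := C)
      ((RCLike.measurable_ofReal.comp hw).aestronglyMeasurable.mul (Lp.aestronglyMeasurable f))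
      (Eventually.of_forall fun r => by
        rw [norm_mul, RCLike.norm_ofReal]
        exact mul_le_mul_of_nonneg_right (hC r) (norm_nonneg _))
  refine ⟨LinearMap.mkContinuous
    { toFun := fun f => (hmem f).toLp _
      map_add' := fun f g => ?_
      map_smul' := fun c f => ?_ } C fun f => ?_, fun f => (hmem f).coeFn_toLp⟩
  · rw [← MemLp.toLp_add]
    refine MemLp.toLp_congr _ _ ?_
    filter_upwards [Lp.coeFn_add f g] with r hr
    rw [hr, Pi.add_apply, Pi.add_apply, mul_add]
  · rw [RingHom.id_apply, ← MemLp.toLp_const_smul]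
    refine MemLp.toLp_congr _ _ ?_
    filter_upwards [Lp.coeFn_smul c f] with r hr
    rw [hr, Pi.smul_apply, Pi.smul_apply, smul_eq_mul, smul_eq_mul, mul_left_comm]
  · refine Lp.norm_le_mul_norm_of_ae_le_mul ?_
    filter_upwards [(hmem f).coeFn_toLp] with r hr
    change ‖(hmem f).toLp _ r‖ ≤ _
    rw [hr, norm_mul, RCLike.norm_ofReal]
    exact mul_le_mul_of_nonneg_right (hC r) (norm_nonneg _)

/-- A curve in `L²(ρ, ∞)` with a continuous weak derivative is differentiable. -/
theorem hasDerivAt_of_inner {ρ δ : ℝ} (hρ : 0 ≤ ρ) (hδ : 0 < δ) {Z Y : ℝ → L2Ioi 𝕜 ρ}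
    (hY : ContinuousAt Y 0)
    (h : ∀ ζ ∈ supportedOn 𝕜 ρ, ∀ s, |s| < δ →
      HasDerivAt (fun s => inner 𝕜 (toLp (volume.restrict (Ioi ρ)) ζ) (Z s))
        (inner 𝕜 (toLp (volume.restrict (Ioi ρ)) ζ) (Y s)) s) :
    HasDerivAt Z (Y 0) 0 := by
  rw [hasDerivAt_iff_isLittleO, isLittleO_iff]
  intro ε hε
  obtain ⟨η, hη, hYη⟩ := Metric.continuousAt_iff.1 hY ε hε
  filter_upwards [Metric.ball_mem_nhds (0 : ℝ) (lt_min hη hδ)] with s hs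
  rw [Metric.mem_ball, dist_zero_right, Real.norm_eq_abs, lt_min_iff] at hs
  -- The mean value inequality bounds each pairing by ‖z‖ ε |s|, uniformly in the test function, and
  -- duality turns this into a norm bound.
  refine norm_le_of_inner_D_pow_le (n := 0) hρ (by positivity) fun ζ hζ => ?_
  simp only [pow_zero, Module.End.one_apply, sub_zero]
  set z := toLp (volume.restrict (Ioi ρ)) ζ
  have hd : ∀ u ∈ uIcc 0 s, HasDerivWithinAt
      (fun u => inner 𝕜 z (Z u) - u • inner 𝕜 z (Y 0)) (inner 𝕜 z (Y u - Y 0)) (uIcc 0 s) u := by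
    intro u hu
    have hu' : |u| < δ := (by
      have := abs_sub_left_of_mem_uIcc hu
      simpa using this : |u| ≤ |s|).trans_lt hs.2
    have := (h ζ hζ u hu').sub ((hasDerivAt_id u).smul_const (inner 𝕜 z (Y 0)))
    rw [one_smul, ← inner_sub_right] at this
    exact this.hasDerivWithinAt
  have hb : ∀ u ∈ uIcc 0 s, ‖inner 𝕜 z (Y u - Y 0)‖ ≤ ‖z‖ * ε := by
    intro u hu
    have hu' : |u| < η := (by
      have := abs_sub_left_of_mem_uIcc hu
      simpa using this : |u| ≤ |s|).trans_lt hs.1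
    refine (norm_inner_le_norm _ _).trans (mul_le_mul_of_nonneg_left ?_ (norm_nonneg _))
    rw [← dist_eq_norm]
    exact (hYη (by rwa [dist_zero_right])).le
  have := (convex_uIcc (0 : ℝ) s).norm_image_sub_le_of_norm_hasDerivWithin_le hd hb
    left_mem_uIcc right_mem_uIcc
  simp only [zero_smul, sub_zero] at this
  rw [inner_sub_right, inner_sub_right, RCLike.real_smul_eq_coe_smul (K := 𝕜) s (Y 0), inner_smul_right,
    ← RCLike.real_smul_eq_coe_mul, sub_right_comm, ← mul_assoc]
  exact this

/-- In the moving frame the transport term ∂_r F cancels and only the zeroth-order term G/r remains,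
so the curve is differentiable in norm. Truncating 1/r below ρ/2 makes it a bounded multiplier
without changing it on r > ρ. -/
theorem hasDerivAt_restrictIoi_translate {ρ : ℝ} (hρ : 0 < ρ) {t : ℝ}
    {M : Lp 𝕜 2 (volume : Measure ℝ) →L[𝕜] Lp 𝕜 2 (volume : Measure ℝ)}
    (hM : ∀ f, M f =ᵐ[volume] fun r => (((max r (ρ / 2))⁻¹ : ℝ) : 𝕜) * f r)
    {F G : ℝ → Lp 𝕜 2 (volume : Measure ℝ)} (hF : Continuous F) (hG : Continuous G)
    (h : ∀ (ζ : Test 𝕜) (t : ℝ), HasDerivAt (fun s => inner 𝕜 (toLp volume ζ) (F s))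
      (-inner 𝕜 (toLp volume (D ζ)) (F t) + inner 𝕜 (toLp volume (xpow (-1) ζ)) (G t)) t) :
    HasDerivAt (fun s => restrictIoi 𝕜 ρ (translate (-s) (F (t + s))))
      (restrictIoi 𝕜 ρ (M (G t))) 0 := by
  have hYc : Continuous fun s => restrictIoi 𝕜 ρ (translate (-s) (M (G (t + s)))) :=
    (restrictIoi 𝕜 ρ).continuous.comp (continuous_translate continuous_neg
      (M.continuous.comp (hG.comp (continuous_const.add continuous_id))))
  have := hasDerivAt_of_inner hρ.le (half_pos hρ) hYc.continuousAt
    (Z := fun s => restrictIoi 𝕜 ρ (translate (-s) (F (t + s)))) fun ζ hζ s hs => ?_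
  · simpa [translate_zero] using this
  have hmem : ∀ u, |u| < ρ / 2 → ζ ∈ supportedOn 𝕜 u := fun u hu =>
    supportedOn_mono (by linarith [le_abs_self u]) hζ
  have hsupp : ∀ u, |u| < ρ / 2 → ζ ∈ supportedOn 𝕜 (-(-u)) := fun u hu => by
    rw [neg_neg]; exact hmem u hu
  have hO : (1 : Module.End 𝕜 (Test 𝕜)) ∈ laurentOps 𝕜 := by
    simpa [xpow_zero] using xpow_mul_D_pow_mem (𝕜 := 𝕜) 0 0
  have h0 := isLittleO_shift hO (hsupp s hs)
  simp only [Module.End.one_apply] at h0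
  have hneg : Tendsto (fun u : ℝ => -u) (𝓝 s) (𝓝 (-s)) := (continuous_neg.tendsto s)
  have h1 : (fun u => toLp volume (shift (-u) ζ) - toLp volume (shift (-s) ζ) -
      ((u - s : ℝ) : 𝕜) • toLp volume (shift (-s) (D ζ))) =o[𝓝 s] fun u => u - s := by
    refine ((h0.comp_tendsto hneg).congr (fun u => ?_) fun u => rfl).trans_isBigO
      (IsBigO.of_bound 1 (Eventually.of_forall fun u => ?_))
    · simp only [Function.comp_apply]
      rw [show (-u - -s : ℝ) = -(u - s) by ring, RCLike.ofReal_neg, smul_neg, neg_smul, neg_neg]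
    · simp only [Function.comp_apply, one_mul]
      rw [show (-u - -s : ℝ) = -(u - s) by ring, norm_neg]
  have hFc : Continuous fun s => F (t + s) := hF.comp (continuous_const.add continuous_id)
  have hder := (h (shift (-s) ζ) (t + s)).comp_const_add t s
  have h2 := hasDerivAt_inner_of_isLittleO h1 hFc.continuousAt hder
  rw [D_shift (hsupp s hs), neg_add_cancel_comm] at h2
  have hev : ∀ᶠ u in 𝓝 s, |u| < ρ / 2 := (continuous_abs.tendsto s).eventually (gt_mem_nhds hs)
  refine (h2.congr_of_eventuallyEq ?_).congr_deriv ?_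
  · filter_upwards [hev] with u hu
    rw [inner_toLp_restrictIoi hζ, inner_toLp_translate (hsupp u hu)]
  · rw [inner_toLp_restrictIoi hζ, inner_toLp_translate (hsupp s hs), inner_toLp, inner_toLp]
    refine integral_congr_ae ?_
    filter_upwards [hM (G (t + s))] with r hr
    rw [hr, xpow_apply]
    by_cases hz : shift (-s) ζ r = 0
    · simp [hz]
    · have hr' : ρ + -s < r := shift_mem (hsupp s hs) hζ (subset_tsupport _ hz)
      -- The shifted support lies in r > ρ - s > ρ/2, where the truncated weight is 1/r.
      rw [max_eq_left (by linarith [le_abs_self s]), inner_smul_left_eq_star_smul, zpow_neg_one,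
        ← smul_eq_mul, inner_smul_right, RCLike.real_smul_eq_coe_mul]
      simp

/-- A real multiplier is symmetric; this cancels the two zeroth-order cross terms in the energy
identity. -/
theorem re_inner_restrictIoi_mul_comm {ρ : ℝ} {w : ℝ → ℝ}
    {M : Lp 𝕜 2 (volume : Measure ℝ) →L[𝕜] Lp 𝕜 2 (volume : Measure ℝ)}
    (hM : ∀ f, M f =ᵐ[volume] fun r => (w r : 𝕜) * f r) (f g : Lp 𝕜 2 (volume : Measure ℝ)) :
    RCLike.re (inner 𝕜 (restrictIoi 𝕜 ρ f) (restrictIoi 𝕜 ρ (M g))) =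
      RCLike.re (inner 𝕜 (restrictIoi 𝕜 ρ g) (restrictIoi 𝕜 ρ (M f))) := by
  rw [L2.inner_def, L2.inner_def, ← integral_re (L2.integrable_inner _ _),
    ← integral_re (L2.integrable_inner _ _)]
  refine integral_congr_ae ?_
  filter_upwards [coeFn_restrictIoi ρ f, coeFn_restrictIoi ρ g, coeFn_restrictIoi ρ (M f),
    coeFn_restrictIoi ρ (M g), ae_restrict_of_ae (hM f), ae_restrict_of_ae (hM g)]
    with r h1 h2 h3 h4 h5 h6
  rw [h1, h2, h3, h4, h5, h6, ← smul_eq_mul, ← smul_eq_mul, inner_smul_right, inner_smul_right,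
    RCLike.re_ofReal_mul, RCLike.re_ofReal_mul, inner_re_symm]

theorem hasDerivAt_norm_sq {H : Type*} [NormedAddCommGroup H] [InnerProductSpace 𝕜 H]
    [NormedSpace ℝ H] [IsScalarTower ℝ 𝕜 H] {Z : ℝ → H} {Z' : H} {t : ℝ} (h : HasDerivAt Z Z' t) :
    HasDerivAt (fun s => ‖Z s‖ ^ 2) (2 * RCLike.re (inner 𝕜 (Z t) Z')) t := by
  have h1 := h.inner 𝕜 h
  have h2 := (RCLike.reCLM (K := 𝕜)).hasFDerivAt.comp_hasDerivAt t h1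
  have h3 : (fun s => ‖Z s‖ ^ 2) = (RCLike.reCLM (K := 𝕜)) ∘ fun s => inner 𝕜 (Z s) (Z s) :=
    funext fun s => (inner_self_eq_norm_sq (𝕜 := 𝕜) (Z s)).symm
  rw [h3]
  refine h2.congr_deriv ?_
  rw [map_add, RCLike.reCLM_apply, inner_re_symm Z' (Z t)]
  exact (two_mul _).symm

theorem norm_sq_restrictIoi_add_sub (ρ : ℝ) (f g : Lp 𝕜 2 (volume : Measure ℝ)) :
    ‖restrictIoi 𝕜 ρ (f + g)‖ ^ 2 + ‖restrictIoi 𝕜 ρ (f - g)‖ ^ 2 =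
      2 * (‖restrictIoi 𝕜 ρ f‖ ^ 2 + ‖restrictIoi 𝕜 ρ g‖ ^ 2) := by
  rw [map_add, map_sub]
  have := parallelogram_law_with_norm 𝕜 (restrictIoi 𝕜 ρ f) (restrictIoi 𝕜 ρ g)
  simpa only [sq] using this

theorem continuous_norm_sq_restrictIoi {F : ℝ → Lp 𝕜 2 (volume : Measure ℝ)} (hF : Continuous F)
    (ρ : ℝ) : Continuous fun t => ‖restrictIoi 𝕜 (ρ + t) (F t)‖ ^ 2 := by
  simp_rw [← norm_sq_restrictIoi_translate]
  exact ((restrictIoi 𝕜 ρ).continuous.comp (continuous_translate continuous_id hF)).norm.pow 2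

namespace IsRadialSolution

variable {m : ℕ} {A B : ℝ → Lp 𝕜 2 (volume : Measure ℝ)}

theorem hasDerivAt_translate_add (h : IsRadialSolution m A B) {ρ : ℝ} (hρ : 0 < ρ) (t : ℝ)
    {M : Lp 𝕜 2 (volume : Measure ℝ) →L[𝕜] Lp 𝕜 2 (volume : Measure ℝ)}
    (hM : ∀ f, M f =ᵐ[volume] fun r => (((max r (ρ / 2))⁻¹ : ℝ) : 𝕜) * f r) :
    HasDerivAt (fun s => restrictIoi 𝕜 ρ (translate (-s) (A (t + s) + B (t + s))))
      ((m : 𝕜) • restrictIoi 𝕜 ρ (M (A t - B t))) 0 := by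
  have := hasDerivAt_restrictIoi_translate hρ hM (t := t)
    (F := fun s => A s + B s) (G := fun s => (m : 𝕜) • (A s - B s))
    (h.continuous_fst.add h.continuous_snd)
    ((continuous_const_smul (m : 𝕜)).comp (h.continuous_fst.sub h.continuous_snd)) fun ζ t => by
      have := (h.hasDerivAt_fst ζ t).add (h.hasDerivAt_snd ζ t)
      simp only [inner_add_right]
      refine this.congr_deriv ?_
      simp only [LinearMap.add_apply, LinearMap.sub_apply, LinearMap.smul_apply, map_add, map_sub,
        map_smul, inner_add_left, inner_sub_left, inner_smul_left, inner_smul_right,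
        inner_sub_right, map_natCast]
      ring
  simpa only [map_smul] using this

/-- The energy outside the light cone of a ball decreases with time. -/
theorem exteriorEnergy_le (h : IsRadialSolution m A B) {ρ t : ℝ} (hρ : 0 < ρ) (ht : 0 ≤ t) :
    ‖restrictIoi 𝕜 (ρ + t) (A t)‖ ^ 2 + ‖restrictIoi 𝕜 (ρ + t) (B t)‖ ^ 2 ≤
      ‖restrictIoi 𝕜 ρ (A 0)‖ ^ 2 + ‖restrictIoi 𝕜 ρ (B 0)‖ ^ 2 := by
  -- A + B is transported inward and A - B outward, with coupling terms ±(m/r)(A ∓ B). By the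
  -- parallelogram law Φ is twice the exterior energy.
  set Φ : ℝ → ℝ := fun t => ‖restrictIoi 𝕜 (ρ + t) (A t + B t)‖ ^ 2 +
    ‖restrictIoi 𝕜 (ρ + t) (A t - B t)‖ ^ 2 with hΦ
  suffices h : Φ t ≤ Φ 0 by
    simp only [hΦ, norm_sq_restrictIoi_add_sub] at h
    rw [add_zero] at h
    linarith
  have hc : Continuous Φ :=
    (continuous_norm_sq_restrictIoi (h.continuous_fst.add h.continuous_snd) ρ).add
      (continuous_norm_sq_restrictIoi (h.continuous_fst.sub h.continuous_snd) ρ)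
  refine image_le_of_liminf_slope_right_le_deriv_boundary (B := fun _ => Φ 0)
    (B' := fun _ => 0) (a := 0) (b := t) hc.continuousOn le_rfl continuousOn_const
    (fun x _ => hasDerivWithinAt_const _ _ _) (fun x hx c hcx => ?_) ⟨ht, le_rfl⟩
  have hρx : 0 < ρ + x := by linarith [hx.1]
  obtain ⟨M, hM⟩ := exists_mul_clm (𝕜 := 𝕜) (w := fun r => (max r ((ρ + x) / 2))⁻¹)
    (measurable_id.max measurable_const).inv (C := ((ρ + x) / 2)⁻¹) fun r => by
      rw [abs_of_nonneg (by positivity)]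
      exact inv_anti₀ (by linarith) (le_max_right _ _)
  have h1 := hasDerivAt_norm_sq (𝕜 := 𝕜) (h.hasDerivAt_translate_add hρx x hM)
  have h2' := (h.reverse (x + x)).hasDerivAt_translate_add hρx x hM
  have h2 : HasDerivAt (fun s => restrictIoi 𝕜 (ρ + x) (translate s (A (x + s) - B (x + s))))
      (-((m : 𝕜) • restrictIoi 𝕜 (ρ + x) (M (A x + B x)))) 0 := by
    have := h2'.scomp_of_eq (0 : ℝ) (hasDerivAt_neg (0 : ℝ)) (by simp)
    rw [add_comm (A x) (B x)]
    simpa [Function.comp_def, ← sub_eq_add_neg] using this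
  have h2 := hasDerivAt_norm_sq (𝕜 := 𝕜) h2
  have h3 := h1.add h2
  -- Each characteristic component is followed in its own frame. Ψ is stationary at s = 0 since the
  -- coupling terms cancel.
  set Ψ : ℝ → ℝ := fun s =>
    ‖restrictIoi 𝕜 (ρ + x) (translate (-s) (A (x + s) + B (x + s)))‖ ^ 2 +
    ‖restrictIoi 𝕜 (ρ + x) (translate s (A (x + s) - B (x + s)))‖ ^ 2 with hΨ
  have h4 : HasDerivAt Ψ 0 0 := by
    refine h3.congr_deriv ?_
    simp only [neg_zero, add_zero, translate_zero, inner_neg_right, inner_smul_right, map_neg]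
    rw [← RCLike.ofReal_natCast, RCLike.re_ofReal_mul, RCLike.re_ofReal_mul,
      re_inner_restrictIoi_mul_comm hM (A x - B x)]
    ring
  have h5 : HasDerivAt (fun z => Ψ (z - x)) 0 x := by
    simpa [Function.comp_def] using
      HasDerivAt.comp_of_eq x h4 ((hasDerivAt_id x).sub_const x) (by simp)
  have h6 := h5.hasDerivWithinAt (s := Ioi x)
  rw [hasDerivWithinAt_iff_tendsto_slope' (by simp)] at h6
  refine ((h6.eventually (gt_mem_nhds hcx)).frequently).mp ?_
  filter_upwards [self_mem_nhdsWithin] with z hz hs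
  refine lt_of_le_of_lt ?_ hs
  have hzx : 0 < z - x := sub_pos.2 hz
  rw [slope_def_field, slope_def_field]
  refine div_le_div_of_nonneg_right ?_ hzx.le
  have e1 : Ψ (x - x) = Φ x := by
    simp only [hΨ, hΦ, sub_self, neg_zero, add_zero, translate_zero]
  -- For A - B the frame moves with the cone. For A + B it moves inward, so Ψ integrates over a
  -- larger region than Φ; hence Φ has right slopes controlled by those of Ψ.
  have e2 : Φ z ≤ Ψ (z - x) := by
    simp only [hΨ, hΦ, norm_sq_restrictIoi_translate, add_sub_cancel]
    refine add_le_add (norm_sq_restrictIoi_anti (by linarith) _) (le_of_eq ?_)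
    rw [show ρ + x + (z - x) = ρ + z by ring]
  linarith

end IsRadialSolution

end

/-! ### Vanishing of the defects and the limits of the exterior energy. -/

section

open Test

variable {𝕜 : Type*} [RCLike 𝕜]

theorem tendsto_norm_sq_restrictIoi (f : Lp 𝕜 2 (volume : Measure ℝ)) :
    Tendsto (fun ρ => ‖restrictIoi 𝕜 ρ f‖ ^ 2) atTop (𝓝 0) := by
  simp_rw [norm_sq_restrictIoi]
  have h := tendsto_setIntegral_of_antitone (μ := volume) (s := fun ρ : ℝ => Ioi ρ)
    (f := fun r => ‖f r‖ ^ 2) (fun _ => measurableSet_Ioi) (fun a b hab => Ioi_subset_Ioi hab)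
    ⟨0, (integrable_norm_sq f).integrableOn⟩
  have he : ⋂ ρ : ℝ, Ioi ρ = ∅ := by
    rw [eq_empty_iff_forall_notMem]
    intro x hx
    exact lt_irrefl x (mem_iInter.1 hx x)
  rwa [he, setIntegral_empty] at h

theorem norm_LpToLpRestrictCLM {μ : Measure ℝ} (s : Set ℝ) (x : Lp 𝕜 2 μ) :
    ‖LpToLpRestrictCLM ℝ 𝕜 𝕜 μ 2 s x‖ = √(∫ r in s, ‖x r‖ ^ 2 ∂μ) := by
  rw [← Real.sqrt_sq (norm_nonneg (LpToLpRestrictCLM ℝ 𝕜 𝕜 μ 2 s x)), norm_sq_eq_integral]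
  congr 1
  refine integral_congr_ae ?_
  filter_upwards [LpToLpRestrictCLM_coeFn 𝕜 s x] with r hr
  rw [hr]

/-- Cauchy–Schwarz is applied separately on s and on its complement. -/
theorem norm_inner_le_of_measurableSet {μ : Measure ℝ} {s : Set ℝ} (hs : MeasurableSet s)
    (x y : Lp 𝕜 2 μ) :
    ‖inner 𝕜 x y‖ ≤ √(∫ r in s, ‖x r‖ ^ 2 ∂μ) * ‖y‖ + ‖x‖ * √(∫ r in sᶜ, ‖y r‖ ^ 2 ∂μ) := by
  have hle : ∀ (s : Set ℝ) (x : Lp 𝕜 2 μ), √(∫ r in s, ‖x r‖ ^ 2 ∂μ) ≤ ‖x‖ := fun s x => by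
    rw [← Real.sqrt_sq (norm_nonneg x), norm_sq_eq_integral]
    exact Real.sqrt_le_sqrt (setIntegral_le_integral (integrable_norm_sq x)
      (Eventually.of_forall fun r => by positivity))
  have hin : ∀ s : Set ℝ, ‖∫ r in s, inner 𝕜 (x r) (y r) ∂μ‖ ≤
      √(∫ r in s, ‖x r‖ ^ 2 ∂μ) * √(∫ r in s, ‖y r‖ ^ 2 ∂μ) := fun s => by
    rw [← norm_LpToLpRestrictCLM, ← norm_LpToLpRestrictCLM]
    refine le_trans (le_of_eq ?_) (norm_inner_le_norm (𝕜 := 𝕜) _ _)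
    rw [L2.inner_def]
    congr 1
    refine integral_congr_ae ?_
    filter_upwards [LpToLpRestrictCLM_coeFn 𝕜 s x, LpToLpRestrictCLM_coeFn 𝕜 s y] with r h1 h2
    rw [h1, h2]
  rw [L2.inner_def, ← integral_add_compl hs (L2.integrable_inner x y)]
  refine (norm_add_le _ _).trans (add_le_add ((hin s).trans ?_) ((hin sᶜ).trans ?_))
  · exact mul_le_mul_of_nonneg_left (hle s y) (Real.sqrt_nonneg _)
  · exact mul_le_mul_of_nonneg_right (hle sᶜ x) (Real.sqrt_nonneg _)

/-- Elements of a finite-dimensional space of square-integrable functions are uniformly small on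
small sets. -/
theorem exists_setIntegral_le {μ : Measure ℝ} (V : Submodule 𝕜 (Lp 𝕜 2 μ)) [FiniteDimensional 𝕜 V]
    {s : ℕ → Set ℝ} (hs : ∀ n, MeasurableSet (s n)) (hanti : Antitone s) (hemp : ⋂ n, s n = ∅)
    {ε : ℝ} (hε : 0 < ε) :
    ∃ n, ∀ v ∈ V, √(∫ r in s n, ‖v r‖ ^ 2 ∂μ) ≤ ε * ‖v‖ := by
  have hlim : ∀ x : Lp 𝕜 2 μ,
      Tendsto (fun n => ‖LpToLpRestrictCLM ℝ 𝕜 𝕜 μ 2 (s n) x‖) atTop (𝓝 0) := fun x => by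
    simp_rw [norm_LpToLpRestrictCLM]
    have h := tendsto_setIntegral_of_antitone (μ := μ) (f := fun r => ‖x r‖ ^ 2) hs hanti
      ⟨0, (integrable_norm_sq x).integrableOn⟩
    rw [hemp, setIntegral_empty] at h
    simpa using h.sqrt
  set e := stdOrthonormalBasis 𝕜 V
  have hsum : Tendsto (fun n => ∑ i, ‖LpToLpRestrictCLM ℝ 𝕜 𝕜 μ 2 (s n) (e i : Lp 𝕜 2 μ)‖) atTop
      (𝓝 0) := by
    simpa using tendsto_finsetSum Finset.univ fun i _ => hlim (e i : Lp 𝕜 2 μ)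
  obtain ⟨n, hn⟩ := (hsum.eventually (gt_mem_nhds hε)).exists
  refine ⟨n, fun v hv => ?_⟩
  rw [← norm_LpToLpRestrictCLM]
  have hv' : v = ∑ i, e.repr ⟨v, hv⟩ i • (e i : Lp 𝕜 2 μ) := by
    have := congrArg (Submodule.subtype V) (e.sum_repr ⟨v, hv⟩)
    simpa using this.symm
  conv_lhs => rw [hv']
  rw [map_sum]
  refine (norm_sum_le _ _).trans ?_
  have hcoef : ∀ i, ‖e.repr ⟨v, hv⟩ i‖ ≤ ‖v‖ := fun i =>
    (PiLp.norm_apply_le _ i).trans_eq (e.repr.norm_map _)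
  calc ∑ i, ‖LpToLpRestrictCLM ℝ 𝕜 𝕜 μ 2 (s n) (e.repr ⟨v, hv⟩ i • (e i : Lp 𝕜 2 μ))‖
      ≤ ∑ i, ‖v‖ * ‖LpToLpRestrictCLM ℝ 𝕜 𝕜 μ 2 (s n) (e i : Lp 𝕜 2 μ)‖ := by
        refine Finset.sum_le_sum fun i _ => ?_
        rw [map_smul, norm_smul]
        exact mul_le_mul_of_nonneg_right (hcoef i) (norm_nonneg _)
    _ = (∑ i, ‖LpToLpRestrictCLM ℝ 𝕜 𝕜 μ 2 (s n) (e i : Lp 𝕜 2 μ)‖) * ‖v‖ := by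
        rw [← Finset.mul_sum, mul_comm]
    _ ≤ ε * ‖v‖ := mul_le_mul_of_nonneg_right hn.le (norm_nonneg _)

theorem memLp_zpow_Ioi {ρ : ℝ} (hρ : 0 < ρ) {k : ℤ} (hk : k < 0) :
    MemLp (fun r : ℝ => ((r ^ k : ℝ) : 𝕜)) 2 (volume.restrict (Ioi ρ)) := by
  have hmeas : Measurable (fun r : ℝ => ((r ^ k : ℝ) : 𝕜)) :=
    RCLike.measurable_ofReal.comp (measurable_id.pow_const k)
  rw [memLp_two_iff_integrable_sq_norm hmeas.aestronglyMeasurable]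
  have h : IntegrableOn (fun r : ℝ => r ^ ((2 * k : ℤ) : ℝ)) (Ioi ρ) :=
    integrableOn_Ioi_rpow_of_lt (by exact_mod_cast (by omega)) hρ
  refine h.congr_fun (fun r hr => ?_) measurableSet_Ioi
  dsimp only
  rw [RCLike.norm_ofReal, sq_abs, Real.rpow_intCast, ← zpow_natCast, ← zpow_mul, mul_comm]
  rfl

open Classical in
/-- The function `r^k` as an element of `L²(ρ, ∞)` (zero if it is not square-integrable). -/
def powLp (𝕜 : Type*) [RCLike 𝕜] (ρ : ℝ) (k : ℤ) : L2Ioi 𝕜 ρ :=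
  if h : MemLp (fun r : ℝ => ((r ^ k : ℝ) : 𝕜)) 2 (volume.restrict (Ioi ρ)) then h.toLp _ else 0

theorem coeFn_powLp {ρ : ℝ} (hρ : 0 < ρ) {k : ℤ} (hk : k < 0) :
    powLp 𝕜 ρ k =ᵐ[volume.restrict (Ioi ρ)] fun r => ((r ^ k : ℝ) : 𝕜) := by
  rw [powLp, dif_pos (memLp_zpow_Ioi hρ hk)]
  exact MemLp.coeFn_toLp _

theorem coeFn_sum_powLp {n : ℕ} {b : ℕ → 𝕜} (hb : ∀ j < n, n ≤ 2 * j + 1 → b j = 0) {ρ : ℝ}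
    (hρ : 0 < ρ) :
    (∑ j ∈ Finset.range n, b j • powLp 𝕜 ρ (2 * j + 1 - n) : L2Ioi 𝕜 ρ)
      =ᵐ[volume.restrict (Ioi ρ)]
        fun r => ∑ j ∈ Finset.range n, b j * ((r ^ (2 * j + 1 - n : ℤ) : ℝ) : 𝕜) := by
  have hp : ∀ j ∈ Finset.range n, (b j • powLp 𝕜 ρ (2 * j + 1 - n) : L2Ioi 𝕜 ρ)
      =ᵐ[volume.restrict (Ioi ρ)] fun r => b j * ((r ^ (2 * j + 1 - n : ℤ) : ℝ) : 𝕜) := fun j hj => by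
    by_cases h : (2 * j + 1 - n : ℤ) < 0
    · filter_upwards [Lp.coeFn_smul (b j) (powLp 𝕜 ρ (2 * j + 1 - n)), coeFn_powLp (𝕜 := 𝕜) hρ h]
        with r h1 h2
      rw [h1, Pi.smul_apply, h2, smul_eq_mul]
    · rw [hb j (Finset.mem_range.1 hj) (by omega), zero_smul]
      filter_upwards [Lp.coeFn_zero 𝕜 2 (volume.restrict (Ioi ρ))] with r hr
      rw [hr, zero_mul]
      rfl
  refine (Lp.coeFn_finsetSum _ _).trans ?_
  filter_upwards [(Finset.eventually_all (Finset.range n)).2 hp] with r hr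
  rw [Finset.sum_apply]
  exact Finset.sum_congr rfl hr

theorem exists_defect_eq_sum (n : ℕ) {ρ : ℝ} (hρ : 0 < ρ) (A : L2Ioi 𝕜 ρ) :
    ∃ b : ℕ → 𝕜, (∀ j < n, n ≤ 2 * j + 1 → b j = 0) ∧
      defect n ρ A = ∑ j ∈ Finset.range n, b j • powLp 𝕜 ρ (2 * j + 1 - n) := by
  obtain ⟨b, hb, h⟩ := defect_ae_eq (n := n) hρ.le A
  exact ⟨b, hb, Lp.ext (h.trans (coeFn_sum_powLp hb hρ).symm)⟩

theorem setIntegral_preimage_mul {ρ : ℝ} (hρ : 0 < ρ) {s : Set ℝ} (hs : MeasurableSet s)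
    (f : ℝ → ℝ) :
    ∫ r in (fun r => ρ * r) ⁻¹' s, f (ρ * r) = ρ⁻¹ * ∫ r in s, f r := by
  rw [← integral_indicator hs, ← integral_indicator (hs.preimage (measurable_const_mul ρ))]
  have := Measure.integral_comp_mul_left (s.indicator f) ρ
  rw [abs_of_pos (inv_pos.2 hρ), smul_eq_mul] at this
  exact this

/-- The defect does not concentrate at the boundary. -/
theorem exists_setIntegral_defect_le (n : ℕ) {ε : ℝ} (hε : 0 < ε) :
    ∃ κ > 0, ∀ ρ > 0, ∀ A : L2Ioi 𝕜 ρ,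
      √(∫ r in Iic (ρ * (1 + κ)), ‖defect n ρ A r‖ ^ 2 ∂(volume.restrict (Ioi ρ))) ≤
        ε * ‖defect n ρ A‖ := by
  let V : Submodule 𝕜 (Lp 𝕜 2 (volume.restrict (Ioi (1 : ℝ)))) :=
    Submodule.span 𝕜 ((fun j : ℕ => powLp 𝕜 1 (2 * j + 1 - n)) '' (Finset.range n : Set ℕ))
  have : FiniteDimensional 𝕜 V :=
    FiniteDimensional.span_of_finite 𝕜 ((Finset.finite_toSet _).image _)
  obtain ⟨k, hk⟩ := exists_setIntegral_le V (s := fun k : ℕ => Ioc 1 (1 + 1 / ((k : ℝ) + 1)))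
    (fun _ => measurableSet_Ioc)
    (fun i j hij => Ioc_subset_Ioc_right (add_le_add_right (Nat.one_div_le_one_div hij) 1)) (by
      rw [eq_empty_iff_forall_notMem]
      intro x hx
      have h := fun i => mem_iInter.1 hx i
      obtain ⟨N, hN⟩ := exists_nat_one_div_lt (sub_pos.2 (h 0).1)
      linarith [(h N).2]) hε
  refine ⟨1 / ((k : ℝ) + 1), Nat.one_div_pos_of_nat, fun ρ hρ A => ?_⟩
  set κ : ℝ := 1 / ((k : ℝ) + 1)
  have hκ : 0 < κ := Nat.one_div_pos_of_nat
  obtain ⟨b, hb, hA⟩ := defect_ae_eq (n := n) hρ.le A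
  set F : ℝ → 𝕜 := fun r => ∑ j ∈ Finset.range n, b j * ((r ^ (2 * j + 1 - n : ℤ) : ℝ) : 𝕜)
  -- Rescaling r = ρr' carries the defect to a combination of the same powers on (1, ∞). One
  -- finite-dimensional space V therefore serves every ρ, and κ does not depend on ρ.
  let v : Lp 𝕜 2 (volume.restrict (Ioi (1 : ℝ))) :=
    ∑ j ∈ Finset.range n, (b j * ((ρ ^ (2 * j + 1 - n : ℤ) : ℝ) : 𝕜)) • powLp 𝕜 1 (2 * j + 1 - n)
  have hvV : v ∈ V := Submodule.sum_mem _ fun j hj =>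
    Submodule.smul_mem _ _ (Submodule.subset_span ⟨j, hj, rfl⟩)
  have hv : v =ᵐ[volume.restrict (Ioi 1)] fun r => F (ρ * r) := by
    refine (coeFn_sum_powLp (fun j hj hj' => by rw [hb j hj hj', zero_mul]) one_pos).trans
      (Eventually.of_forall fun r => Finset.sum_congr rfl fun j _ => ?_)
    rw [mul_zpow, RCLike.ofReal_mul, mul_assoc]
  have hV := hk v hvV
  have hF : ∀ s : Set ℝ, MeasurableSet s → s ⊆ Ioi ρ →
      ∫ r in (fun r => ρ * r) ⁻¹' s, ‖v r‖ ^ 2 = ρ⁻¹ * ∫ r in s, ‖defect n ρ A r‖ ^ 2 := by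
    intro s hs hsub
    have hsub' : (fun r => ρ * r) ⁻¹' s ⊆ Ioi 1 := fun r hr => by
      have : ρ < ρ * r := hsub hr
      simpa [hρ] using this
    have h1 : ∫ r in s, ‖defect n ρ A r‖ ^ 2 = ∫ r in s, ‖F r‖ ^ 2 := by
      refine integral_congr_ae ?_
      filter_upwards [ae_restrict_of_ae_restrict_of_subset hsub hA] with r hr
      rw [hr]
    rw [h1, ← setIntegral_preimage_mul hρ hs fun r => ‖F r‖ ^ 2]
    refine integral_congr_ae ?_
    filter_upwards [ae_restrict_of_ae_restrict_of_subset hsub' hv] with r hr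
    rw [hr]
  have e1 : (fun r => ρ * r) ⁻¹' Ioi ρ = Ioi 1 := by
    ext r
    simp only [mem_preimage, mem_Ioi]
    exact lt_mul_iff_one_lt_right hρ
  have e2 : (fun r => ρ * r) ⁻¹' (Iic (ρ * (1 + κ)) ∩ Ioi ρ) = Ioc 1 (1 + κ) := by
    ext r
    simp only [mem_preimage, mem_inter_iff, mem_Iic, mem_Ioi, mem_Ioc]
    rw [lt_mul_iff_one_lt_right hρ, mul_le_mul_iff_right₀ hρ, and_comm]
  have hF1 := hF (Ioi ρ) measurableSet_Ioi le_rfl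
  have hF2 := hF (Iic (ρ * (1 + κ)) ∩ Ioi ρ) (measurableSet_Iic.inter measurableSet_Ioi)
    inter_subset_right
  rw [e1, ← norm_sq_eq_integral, ← norm_sq_eq_integral] at hF1
  rw [e2] at hF2
  rw [Measure.restrict_restrict measurableSet_Ioc,
    inter_eq_left.2 (Ioc_subset_Ioi_self : Ioc 1 (1 + κ) ⊆ Ioi 1), hF2,
    ← Real.sqrt_sq (norm_nonneg v), hF1, Real.sqrt_mul (by positivity),
    Real.sqrt_mul (by positivity), Real.sqrt_sq (norm_nonneg _), mul_left_comm] at hV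
  rw [Measure.restrict_restrict measurableSet_Iic]
  exact le_of_mul_le_mul_left hV (Real.sqrt_pos.2 (inv_pos.2 hρ))

/-- The defect x of a satisfies ‖x‖² = ⟨x, a⟩. Splitting the inner product at ρ(1 + κ), the inner
piece is small because x does not concentrate there, and the outer piece sees only a beyond ρ(1 +
κ). -/
theorem norm_defect_le (n : ℕ) {ε : ℝ} (hε : 0 < ε) :
    ∃ κ > 0, ∀ ρ > 0, ∀ A : Lp 𝕜 2 (volume : Measure ℝ),
      ‖defect n ρ (restrictIoi 𝕜 ρ A)‖ ≤
        ε * ‖restrictIoi 𝕜 ρ A‖ + ‖restrictIoi 𝕜 (ρ * (1 + κ)) A‖ := by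
  obtain ⟨κ, hκ, h⟩ := exists_setIntegral_defect_le (𝕜 := 𝕜) n hε
  refine ⟨κ, hκ, fun ρ hρ A => ?_⟩
  set a := restrictIoi 𝕜 ρ A
  set x := defect n ρ a
  have h1 : inner 𝕜 x a = inner 𝕜 x x := by
    have : a = x + transmutation 𝕜 n ρ ((transmutation 𝕜 n ρ).adjoint a) := by simp [x, defect]
    conv_lhs => rw [this]
    rw [inner_add_right, inner_defect hρ.le, add_zero]
  have h2 := norm_inner_le_of_measurableSet (𝕜 := 𝕜) (s := Iic (ρ * (1 + κ))) measurableSet_Iic x a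
  have h3 : √(∫ r in (Iic (ρ * (1 + κ)))ᶜ, ‖a r‖ ^ 2 ∂(volume.restrict (Ioi ρ))) =
      ‖restrictIoi 𝕜 (ρ * (1 + κ)) A‖ := by
    have hle : ρ ≤ ρ * (1 + κ) := by nlinarith
    rw [← Real.sqrt_sq (norm_nonneg (restrictIoi 𝕜 (ρ * (1 + κ)) A)), norm_sq_restrictIoi,
      Measure.restrict_restrict measurableSet_Iic.compl, compl_Iic,
      inter_eq_left.2 (Ioi_subset_Ioi hle)]
    congr 1
    refine integral_congr_ae ?_
    filter_upwards [ae_restrict_of_ae_restrict_of_subset (Ioi_subset_Ioi hle)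
      (coeFn_restrictIoi ρ A)] with r hr
    rw [hr]
  rw [h1, h3, inner_self_eq_norm_sq_to_K, norm_pow, RCLike.norm_ofReal, abs_norm, sq] at h2
  rcases (norm_nonneg x).eq_or_lt with h0 | h0
  · rw [← h0]
    positivity
  · refine le_of_mul_le_mul_left (h2.trans ?_) h0
    have := mul_le_mul_of_nonneg_right (h ρ hρ a) (norm_nonneg a)
    linarith

/-- The difference of the free profiles of `A` and `B`. -/
def radiation (m : ℕ) (ρ : ℝ) (A B : Lp 𝕜 2 (volume : Measure ℝ)) : L2Ioi 𝕜 ρ :=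
  (transmutation 𝕜 (m + 1) ρ).adjoint (restrictIoi 𝕜 ρ A) -
    (transmutation 𝕜 m ρ).adjoint (restrictIoi 𝕜 ρ B)

/-- Since ∂_r^(m+1) φ = ∂_r^m(∂_r φ), both terms of the pairing test against the same vector. The
conserved pairing is thus the action of one L² function on a dense set. -/
theorem inner_radiation (m : ℕ) {ρ : ℝ} (hρ : 0 ≤ ρ) {φ : Test 𝕜} (hφ : φ ∈ supportedOn 𝕜 ρ)
    (A B : Lp 𝕜 2 (volume : Measure ℝ)) :
    inner 𝕜 (toLp (volume.restrict (Ioi ρ)) ((D ^ (m + 1)) φ)) (radiation m ρ A B) =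
      IsRadialSolution.pairing m φ A B := by
  have h1 := inner_adjoint_transmutation (n := m + 1) hρ hφ (restrictIoi 𝕜 ρ A)
  have h2 := inner_adjoint_transmutation (n := m) hρ (isLocal_D.mem hφ) (restrictIoi 𝕜 ρ B)
  rw [inner_toLp_restrictIoi ((isLocal_xpow _).mem ((isLocal_N.pow _).mem hφ))] at h1
  rw [inner_toLp_restrictIoi ((isLocal_xpow _).mem ((isLocal_N.pow _).mem (isLocal_D.mem hφ))),
    ← Module.End.mul_apply, ← pow_succ] at h2
  rw [radiation, inner_sub_right, h1, h2, IsRadialSolution.pairing]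
  push_cast
  rfl

theorem norm_radiation_le (m : ℕ) {ρ ρ' : ℝ} (hρ : 0 ≤ ρ) (hρ' : 0 ≤ ρ')
    {A B A' B' : Lp 𝕜 2 (volume : Measure ℝ)}
    (h : ∀ φ ∈ supportedOn 𝕜 ρ, ∃ φ' ∈ supportedOn 𝕜 ρ',
      ∫ r, ‖(D ^ (m + 1)) φ' r‖ ^ 2 = ∫ r, ‖(D ^ (m + 1)) φ r‖ ^ 2 ∧
      IsRadialSolution.pairing m φ A B = IsRadialSolution.pairing m φ' A' B') :
    ‖radiation m ρ A B‖ ≤ ‖radiation m ρ' A' B'‖ := by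
  refine norm_le_of_inner_D_pow_le (n := m + 1) hρ (norm_nonneg _) fun φ hφ => ?_
  obtain ⟨φ', hφ', h1, h2⟩ := h φ hφ
  have h3 : ‖toLp (volume.restrict (Ioi ρ)) ((D ^ (m + 1)) φ)‖ =
      ‖toLp (volume.restrict (Ioi ρ')) ((D ^ (m + 1)) φ')‖ := by
    rw [← sq_eq_sq₀ (norm_nonneg _) (norm_nonneg _),
      norm_sq_toLp_restrict ((isLocal_D.pow _).mem hφ),
      norm_sq_toLp_restrict ((isLocal_D.pow _).mem hφ'), h1]
  rw [inner_radiation m hρ hφ, h2, ← inner_radiation m hρ' hφ', h3]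
  exact norm_inner_le_norm _ _

theorem norm_adjoint_transmutation_le {n : ℕ} {ρ : ℝ} (hρ : 0 ≤ ρ) (A : L2Ioi 𝕜 ρ) :
    ‖(transmutation 𝕜 n ρ).adjoint A‖ ≤ ‖A‖ := by
  have := norm_sq_defect (n := n) hρ A
  refine (sq_le_sq₀ (norm_nonneg _) (norm_nonneg _)).1 ?_
  linarith [sq_nonneg ‖defect n ρ A‖]

theorem norm_radiation_le_add (m : ℕ) {ρ : ℝ} (hρ : 0 ≤ ρ) (A B : Lp 𝕜 2 (volume : Measure ℝ)) :
    ‖radiation m ρ A B‖ ≤ ‖restrictIoi 𝕜 ρ A‖ + ‖restrictIoi 𝕜 ρ B‖ :=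
  (norm_sub_le _ _).trans (add_le_add (norm_adjoint_transmutation_le hρ _)
    (norm_adjoint_transmutation_le hρ _))

theorem norm_sq_radiation_add (m : ℕ) (ρ : ℝ) (A B : Lp 𝕜 2 (volume : Measure ℝ)) :
    ‖radiation m ρ A B‖ ^ 2 + ‖radiation m ρ A (-B)‖ ^ 2 =
      2 * (‖(transmutation 𝕜 (m + 1) ρ).adjoint (restrictIoi 𝕜 ρ A)‖ ^ 2 +
        ‖(transmutation 𝕜 m ρ).adjoint (restrictIoi 𝕜 ρ B)‖ ^ 2) := by
  have := parallelogram_law_with_norm 𝕜 ((transmutation 𝕜 (m + 1) ρ).adjoint (restrictIoi 𝕜 ρ A))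
    ((transmutation 𝕜 m ρ).adjoint (restrictIoi 𝕜 ρ B))
  rw [radiation, radiation, map_neg, map_neg, sub_neg_eq_add, add_comm]
  simpa only [sq] using this

namespace IsRadialSolution

variable {m : ℕ} {A B : ℝ → Lp 𝕜 2 (volume : Measure ℝ)}

theorem norm_radiation_eq (h : IsRadialSolution m A B) {ρ t : ℝ} (hρ : 0 < ρ) (ht : 0 ≤ t) :
    ‖radiation m (ρ + t) (A t) (B t)‖ = ‖radiation m ρ (A 0) (B 0)‖ := by
  refine le_antisymm (norm_radiation_le m (by linarith) hρ.le fun φ hφ => ?_)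
    (norm_radiation_le m hρ.le (by linarith) fun φ hφ => ?_)
  · have h1 : φ ∈ supportedOn 𝕜 (-(-t)) := supportedOn_mono (by linarith) hφ
    refine ⟨shift (-t) φ, by simpa using shift_mem h1 hφ, ?_, ?_⟩
    · rw [D_pow_shift h1, integral_norm_sq_shift ((isLocal_D.pow _).mem h1)]
    · rw [← h.pairing_shift _ ht, shift_neg_shift hρ.le hφ ht]
  · have h1 : φ ∈ supportedOn 𝕜 (-t) := supportedOn_mono (by linarith) hφ
    refine ⟨shift t φ, shift_mem h1 hφ, ?_, (h.pairing_shift φ ht).symm⟩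
    rw [D_pow_shift h1, integral_norm_sq_shift ((isLocal_D.pow _).mem h1)]

/-- Back at time 0 the incoming part at time t was located a distance t farther out, beyond ρ + 2t.
-/
theorem norm_radiation_neg_le (h : IsRadialSolution m A B) {ρ t : ℝ} (hρ : 0 < ρ) (ht : 0 ≤ t) :
    ‖radiation m (ρ + t) (A t) (-B t)‖ ≤ ‖radiation m (ρ + t + t) (A 0) (-B 0)‖ := by
  refine norm_radiation_le m (by linarith) (by linarith) fun φ hφ => ?_
  have h1 : φ ∈ supportedOn 𝕜 (-t) := supportedOn_mono (by linarith) hφ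
  refine ⟨shift t φ, shift_mem h1 hφ, ?_, (h.pairing_neg_shift φ ht).symm⟩
  rw [D_pow_shift h1, integral_norm_sq_shift ((isLocal_D.pow _).mem h1)]

theorem tendsto_norm_radiation_neg (h : IsRadialSolution m A B) {ρ : ℝ} (hρ : 0 < ρ) :
    Tendsto (fun t => ‖radiation m (ρ + t) (A t) (-B t)‖) atTop (𝓝 0) := by
  have hlim : ∀ f : Lp 𝕜 2 (volume : Measure ℝ),
      Tendsto (fun t => ‖restrictIoi 𝕜 (ρ + t + t) f‖) atTop (𝓝 0) := fun f => by
    have h1 : Tendsto (fun t => ρ + t + t) atTop atTop :=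
      (tendsto_atTop_add_const_left _ ρ tendsto_id).atTop_add_atTop tendsto_id
    have := ((tendsto_norm_sq_restrictIoi f).comp h1).sqrt
    simpa [Function.comp_def] using this
  have hadd := (hlim (A 0)).add (hlim (-B 0))
  rw [add_zero] at hadd
  refine squeeze_zero' (Eventually.of_forall fun _ => norm_nonneg _) ?_ hadd
  filter_upwards [eventually_ge_atTop 0] with t ht
  exact (h.norm_radiation_neg_le hρ ht).trans (norm_radiation_le_add m (by linarith) _ _)

/-- Used for X = A and X = B. By `norm_defect_le` it suffices to control the energy beyond (ρ + t)(1
+ κ); this lies outside the cone issued from radius ρ + κ(ρ + t), whose initial exterior energy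
tends to 0. -/
theorem tendsto_norm_defect {X : ℝ → Lp 𝕜 2 (volume : Measure ℝ)} (n : ℕ)
    (h : IsRadialSolution m A B)
    (hX : ∀ t ρ, ‖restrictIoi 𝕜 ρ (X t)‖ ^ 2 ≤
      ‖restrictIoi 𝕜 ρ (A t)‖ ^ 2 + ‖restrictIoi 𝕜 ρ (B t)‖ ^ 2)
    {ρ : ℝ} (hρ : 0 < ρ) :
    Tendsto (fun t => ‖defect n (ρ + t) (restrictIoi 𝕜 (ρ + t) (X t))‖) atTop (𝓝 0) := by
  set e : ℝ → ℝ := fun ρ => √(‖restrictIoi 𝕜 ρ (A 0)‖ ^ 2 + ‖restrictIoi 𝕜 ρ (B 0)‖ ^ 2) with he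
  have hle : ∀ ρ > 0, ∀ t ≥ 0, ‖restrictIoi 𝕜 (ρ + t) (X t)‖ ≤ e ρ := fun ρ hρ t ht =>
    Real.le_sqrt_of_sq_le ((hX t _).trans (h.exteriorEnergy_le hρ ht))
  have he0 : Tendsto e atTop (𝓝 0) := by
    simpa using ((tendsto_norm_sq_restrictIoi (A 0)).add (tendsto_norm_sq_restrictIoi (B 0))).sqrt
  rw [Metric.tendsto_nhds]
  intro δ hδ
  -- The energy bound e ρ is uniform in t, so this ε makes the first term of `norm_defect_le` at
  -- most δ/2; adding 1 covers e ρ = 0.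
  have hε : 0 < δ / 2 / (e ρ + 1) := by
    have : 0 ≤ e ρ := Real.sqrt_nonneg _
    positivity
  obtain ⟨κ, hκ, hdef⟩ := norm_defect_le (𝕜 := 𝕜) n hε
  have hlim : Tendsto (fun t => e (ρ + κ * (ρ + t))) atTop (𝓝 0) :=
    he0.comp (tendsto_atTop_add_const_left _ ρ
      ((tendsto_atTop_add_const_left _ ρ tendsto_id).const_mul_atTop hκ))
  filter_upwards [hlim.eventually (gt_mem_nhds (half_pos hδ)), eventually_ge_atTop 0] with t h1 ht
  rw [dist_zero_right, norm_norm]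
  refine (hdef (ρ + t) (by linarith) (X t)).trans_lt ?_
  have h2 : ‖restrictIoi 𝕜 ((ρ + t) * (1 + κ)) (X t)‖ ≤ e (ρ + κ * (ρ + t)) := by
    have := hle (ρ + κ * (ρ + t)) (by nlinarith [mul_pos hκ hρ, mul_nonneg hκ.le ht]) t ht
    rwa [show ρ + κ * (ρ + t) + t = (ρ + t) * (1 + κ) by ring] at this
  have h3 : δ / 2 / (e ρ + 1) * ‖restrictIoi 𝕜 (ρ + t) (X t)‖ ≤ δ / 2 := by
    have h4 : 0 ≤ e ρ := Real.sqrt_nonneg _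
    rw [div_mul_eq_mul_div, div_le_iff₀ (by linarith)]
    exact mul_le_mul_of_nonneg_left ((hle ρ hρ t ht).trans (by linarith)) (half_pos hδ).le
  linarith

/-- The limit of the exterior energy. -/
theorem tendsto_exteriorEnergy (h : IsRadialSolution m A B) {ρ : ℝ} (hρ : 0 < ρ) :
    Tendsto (fun t => ‖restrictIoi 𝕜 (ρ + t) (A t)‖ ^ 2 + ‖restrictIoi 𝕜 (ρ + t) (B t)‖ ^ 2) atTop
      (𝓝 (1 / 2 * ‖radiation m ρ (A 0) (B 0)‖ ^ 2)) := by
  have h1 := (h.tendsto_norm_defect (X := A) (m + 1)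
    (fun t ρ => le_add_of_nonneg_right (by positivity)) hρ).pow 2
  have h2 := (h.tendsto_norm_defect (X := B) m
    (fun t ρ => le_add_of_nonneg_left (by positivity)) hρ).pow 2
  have h3 := ((h.tendsto_norm_radiation_neg hρ).pow 2).const_add (‖radiation m ρ (A 0) (B 0)‖ ^ 2)
  have h4 := (h1.add h2).add (h3.const_mul (1 / 2))
  simp only [ne_eq, OfNat.ofNat_ne_zero, not_false_eq_true, zero_pow, add_zero, zero_add] at h4
  refine h4.congr' ?_
  filter_upwards [eventually_ge_atTop 0] with t ht
  -- Pythagoras for A and B, then the parallelogram law for the adjoint parts.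
  rw [norm_sq_defect (n := m + 1) (by linarith) (restrictIoi 𝕜 (ρ + t) (A t)),
    norm_sq_defect (n := m) (by linarith) (restrictIoi 𝕜 (ρ + t) (B t)),
    ← h.norm_radiation_eq hρ ht, norm_sq_radiation_add]
  ring

theorem tendsto_exteriorEnergy_atBot (h : IsRadialSolution m A B) {ρ : ℝ} (hρ : 0 < ρ) :
    Tendsto (fun t => ‖restrictIoi 𝕜 (ρ + -t) (A t)‖ ^ 2 + ‖restrictIoi 𝕜 (ρ + -t) (B t)‖ ^ 2) atBot
      (𝓝 (1 / 2 * ‖radiation m ρ (A 0) (-B 0)‖ ^ 2)) := by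
  have := ((h.reverse 0).tendsto_exteriorEnergy hρ).comp tendsto_neg_atBot_atTop
  simpa only [Function.comp_def, zero_sub, neg_neg, neg_zero, map_neg,
    norm_neg] using this

end IsRadialSolution

end

/-! ### Weak gradients and radial test functions on ℝ^d. -/

section

open Test

variable {𝕜 : Type*} [RCLike 𝕜]

section WeakGradient

variable {d : ℕ}

/-- Smooth real functions with compact support on `ℝ^d`. -/
def IsTestFunction (φ : E d → ℝ) : Prop := ContDiff ℝ ∞ φ ∧ HasCompactSupport φ

theorem IsTestFunction.partialD {φ : E d → ℝ} (hφ : IsTestFunction φ) (i : Fin d) :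
    IsTestFunction (partialD i φ) :=
  ⟨(hφ.1.fderiv_right (m := ∞) le_rfl).clm_apply contDiff_const,
    (hφ.2.fderiv (𝕜 := ℝ)).comp_left (g := fun L : E d →L[ℝ] ℝ => L (EuclideanSpace.single i 1))
      rfl⟩

theorem tendsto_integral_smul_of_eLpNorm_two {φ : E d → ℝ} (hφ : IsTestFunction φ) {g : E d → 𝕜}
    {G : ℕ → E d → 𝕜} (hg : MemLp g 2 volume) (hG : ∀ n, MemLp (G n) 2 volume)
    (h : Tendsto (fun n => eLpNorm (fun x => G n x - g x) 2 volume) atTop (𝓝 0)) :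
    Tendsto (fun n => ∫ x, φ x • G n x) atTop (𝓝 (∫ x, φ x • g x)) := by
  have hφ2 : MemLp φ 2 volume := hφ.1.continuous.memLp_of_hasCompactSupport hφ.2
  have hint : ∀ {u : E d → 𝕜}, MemLp u 2 volume → Integrable (fun x => φ x • u x) := fun hu =>
    memLp_one_iff_integrable.1 (hu.smul hφ2)
  refine tendsto_integral_of_L1' _ (hint hg).aestronglyMeasurable
    (Eventually.of_forall fun n => hint (hG n)) ?_
  have hlim := ENNReal.Tendsto.const_mul h (Or.inr hφ2.eLpNorm_ne_top)
  rw [mul_zero] at hlim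
  refine tendsto_of_tendsto_of_tendsto_of_le_of_le tendsto_const_nhds hlim
    (fun _ => zero_le) fun n => ?_
  have := eLpNorm_smul_le_mul_eLpNorm (p := 2) (q := 2) (r := 1)
    ((hG n).sub hg).aestronglyMeasurable hφ2.aestronglyMeasurable
  refine le_trans (le_of_eq ?_) this
  congr 1 with x
  simp [smul_sub]

theorem integrable_smul_of_locallyIntegrable {φ : E d → ℝ} (hφ : IsTestFunction φ) {f : E d → 𝕜}
    (hf : LocallyIntegrable f volume) : Integrable (fun x => φ x • f x) :=
  hf.integrable_smul_left_of_hasCompactSupport hφ.1.continuous hφ.2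

theorem tendsto_integral_smul_of_eLpNorm_one {φ : E d → ℝ} (hφ : IsTestFunction φ) {f : E d → 𝕜}
    {F : ℕ → E d → 𝕜} (hf : LocallyIntegrable f volume) (hF : ∀ n, Continuous (F n))
    (h : ∀ K : Set (E d), IsCompact K →
      Tendsto (fun n => eLpNorm (fun x => F n x - f x) 1 (volume.restrict K)) atTop (𝓝 0)) :
    Tendsto (fun n => ∫ x, φ x • F n x) atTop (𝓝 (∫ x, φ x • f x)) := by
  refine tendsto_integral_of_L1' _ (integrable_smul_of_locallyIntegrable hφ hf).aestronglyMeasurable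
    (Eventually.of_forall fun n =>
      integrable_smul_of_locallyIntegrable hφ (hF n).locallyIntegrable) ?_
  obtain ⟨C, hC⟩ := hφ.2.exists_bound_of_continuous hφ.1.continuous
  have hlim := ENNReal.Tendsto.const_mul (h _ hφ.2) (Or.inr (ENNReal.ofReal_ne_top (r := C)))
  rw [mul_zero] at hlim
  refine tendsto_of_tendsto_of_tendsto_of_le_of_le tendsto_const_nhds hlim
    (fun _ => zero_le) fun n => ?_
  rw [← eLpNorm_indicator_eq_eLpNorm_restrict (isClosed_tsupport φ).measurableSet]
  refine eLpNorm_le_mul_eLpNorm_of_ae_le_mul (Eventually.of_forall fun x => ?_) 1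
  by_cases hx : x ∈ tsupport φ
  · rw [indicator_of_mem hx]
    simp only [Pi.sub_apply]
    rw [← smul_sub, norm_smul]
    exact mul_le_mul_of_nonneg_right (hC x) (norm_nonneg _)
  · simp [indicator_of_notMem hx, image_eq_zero_of_notMem_tsupport hx]

/-- Integration by parts against the weak gradient. -/
theorem HasDotH1Gradient.integral_smul {f : E d → 𝕜} {G : Fin d → E d → 𝕜}
    (h : HasDotH1Gradient f G) {φ : E d → ℝ} (hφ : IsTestFunction φ) (i : Fin d) :
    ∫ x, φ x • G i x = -∫ x, partialD i φ x • f x := by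
  obtain ⟨F, hF, h1, h2⟩ := h.approx
  have hFi : ∀ n, Continuous (partialD i (F n)) := fun n =>
    ((hF n).1.continuous_fderiv (by simp)).clm_apply continuous_const
  have hFc : ∀ n, HasCompactSupport (partialD i (F n)) := fun n =>
    ((hF n).2.fderiv (𝕜 := ℝ)).comp_left (g := fun L : E d →L[ℝ] 𝕜 => L (EuclideanSpace.single i 1))
      rfl
  have e1 := tendsto_integral_smul_of_eLpNorm_two hφ (h.gradient_memLp i)
    (fun n => (hFi n).memLp_of_hasCompactSupport (hFc n)) (h2 i)
  have e2 := (tendsto_integral_smul_of_eLpNorm_one (hφ.partialD i) h.locallyIntegrable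
    (fun n => (hF n).1.continuous) h1).neg
  refine tendsto_nhds_unique e1 (e2.congr fun n => ?_)
  refine (integral_smul_fderiv_eq_neg_fderiv_smul_of_integrable (𝕜 := ℝ) ?_ ?_ ?_ ?_ ?_).symm
  · exact integrable_smul_of_locallyIntegrable (hφ.partialD i) (hF n).1.continuous.locallyIntegrable
  · exact integrable_smul_of_locallyIntegrable hφ (hFi n).locallyIntegrable
  · exact integrable_smul_of_locallyIntegrable hφ (hF n).1.continuous.locallyIntegrable
  · exact fun x _ => (hφ.1.differentiable (by simp)).differentiableAt
  · exact fun x _ => ((hF n).1.differentiable (by simp)).differentiableAt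

end WeakGradient

section RadialTestFunctions

variable {d : ℕ}

/-- Smoothness at the origin, where the norm is not differentiable, holds because κ vanishes near 0.
-/
theorem isTestFunction_radial_mul (κ : Test ℝ) {w : E d → ℝ} (hw : ContDiff ℝ ∞ w) :
    IsTestFunction fun x => κ ‖x‖ * w x := by
  obtain ⟨a, b, ha, -, hab⟩ := exists_tsupport_subset_Icc (mem_supportedOn.2 κ.tsupport_subset)
  have hz : ∀ r, r ∉ Icc a b → κ r = 0 := fun r hr => by
    by_contra h
    exact hr (hab (subset_tsupport _ h))
  refine ⟨contDiff_iff_contDiffAt.2 fun x => ?_,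
    HasCompactSupport.intro (isCompact_closedBall (0 : E d) b) fun x hx => ?_⟩
  · by_cases hx : x = 0
    · subst hx
      refine (contDiffAt_const (c := (0 : ℝ))).congr_of_eventuallyEq ?_
      filter_upwards [Metric.ball_mem_nhds (0 : E d) ha] with y hy
      rw [mem_ball_zero_iff] at hy
      rw [hz _ fun h => by linarith [h.1], zero_mul]
    · exact (κ.contDiff.contDiffAt.comp x (contDiffAt_norm ℝ hx)).mul hw.contDiffAt
  · rw [mem_closedBall_zero_iff, not_le] at hx
    rw [hz _ fun h => by linarith [h.2], zero_mul]

theorem hasFDerivAt_norm {x : E d} (hx : x ≠ 0) :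
    HasFDerivAt (fun x : E d => ‖x‖) (‖x‖⁻¹ • innerSL ℝ x) x := by
  have h := (hasStrictFDerivAt_norm_sq x).hasFDerivAt.sqrt (by simpa using hx)
  simp only [Real.sqrt_sq (norm_nonneg _)] at h
  refine h.congr_fderiv ?_
  ext v
  simp
  ring

theorem hasFDerivAt_radial (κ : Test ℝ) (x : E d) :
    HasFDerivAt (fun x : E d => κ ‖x‖) ((D κ ‖x‖ * ‖x‖⁻¹) • innerSL ℝ x) x := by
  by_cases hx : x = 0
  · subst hx
    obtain ⟨a, b, ha, -, hab⟩ := exists_tsupport_subset_Icc (mem_supportedOn.2 κ.tsupport_subset)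
    rw [norm_zero, inv_zero, mul_zero, zero_smul]
    refine (hasFDerivAt_const (0 : ℝ) (0 : E d)).congr_of_eventuallyEq ?_
    filter_upwards [Metric.ball_mem_nhds (0 : E d) ha] with y hy
    rw [mem_ball_zero_iff] at hy
    by_contra h
    linarith [(hab (subset_tsupport _ h)).1]
  · have := (κ.hasDerivAt ‖x‖).comp_hasFDerivAt x (hasFDerivAt_norm hx)
    rwa [smul_smul] at this

theorem partialD_radial (κ : Test ℝ) (i : Fin d) (x : E d) :
    partialD i (fun x : E d => κ ‖x‖) x = D κ ‖x‖ * (x i / ‖x‖) := by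
  rw [partialD, (hasFDerivAt_radial κ x).fderiv]
  simp [EuclideanSpace.inner_single_right]
  ring

theorem partialD_radial_mul (κ : Test ℝ) (i : Fin d) (x : E d) :
    partialD i (fun x : E d => κ ‖x‖ * x i) x = D κ ‖x‖ * (x i ^ 2 / ‖x‖) + κ ‖x‖ := by
  have h := (hasFDerivAt_radial κ x).mul (EuclideanSpace.proj (𝕜 := ℝ) i).hasFDerivAt
  have h' : HasFDerivAt (fun x : E d => κ ‖x‖ * x i) _ x := h
  rw [partialD, h'.fderiv]
  simp [EuclideanSpace.inner_single_right]
  ring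

theorem sum_sq_div_norm (x : E d) : ∑ i, x i ^ 2 / ‖x‖ = ‖x‖ := by
  rw [← Finset.sum_div, ← EuclideanSpace.real_norm_sq_eq, sq, mul_self_div_self]

theorem sum_sq_div_norm_sq {x : E d} (hx : x ≠ 0) : ∑ i, (x i / ‖x‖) ^ 2 = 1 := by
  simp_rw [div_pow]
  rw [← Finset.sum_div, ← EuclideanSpace.real_norm_sq_eq, div_self (by simpa using hx)]

end RadialTestFunctions

end

/-! ### Flattening radial functions: h ↦ r^m h in L²(dr). -/

section

open Test

variable {𝕜 : Type*} [RCLike 𝕜]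

namespace Test

/-- A real test function, seen as a `𝕜`-valued one. -/
def complexify (𝕜 : Type*) [RCLike 𝕜] (ζ : Test ℝ) : Test 𝕜 :=
  ofReal ζ ζ.contDiff ζ.hasCompactSupport ζ.tsupport_subset

theorem complexify_apply (ζ : Test ℝ) (r : ℝ) : complexify 𝕜 ζ r = (ζ r : 𝕜) := rfl

theorem complexify_D (ζ : Test ℝ) : complexify 𝕜 (D ζ) = D (complexify 𝕜 ζ) := by
  ext r
  have h := (RCLike.ofRealCLM (K := 𝕜)).hasFDerivAt.comp_hasDerivAt r (ζ.hasDerivAt r)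
  rw [complexify_apply, coe_D (complexify 𝕜 ζ)]
  exact h.deriv.symm

theorem complexify_xpow (k : ℤ) (ζ : Test ℝ) :
    complexify 𝕜 (xpow k ζ) = xpow k (complexify 𝕜 ζ) := by
  ext r
  rw [complexify_apply, xpow_apply, xpow_apply, complexify_apply, smul_eq_mul, RCLike.ofReal_mul,
    RCLike.real_smul_eq_coe_mul]

theorem complexify_add (ζ ξ : Test ℝ) :
    complexify 𝕜 (ζ + ξ) = complexify 𝕜 ζ + complexify 𝕜 ξ := by
  ext r
  rw [complexify_apply, add_apply, add_apply, RCLike.ofReal_add, complexify_apply, complexify_apply]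

theorem complexify_smul (c : ℝ) (ζ : Test ℝ) :
    complexify 𝕜 (c • ζ) = (c : 𝕜) • complexify 𝕜 ζ := by
  ext r
  rw [complexify_apply, smul_apply, smul_apply, RCLike.ofReal_mul, complexify_apply]

theorem exists_eq_complexify_add (ζ : Test 𝕜) :
    ∃ a b : Test ℝ, ζ = complexify 𝕜 a + (RCLike.I : 𝕜) • complexify 𝕜 b := by
  refine ⟨mk (fun r => RCLike.re (ζ r)) ((RCLike.reCLM (K := 𝕜)).contDiff.comp ζ.contDiff)
      (ζ.hasCompactSupport.comp_left (map_zero (RCLike.re (K := 𝕜))))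
      ((closure_mono (Function.support_comp_subset (map_zero (RCLike.re (K := 𝕜))) ζ)).trans
        ζ.tsupport_subset),
    mk (fun r => RCLike.im (ζ r)) ((RCLike.imCLM (K := 𝕜)).contDiff.comp ζ.contDiff)
      (ζ.hasCompactSupport.comp_left (map_zero (RCLike.im (K := 𝕜))))
      ((closure_mono (Function.support_comp_subset (map_zero (RCLike.im (K := 𝕜))) ζ)).trans
        ζ.tsupport_subset), ?_⟩
  ext r
  rw [add_apply, smul_apply, complexify_apply, complexify_apply, mul_comm]
  exact (RCLike.re_add_im (ζ r)).symm

end Test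

section Flat

variable {m : ℕ}

/-- The volume of the unit sphere of `ℝ^(2m+1)`. -/
def sphereVolume (m : ℕ) : ℝ :=
  (2 * m + 1 : ℕ) * (volume : Measure (E (2 * m + 1))).real (Metric.ball 0 1)

theorem sphereVolume_pos (m : ℕ) : 0 < sphereVolume m :=
  mul_pos (by positivity) (ENNReal.toReal_pos (Metric.measure_ball_pos _ _ one_pos).ne'
    measure_ball_lt_top.ne)

theorem integral_radial {F : Type*} [NormedAddCommGroup F] [NormedSpace ℝ F] (m : ℕ) (f : ℝ → F) :
    ∫ x : E (2 * m + 1), f ‖x‖ = sphereVolume m • ∫ r in Ioi 0, r ^ (2 * m) • f r := by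
  rw [integral_fun_norm_addHaar, finrank_euclideanSpace_fin, sphereVolume, ← Nat.cast_smul_eq_nsmul ℝ,
    smul_smul, Nat.add_sub_cancel]

theorem memLp_flat {h : ℝ → 𝕜} (hh : MemLp (radial (2 * m + 1) h) 2 volume) :
    MemLp ((Ioi 0).indicator fun r : ℝ => (r ^ m) • h r) 2 volume := by
  rw [memLp_indicator_iff_restrict measurableSet_Ioi]
  -- Measurability of the profile is recovered from that of the radial function through polar
  -- coordinates on balls, where L² functions are integrable.
  have hmeas : AEStronglyMeasurable h (volume.restrict (Ioi 0)) := by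
    have hU : Ioi (0 : ℝ) = ⋃ n : ℕ, Ioo 0 (n : ℝ) := by
      ext r
      simp only [mem_Ioi, mem_iUnion, mem_Ioo, exists_and_left, iff_self_and]
      exact fun _ => exists_nat_gt r
    rw [hU, aestronglyMeasurable_iUnion_iff]
    intro n
    have h1 : IntegrableOn (fun x : E (2 * m + 1) => h ‖x‖) (Metric.ball 0 n) volume := by
      have : IsFiniteMeasure ((volume : Measure (E (2 * m + 1))).restrict (Metric.ball 0 n)) :=
        ⟨by rw [Measure.restrict_apply_univ]; exact measure_ball_lt_top⟩
      exact (hh.restrict _).integrable one_le_two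
    rw [integrableOn_fun_norm_addHaar, finrank_euclideanSpace_fin, Nat.add_sub_cancel] at h1
    have h2 : AEStronglyMeasurable (fun r : ℝ => (r ^ (2 * m))⁻¹ • r ^ (2 * m) • h r)
        (volume.restrict (Ioo 0 (n : ℝ))) :=
      ((measurable_id.pow_const (2 * m)).inv.aestronglyMeasurable (f := fun r : ℝ => (r ^ (2 * m))⁻¹)).smul
        h1.aestronglyMeasurable
    refine h2.congr ?_
    filter_upwards [ae_restrict_mem measurableSet_Ioo] with r hr
    rw [inv_smul_smul₀ (pow_ne_zero _ hr.1.ne')]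
  have h3 : Integrable (fun x : E (2 * m + 1) => ‖h ‖x‖‖ ^ 2) volume :=
    (memLp_two_iff_integrable_sq_norm hh.aestronglyMeasurable).1 hh
  rw [integrable_fun_norm_addHaar volume (f := fun r => ‖h r‖ ^ 2), finrank_euclideanSpace_fin,
    Nat.add_sub_cancel] at h3
  have hmeas' : AEStronglyMeasurable (fun r : ℝ => r ^ m • h r) (volume.restrict (Ioi 0)) :=
    ((measurable_id.pow_const m).aestronglyMeasurable (f := fun r : ℝ => r ^ m)).smul hmeas
  rw [memLp_two_iff_integrable_sq_norm hmeas']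
  refine h3.congr_fun (fun r hr => ?_) measurableSet_Ioi
  dsimp only
  rw [norm_smul, mul_pow, norm_pow, Real.norm_eq_abs, abs_of_pos hr, smul_eq_mul, ← pow_mul,
    mul_comm m]

/-- The function `r^m h(r)` on `(0, ∞)`, as an element of `L²`. -/
def flat {h : ℝ → 𝕜} (hh : MemLp (radial (2 * m + 1) h) 2 volume) : Lp 𝕜 2 (volume : Measure ℝ) :=
  (memLp_flat hh).toLp _

theorem coeFn_flat {h : ℝ → 𝕜} (hh : MemLp (radial (2 * m + 1) h) 2 volume) :
    flat hh =ᵐ[volume] (Ioi 0).indicator fun r : ℝ => (r ^ m) • h r :=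
  (memLp_flat hh).coeFn_toLp

theorem norm_sq_flat {h : ℝ → 𝕜} (hh : MemLp (radial (2 * m + 1) h) 2 volume) :
    sphereVolume m * ‖flat hh‖ ^ 2 = (eLpNorm (radial (2 * m + 1) h) 2 volume).toReal ^ 2 := by
  rw [← Lp.norm_toLp _ hh, norm_sq_eq_integral, norm_sq_eq_integral]
  have h1 : ∫ x, ‖hh.toLp _ x‖ ^ 2 = ∫ x : E (2 * m + 1), ‖h ‖x‖‖ ^ 2 := by
    refine integral_congr_ae ?_
    filter_upwards [hh.coeFn_toLp] with x hx
    rw [hx, radial]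
  have h2 : ∫ r, ‖flat hh r‖ ^ 2 = ∫ r in Ioi 0, r ^ (2 * m) • ‖h r‖ ^ 2 := by
    rw [← integral_indicator measurableSet_Ioi]
    refine integral_congr_ae ?_
    filter_upwards [coeFn_flat hh] with r hr
    rw [hr]
    by_cases h0 : r ∈ Ioi 0
    · rw [indicator_of_mem h0, indicator_of_mem h0, norm_smul, mul_pow, norm_pow,
        Real.norm_eq_abs, abs_of_pos h0, smul_eq_mul, ← pow_mul, mul_comm m]
    · rw [indicator_of_notMem h0, indicator_of_notMem h0, norm_zero, zero_pow two_ne_zero]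
  rw [h1, h2, integral_radial m fun r => ‖h r‖ ^ 2, smul_eq_mul]

theorem flat_sub {h h' : ℝ → 𝕜} (hh : MemLp (radial (2 * m + 1) h) 2 volume)
    (hh' : MemLp (radial (2 * m + 1) h') 2 volume)
    (hs : MemLp (radial (2 * m + 1) fun r => h r - h' r) 2 volume) :
    flat hs = flat hh - flat hh' := by
  rw [flat, flat, flat, ← MemLp.toLp_sub]
  refine MemLp.toLp_congr _ _ (Eventually.of_forall fun r => ?_)
  by_cases h0 : r ∈ Ioi 0
  · rw [Pi.sub_apply, indicator_of_mem h0, indicator_of_mem h0, indicator_of_mem h0, smul_sub]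
  · rw [Pi.sub_apply, indicator_of_notMem h0, indicator_of_notMem h0, indicator_of_notMem h0,
      sub_zero]

theorem continuous_flat {h : ℝ → ℝ → 𝕜} (hh : ∀ t, MemLp (radial (2 * m + 1) (h t)) 2 volume)
    (hc : ∀ t, Tendsto (fun s => eLpNorm (radial (2 * m + 1) fun r => h s r - h t r) 2 volume) (𝓝 t)
      (𝓝 0)) : Continuous fun t => flat (hh t) := by
  refine continuous_iff_continuousAt.2 fun t => ?_
  rw [ContinuousAt, tendsto_iff_norm_sub_tendsto_zero]
  have hs : ∀ s, MemLp (radial (2 * m + 1) fun r => h s r - h t r) 2 volume := fun s =>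
    (hh s).sub (hh t)
  have h1 := (((ENNReal.continuousAt_toReal ENNReal.zero_ne_top).tendsto.comp (hc t)).pow 2).const_mul
    (sphereVolume m)⁻¹
  have h2 := h1.sqrt
  simp only [ENNReal.toReal_zero, ne_eq, OfNat.ofNat_ne_zero, not_false_eq_true, zero_pow, mul_zero,
    Real.sqrt_zero] at h2
  refine h2.congr fun s => ?_
  rw [← flat_sub (hh s) (hh t) (hs s), Function.comp_apply, ← norm_sq_flat (hs s),
    inv_mul_cancel_left₀ (sphereVolume_pos m).ne', Real.sqrt_sq (norm_nonneg _)]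

/-- The weight r^(2m) of polar coordinates is split evenly between the test function and h. -/
theorem inner_flat {h : ℝ → 𝕜} (hh : MemLp (radial (2 * m + 1) h) 2 volume) (κ : Test ℝ) :
    ∫ x : E (2 * m + 1), κ ‖x‖ • h ‖x‖ =
      sphereVolume m • inner 𝕜 (toLp volume (xpow m (complexify 𝕜 κ))) (flat hh) := by
  rw [integral_radial m fun r => κ r • h r, inner_toLp, ← integral_indicator measurableSet_Ioi]
  congr 1
  refine integral_congr_ae ?_
  filter_upwards [coeFn_flat hh] with r hr
  rw [hr]
  by_cases h0 : r ∈ Ioi 0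
  · rw [indicator_of_mem h0, indicator_of_mem h0, xpow_apply, complexify_apply, RCLike.inner_apply,
      zpow_natCast, RCLike.real_smul_eq_coe_mul, RCLike.real_smul_eq_coe_mul,
      RCLike.real_smul_eq_coe_mul, RCLike.real_smul_eq_coe_mul, map_mul, RCLike.conj_ofReal,
      RCLike.conj_ofReal, mul_comm 2 m, pow_mul, sq]
    push_cast
    ring
  · rw [indicator_of_notMem h0, indicator_of_notMem h0, inner_zero_right]

/-- Away from the origin the profile is recovered as the sum of x_i/|x| times the gradient
components, with coefficients bounded by 1. -/
theorem memLp_radial_of_radialGrad {h : ℝ → 𝕜}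
    (hh : ∀ i, MemLp (radialGrad (2 * m + 1) h i) 2 volume) :
    MemLp (radial (2 * m + 1) h) 2 volume ∧
      eLpNorm (radial (2 * m + 1) h) 2 volume ≤
        ∑ i, eLpNorm (radialGrad (2 * m + 1) h i) 2 volume := by
  have hae : radial (2 * m + 1) h =ᵐ[volume]
      ∑ i, fun x => (x i / ‖x‖) • radialGrad (2 * m + 1) h i x := by
    filter_upwards [Measure.ae_ne volume (0 : E (2 * m + 1))] with x hx
    rw [Finset.sum_apply]
    simp_rw [radialGrad, smul_smul, ← sq]
    rw [← Finset.sum_smul, sum_sq_div_norm_sq hx, one_smul, radial]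
  have hle : ∀ i (x : E (2 * m + 1)), ‖(x i / ‖x‖) • radialGrad (2 * m + 1) h i x‖ ≤
      1 * ‖radialGrad (2 * m + 1) h i x‖ := fun i x => by
    rw [norm_smul]
    refine mul_le_mul_of_nonneg_right ?_ (norm_nonneg _)
    rw [norm_div, norm_norm]
    exact div_le_one_of_le₀ (PiLp.norm_apply_le x i) (norm_nonneg _)
  have hmem : ∀ i, MemLp (fun x => (x i / ‖x‖) • radialGrad (2 * m + 1) h i x) 2 volume := fun i =>
    (hh i).of_le_mul (((EuclideanSpace.proj (𝕜 := ℝ) i).measurable.div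
      measurable_norm).aestronglyMeasurable.smul (hh i).aestronglyMeasurable)
      (Eventually.of_forall (hle i))
  refine ⟨(memLp_finsetSum' _ fun i _ => hmem i).ae_eq hae.symm, ?_⟩
  rw [eLpNorm_congr_ae hae]
  refine (eLpNorm_sum_le (fun i _ => (hmem i).aestronglyMeasurable) one_le_two).trans
    (Finset.sum_le_sum fun i _ => ?_)
  simpa using eLpNorm_le_mul_eLpNorm_of_ae_le_mul (Eventually.of_forall (hle i)) 2

end Flat

end

/-! ### From finite-energy solutions on ℝ^d to the radial system. -/

section

open Test

variable {𝕜 : Type*} [RCLike 𝕜] {m : ℕ}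

theorem isTestFunction_radial {d : ℕ} (κ : Test ℝ) : IsTestFunction fun x : E d => κ ‖x‖ := by
  simpa using isTestFunction_radial_mul κ (contDiff_const (c := (1 : ℝ)))

theorem IsTestFunction.integrable_smul {d : ℕ} {φ : E d → ℝ} (hφ : IsTestFunction φ) {g : E d → 𝕜}
    (hg : MemLp g 2 volume) : Integrable fun x => φ x • g x :=
  memLp_one_iff_integrable.1 (hg.smul (hφ.1.continuous.memLp_of_hasCompactSupport (p := 2) hφ.2))

/-- The weak radial derivative of a radial function. -/
theorem integral_radial_smul_radialGrad {h hr : ℝ → 𝕜}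
    (hh : HasDotH1Gradient (radial (2 * m + 1) h) (radialGrad (2 * m + 1) hr)) (κ : Test ℝ) :
    ∫ x : E (2 * m + 1), xpow 1 κ ‖x‖ • hr ‖x‖ =
      -∫ x : E (2 * m + 1), (xpow 1 (D κ) + ((2 * m + 1 : ℕ) : ℝ) • κ) ‖x‖ • h ‖x‖ := by
  -- The vector field κ(|x|)x is used componentwise; summing over i produces its divergence rκ' +
  -- dκ.
  have hF : ∀ i, IsTestFunction fun x : E (2 * m + 1) => κ ‖x‖ * x i := fun i =>
    isTestFunction_radial_mul κ (EuclideanSpace.proj (𝕜 := ℝ) i).contDiff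
  have h1 : ∀ i, ∫ x : E (2 * m + 1), (κ ‖x‖ * x i) • radialGrad (2 * m + 1) hr i x =
      -∫ x : E (2 * m + 1), (D κ ‖x‖ * (x i ^ 2 / ‖x‖) + κ ‖x‖) • h ‖x‖ := fun i => by
    rw [hh.integral_smul (hF i) i]
    simp_rw [partialD_radial_mul]
    rfl
  have h2 := Finset.sum_congr (s₁ := Finset.univ) rfl fun i _ => h1 i
  rw [Finset.sum_neg_distrib, ← integral_finsetSum, ← integral_finsetSum] at h2
  · refine Eq.trans ?_ (h2.trans (congrArg Neg.neg ?_))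
    · refine integral_congr_ae (Eventually.of_forall fun x => ?_)
      dsimp only
      simp_rw [radialGrad, smul_smul]
      rw [← Finset.sum_smul, xpow_apply, zpow_one, smul_eq_mul]
      congr 1
      have : ∀ i, κ ‖x‖ * x i * (x i / ‖x‖) = κ ‖x‖ * (x i ^ 2 / ‖x‖) := fun i => by ring
      simp_rw [this]
      rw [← Finset.mul_sum, sum_sq_div_norm, mul_comm]
    · refine integral_congr_ae (Eventually.of_forall fun x => ?_)
      dsimp only
      rw [← Finset.sum_smul, Finset.sum_add_distrib, ← Finset.mul_sum, sum_sq_div_norm,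
        Finset.sum_const, Finset.card_univ, Fintype.card_fin, nsmul_eq_mul, Test.add_apply, Test.smul_apply,
        xpow_apply, zpow_one, smul_eq_mul, mul_comm ‖x‖]
  · intro i _
    have := integrable_smul_of_locallyIntegrable ((hF i).partialD i) hh.locallyIntegrable
    simp_rw [partialD_radial_mul] at this
    exact this
  · exact fun i _ => (hF i).integrable_smul (hh.gradient_memLp i)

theorem integral_radial_wave {h : ℝ → 𝕜}
    (hh : ∀ i, MemLp (radialGrad (2 * m + 1) h i) 2 volume) (κ : Test ℝ) :
    ∑ i, ∫ x : E (2 * m + 1), partialD i (fun x : E (2 * m + 1) => κ ‖x‖) x •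
      radialGrad (2 * m + 1) h i x = ∫ x : E (2 * m + 1), D κ ‖x‖ • h ‖x‖ := by
  rw [← integral_finsetSum]
  · refine integral_congr_ae ?_
    filter_upwards [Measure.ae_ne volume (0 : E (2 * m + 1))] with x hx
    simp_rw [partialD_radial, radialGrad, smul_smul, mul_assoc, ← sq]
    rw [← Finset.sum_smul, ← Finset.mul_sum, sum_sq_div_norm_sq hx, mul_one]
  · exact fun i _ => ((isTestFunction_radial κ).partialD i).integrable_smul (hh i)

/-- Flattening conjugates by r^m: this turns the gradient into ∂_r - m/r, and
`xpow_mul_div_mul_xpow` turns the divergence into ∂_r + m/r. -/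
theorem xpow_mul_D_mul_xpow (m : ℕ) :
    xpow m * D * xpow (-m) = (D - (m : ℝ) • xpow (-1) : Module.End ℝ (Test ℝ)) := by
  rw [mul_assoc, D_mul_xpow, mul_add, xpow_mul_xpow_assoc, add_neg_cancel, xpow_zero, one_mul,
    mul_smul_comm, xpow_mul_xpow, show (m + (-m - 1) : ℤ) = -1 by ring, Int.cast_neg,
    Int.cast_natCast, neg_smul, sub_eq_add_neg]

theorem xpow_mul_div_mul_xpow (m : ℕ) :
    xpow m * (xpow 1 * D + ((2 * m + 1 : ℕ) : ℝ) • 1) * xpow (-1 - m) =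
      (D + (m : ℝ) • xpow (-1) : Module.End ℝ (Test ℝ)) := by
  have h1 : xpow m * xpow 1 * D * xpow (-1 - m) =
      (D - ((m + 1 : ℕ) : ℝ) • xpow (-1) : Module.End ℝ (Test ℝ)) := by
    rw [← xpow_mul_D_mul_xpow, xpow_mul_xpow]
    push_cast
    congr 2
    ring
  rw [mul_add, ← mul_assoc, add_mul, h1, mul_smul_comm, mul_one, smul_mul_assoc, xpow_mul_xpow,
    show (m + (-1 - m) : ℤ) = -1 by ring, sub_add, ← sub_smul]
  push_cast
  rw [sub_eq_add_neg, ← neg_smul]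
  congr 2
  ring

theorem eq_sphereVolume_smul_inner {h : ℝ → 𝕜} (hh : MemLp (radial (2 * m + 1) h) 2 volume)
    {κ ζ : Test ℝ} (hκ : xpow m κ = ζ) :
    inner 𝕜 (toLp volume (complexify 𝕜 ζ)) (flat hh) =
      (sphereVolume m)⁻¹ • ∫ x : E (2 * m + 1), κ ‖x‖ • h ‖x‖ := by
  rw [inner_flat hh, inv_smul_smul₀ (sphereVolume_pos m).ne', ← hκ, complexify_xpow]

/-- The weak radial derivative, in terms of `r^m h` and `r^m ∂_r h`. -/
theorem inner_flat_radialGrad {h hr : ℝ → 𝕜}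
    (hh : HasDotH1Gradient (radial (2 * m + 1) h) (radialGrad (2 * m + 1) hr))
    (hhr : MemLp (radial (2 * m + 1) hr) 2 volume) (ζ : Test ℝ) :
    inner 𝕜 (toLp volume (complexify 𝕜 ζ)) (flat hhr) =
      -(sphereVolume m)⁻¹ • ∫ x : E (2 * m + 1),
        (xpow 1 (D (xpow (-1 - m) ζ)) + ((2 * m + 1 : ℕ) : ℝ) • xpow (-1 - m) ζ) ‖x‖ • h ‖x‖ := by
  rw [eq_sphereVolume_smul_inner hhr (κ := xpow 1 (xpow (-1 - m) ζ)),
    integral_radial_smul_radialGrad hh, smul_neg, neg_smul]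
  rw [← Module.End.mul_apply, ← Module.End.mul_apply, xpow_mul_xpow, xpow_mul_xpow,
    show (m + 1 + (-1 - m) : ℤ) = 0 by ring, xpow_zero, Module.End.one_apply]

/-- The weak equations on ℝ^d are tested with real functions only; conjugate-linearity in the test
function extends them to 𝕜-valued ones. -/
theorem hasDerivAt_inner_of_complexify {F : ℝ → Lp 𝕜 2 (volume : Measure ℝ)}
    {G : Lp 𝕜 2 (volume : Measure ℝ)} {O : Module.End 𝕜 (Test 𝕜)} {t : ℝ}
    (h : ∀ ζ : Test ℝ, HasDerivAt (fun s => inner 𝕜 (toLp volume (complexify 𝕜 ζ)) (F s))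
      (-inner 𝕜 (toLp volume (O (complexify 𝕜 ζ))) G) t) (ζ : Test 𝕜) :
    HasDerivAt (fun s => inner 𝕜 (toLp volume ζ) (F s)) (-inner 𝕜 (toLp volume (O ζ)) G) t := by
  obtain ⟨a, b, rfl⟩ := exists_eq_complexify_add ζ
  have := (h a).add ((h b).const_mul (starRingEnd 𝕜 RCLike.I))
  simp only [map_add, map_smul, inner_add_left, inner_smul_left]
  refine this.congr_deriv ?_
  ring

theorem complexify_radial_op (c : ℝ) (ζ : Test ℝ) :
    complexify 𝕜 ((D + c • xpow (-1) : Module.End ℝ (Test ℝ)) ζ) =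
      (D + (c : 𝕜) • xpow (-1) : Module.End 𝕜 (Test 𝕜)) (complexify 𝕜 ζ) := by
  rw [LinearMap.add_apply, LinearMap.smul_apply, complexify_add, complexify_smul, complexify_D,
    complexify_xpow, LinearMap.add_apply, LinearMap.smul_apply]

theorem IsEnergySolution.isRadialSolution {f g : E (2 * m + 1) → 𝕜} {u ur ut : ℝ → ℝ → 𝕜}
    (hu : IsEnergySolution f g (fun t => radial (2 * m + 1) (u t))
      (fun t => radialGrad (2 * m + 1) (ur t)) (fun t => radial (2 * m + 1) (ut t)))
    (hA : ∀ t, MemLp (radial (2 * m + 1) (ur t)) 2 volume) :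
    IsRadialSolution m (fun t => flat (hA t)) (fun t => flat (hu.memLp_timeDeriv t)) where
  continuous_fst := by
    refine continuous_flat hA fun t => ?_
    have hs := tendsto_finsetSum Finset.univ fun i _ => hu.continuous_gradient t i
    rw [Finset.sum_const_zero] at hs
    have hsub : ∀ s i, (fun x => radialGrad (2 * m + 1) (ur s) i x -
        radialGrad (2 * m + 1) (ur t) i x) =
        radialGrad (2 * m + 1) (fun r => ur s r - ur t r) i := fun s i => by
      ext x
      rw [radialGrad, radialGrad, radialGrad, smul_sub]
    refine tendsto_of_tendsto_of_tendsto_of_le_of_le tendsto_const_nhds hs (fun _ => zero_le)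
      fun s => ?_
    simp only [hsub]
    refine (memLp_radial_of_radialGrad fun i => ?_).2
    rw [← hsub s i]
    exact ((hu.dotH1 s).gradient_memLp i).sub ((hu.dotH1 t).gradient_memLp i)
  continuous_snd := continuous_flat _ hu.continuous_timeDeriv
  hasDerivAt_fst ζ t := by
    refine hasDerivAt_inner_of_complexify (fun ζ => ?_) ζ
    -- The test profile obtained by moving ∂_r from u onto ζ: it is the divergence of the field with
    -- profile r^(-1-m)ζ.
    set κ : Test ℝ := xpow 1 (D (xpow (-1 - m) ζ)) + ((2 * m + 1 : ℕ) : ℝ) • xpow (-1 - m) ζ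
      with hκ
    have h1 := (hu.timeDeriv _ (isTestFunction_radial κ).1 (isTestFunction_radial κ).2 t).const_smul
      (-(sphereVolume m)⁻¹)
    have h2 : ∀ s, inner 𝕜 (toLp volume (complexify 𝕜 ζ)) (flat (hA s)) =
        -(sphereVolume m)⁻¹ • ∫ x : E (2 * m + 1), κ ‖x‖ • radial (2 * m + 1) (u s) x := fun s =>
      inner_flat_radialGrad (hu.dotH1 s) (hA s) ζ
    have hop : xpow m κ = (D + (m : ℝ) • xpow (-1) : Module.End ℝ (Test ℝ)) ζ := by
      rw [← xpow_mul_div_mul_xpow]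
      rfl
    have h3 := eq_sphereVolume_smul_inner (hu.memLp_timeDeriv t) hop
    rw [complexify_radial_op, RCLike.ofReal_natCast] at h3
    simp only [h2]
    rw [h3, ← neg_smul]
    exact h1
  hasDerivAt_snd ζ t := by
    refine hasDerivAt_inner_of_complexify (fun ζ => ?_) ζ
    set κ : Test ℝ := xpow (-m) ζ with hκ
    have h1 := (hu.wave _ (isTestFunction_radial κ).1 (isTestFunction_radial κ).2 t).const_smul
      (sphereVolume m)⁻¹
    have hζ : xpow m κ = ζ := by
      rw [hκ, ← Module.End.mul_apply, xpow_mul_xpow, add_neg_cancel, xpow_zero, Module.End.one_apply]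
    have h2 : ∀ s, inner 𝕜 (toLp volume (complexify 𝕜 ζ)) (flat (hu.memLp_timeDeriv s)) =
        (sphereVolume m)⁻¹ • ∫ x : E (2 * m + 1), κ ‖x‖ • radial (2 * m + 1) (ut s) x := fun s =>
      eq_sphereVolume_smul_inner (hu.memLp_timeDeriv s) hζ
    have hop : xpow m (D κ) = (D + (-m : ℝ) • xpow (-1) : Module.End ℝ (Test ℝ)) ζ := by
      rw [neg_smul, ← sub_eq_add_neg, ← xpow_mul_D_mul_xpow]
      rfl
    have h3 := eq_sphereVolume_smul_inner (hA t) hop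
    rw [complexify_radial_op, RCLike.ofReal_neg, RCLike.ofReal_natCast, neg_smul,
      ← sub_eq_add_neg] at h3
    simp only [h2]
    rw [h3, ← smul_neg, ← integral_radial_wave (hu.dotH1 t).gradient_memLp]
    exact h1

theorem eq_of_inner_complexify {F G : Lp 𝕜 2 (volume : Measure ℝ)} {ρ : ℝ} (hρ : 0 ≤ ρ)
    (h : ∀ ζ : Test ℝ, inner 𝕜 (toLp volume (complexify 𝕜 ζ)) F =
      inner 𝕜 (toLp volume (complexify 𝕜 ζ)) G) : restrictIoi 𝕜 ρ F = restrictIoi 𝕜 ρ G := by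
  rw [← sub_eq_zero, ← norm_le_zero_iff]
  refine norm_le_of_inner_D_pow_le (n := 0) hρ le_rfl fun φ hφ => ?_
  rw [pow_zero, Module.End.one_apply, inner_sub_right, inner_toLp_restrictIoi hφ,
    inner_toLp_restrictIoi hφ]
  obtain ⟨a, b, rfl⟩ := exists_eq_complexify_add φ
  simp only [map_add, map_smul, inner_add_left, inner_smul_left, h, sub_self, norm_zero]
  positivity

/-- The initial condition identifies only u(0) and f almost everywhere. Their radial derivatives
agree because both are the weak derivative of the same function. -/
theorem restrictIoi_flat_eq_of_ae_eq {h h' hr hr' : ℝ → 𝕜}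
    (hh : HasDotH1Gradient (radial (2 * m + 1) h) (radialGrad (2 * m + 1) hr))
    (hh' : HasDotH1Gradient (radial (2 * m + 1) h') (radialGrad (2 * m + 1) hr'))
    (hhr : MemLp (radial (2 * m + 1) hr) 2 volume) (hhr' : MemLp (radial (2 * m + 1) hr') 2 volume)
    (heq : radial (2 * m + 1) h =ᵐ[volume] radial (2 * m + 1) h') {ρ : ℝ} (hρ : 0 ≤ ρ) :
    restrictIoi 𝕜 ρ (flat hhr) = restrictIoi 𝕜 ρ (flat hhr') := by
  refine eq_of_inner_complexify hρ fun ζ => ?_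
  rw [inner_flat_radialGrad hh, inner_flat_radialGrad hh']
  congr 1
  refine integral_congr_ae ?_
  filter_upwards [heq] with x hx
  have hx : h ‖x‖ = h' ‖x‖ := hx
  rw [hx]

theorem flat_eq_of_ae_eq {h h' : ℝ → 𝕜} (hh : MemLp (radial (2 * m + 1) h) 2 volume)
    (hh' : MemLp (radial (2 * m + 1) h') 2 volume)
    (heq : radial (2 * m + 1) h =ᵐ[volume] radial (2 * m + 1) h') : flat hh = flat hh' := by
  have hs : MemLp (radial (2 * m + 1) fun r => h r - h' r) 2 volume := hh.sub hh'
  have h0 : radial (2 * m + 1) (fun r => h r - h' r) =ᵐ[volume] 0 := by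
    filter_upwards [heq] with x hx
    exact sub_eq_zero.2 hx
  have := norm_sq_flat hs
  rw [eLpNorm_congr_ae h0, eLpNorm_zero, ENNReal.toReal_zero, zero_pow two_ne_zero, mul_eq_zero,
    or_iff_right (sphereVolume_pos m).ne', sq_eq_zero_iff, norm_eq_zero, flat_sub hh hh',
    sub_eq_zero] at this
  exact this

end

/-! ### The exterior energy space, P(R), and the projection in flattened form. -/

section

open Test

variable {𝕜 : Type*} [RCLike 𝕜] {m : ℕ} {R : ℝ}

theorem extMeasure_eq (m : ℕ) (R : ℝ) : extMeasure (2 * m + 1) R =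
    (volume.restrict (Ioi R)).withDensity fun r => ENNReal.ofReal (r ^ (2 * m)) := by
  rw [extMeasure, Measure.restrict_congr_set Ioi_ae_eq_Ici.symm, Nat.add_sub_cancel]

theorem ae_extMeasure_iff (hR : 0 < R) {p : ℝ → Prop} :
    (∀ᵐ r ∂extMeasure (2 * m + 1) R, p r) ↔ ∀ᵐ r ∂volume.restrict (Ioi R), p r := by
  rw [extMeasure_eq, ae_withDensity_iff (by fun_prop)]
  refine eventually_congr ?_
  filter_upwards [ae_restrict_mem measurableSet_Ioi] with r hr
  have : ENNReal.ofReal (r ^ (2 * m)) ≠ 0 :=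
    (ENNReal.ofReal_pos.2 (pow_pos (hR.trans hr) _)).ne'
  simp [this]

theorem integral_extMeasure {F : Type*} [NormedAddCommGroup F] [NormedSpace ℝ F] (hR : 0 < R)
    (f : ℝ → F) :
    ∫ r, f r ∂extMeasure (2 * m + 1) R = ∫ r in Ioi R, r ^ (2 * m) • f r := by
  rw [extMeasure_eq, integral_withDensity_eq_integral_toReal_smul (by fun_prop) (by simp)]
  refine setIntegral_congr_fun measurableSet_Ioi fun r hr => ?_
  rw [ENNReal.toReal_ofReal (pow_nonneg (hR.trans hr).le _)]

theorem memLp_extMeasure (hR : 0 < R) {h F : ℝ → 𝕜} (hF : MemLp F 2 (volume.restrict (Ioi R)))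
    (hFh : F =ᵐ[volume.restrict (Ioi R)] fun r => r ^ m • h r) :
    MemLp h 2 (extMeasure (2 * m + 1) R) := by
  have hmeas : AEStronglyMeasurable (fun r : ℝ => (r ^ m)⁻¹ • F r) (volume.restrict (Ioi R)) :=
    ((measurable_id.pow_const m).inv.aestronglyMeasurable (f := fun r : ℝ => (r ^ m)⁻¹)).smul
      hF.aestronglyMeasurable
  have hmeas' : AEStronglyMeasurable h (volume.restrict (Ioi R)) := by
    refine hmeas.congr ?_
    filter_upwards [hFh, ae_restrict_mem measurableSet_Ioi] with r h1 hr
    rw [h1, inv_smul_smul₀ (pow_pos (hR.trans hr) _).ne']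
  have hmeas'' : AEStronglyMeasurable h (extMeasure (2 * m + 1) R) := by
    rw [extMeasure_eq]
    exact hmeas'.mono_ac (withDensity_absolutelyContinuous _ _)
  rw [memLp_two_iff_integrable_sq_norm hmeas'', extMeasure_eq,
    integrable_withDensity_iff (by fun_prop) (by simp)]
  refine ((memLp_two_iff_integrable_sq_norm hF.aestronglyMeasurable).1 hF).congr ?_
  filter_upwards [hFh, ae_restrict_mem measurableSet_Ioi] with r h1 hr
  have hr0 : 0 < r := hR.trans hr
  rw [h1, norm_smul, mul_pow, norm_pow, Real.norm_eq_abs, abs_of_pos hr0,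
    ENNReal.toReal_ofReal (by positivity), ← pow_mul, mul_comm m, mul_comm]

theorem memLp_inv_smul (hR : 0 < R) (x : L2Ioi 𝕜 R) :
    MemLp (fun r => (r ^ m)⁻¹ • x r) 2 (extMeasure (2 * m + 1) R) := by
  refine memLp_extMeasure hR (Lp.memLp x) ?_
  filter_upwards [ae_restrict_mem measurableSet_Ioi] with r hr
  rw [smul_inv_smul₀ (pow_pos (hR.trans hr) _).ne']

theorem inner_extMeasure (hR : 0 < R) {X Y : Lp 𝕜 2 (extMeasure (2 * m + 1) R)} {x y : L2Ioi 𝕜 R}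
    (hX : X =ᵐ[extMeasure (2 * m + 1) R] fun r => (r ^ m)⁻¹ • x r)
    (hY : Y =ᵐ[extMeasure (2 * m + 1) R] fun r => (r ^ m)⁻¹ • y r) :
    inner 𝕜 X Y = inner 𝕜 x y := by
  rw [L2.inner_def, L2.inner_def, integral_extMeasure hR]
  refine integral_congr_ae ?_
  filter_upwards [(ae_extMeasure_iff hR).1 hX, (ae_extMeasure_iff hR).1 hY,
    ae_restrict_mem measurableSet_Ioi] with r h1 h2 hr
  have hr0 : (r : 𝕜) ≠ 0 := RCLike.ofReal_ne_zero.2 (hR.trans hr).ne'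
  rw [h1, h2]
  simp only [RCLike.real_smul_eq_coe_mul, RCLike.inner_apply, map_mul, RCLike.conj_ofReal]
  push_cast
  field_simp
  ring

/-- The isometry `x ↦ r^{-m} x` from `L²(R, ∞)` to `L²(r ≥ R; r^{2m} dr)`. -/
def ofFlat (𝕜 : Type*) [RCLike 𝕜] (m : ℕ) (hR : 0 < R) :
    L2Ioi 𝕜 R →ₗᵢ[𝕜] Lp 𝕜 2 (extMeasure (2 * m + 1) R) :=
  LinearMap.isometryOfInner
    { toFun := fun x => (memLp_inv_smul hR x).toLp _
      map_add' := fun x y => by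
        rw [← MemLp.toLp_add]
        refine MemLp.toLp_congr _ _ ((ae_extMeasure_iff hR).2 ?_)
        filter_upwards [Lp.coeFn_add x y] with r hr
        rw [hr, Pi.add_apply, Pi.add_apply, smul_add]
      map_smul' := fun c x => by
        rw [RingHom.id_apply, ← MemLp.toLp_const_smul]
        refine MemLp.toLp_congr _ _ ((ae_extMeasure_iff hR).2 ?_)
        filter_upwards [Lp.coeFn_smul c x] with r hr
        rw [hr, Pi.smul_apply, Pi.smul_apply, smul_comm] }
    fun x y => inner_extMeasure hR (memLp_inv_smul hR x).coeFn_toLp (memLp_inv_smul hR y).coeFn_toLp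

theorem coeFn_ofFlat (hR : 0 < R) (x : L2Ioi 𝕜 R) :
    ofFlat 𝕜 m hR x =ᵐ[extMeasure (2 * m + 1) R] fun r => (r ^ m)⁻¹ • x r :=
  (memLp_inv_smul hR x).coeFn_toLp

theorem toLp_eq_ofFlat (hR : 0 < R) {h : ℝ → 𝕜} (hh : MemLp h 2 (extMeasure (2 * m + 1) R))
    {x : L2Ioi 𝕜 R} (hx : x =ᵐ[volume.restrict (Ioi R)] fun r => r ^ m • h r) :
    hh.toLp h = ofFlat 𝕜 m hR x := by
  refine Lp.ext (hh.coeFn_toLp.trans (EventuallyEq.trans ?_ (coeFn_ofFlat hR x).symm))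
  refine (ae_extMeasure_iff hR).2 ?_
  filter_upwards [hx, ae_restrict_mem measurableSet_Ioi] with r h1 hr
  rw [h1, inv_smul_smul₀ (pow_pos (hR.trans hr) _).ne']

/-- The element of the energy space with the flattened components `x` and `y`. -/
def extOfFlat (m : ℕ) (hR : 0 < R) (x y : L2Ioi 𝕜 R) : ExtSpace 𝕜 (2 * m + 1) R :=
  WithLp.toLp 2 (ofFlat 𝕜 m hR x, ofFlat 𝕜 m hR y)

theorem toExt_eq_extOfFlat (hR : 0 < R) {h k : ℝ → 𝕜} (hh : MemLp h 2 (extMeasure (2 * m + 1) R))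
    (hk : MemLp k 2 (extMeasure (2 * m + 1) R)) {x y : L2Ioi 𝕜 R}
    (hx : x =ᵐ[volume.restrict (Ioi R)] fun r => r ^ m • h r)
    (hy : y =ᵐ[volume.restrict (Ioi R)] fun r => r ^ m • k r) :
    toExt hh hk = extOfFlat m hR x y := by
  rw [toExt, toLp_eq_ofFlat hR hh hx, toLp_eq_ofFlat hR hk hy, extOfFlat]

theorem inner_extOfFlat (hR : 0 < R) (x y x' y' : L2Ioi 𝕜 R) :
    inner 𝕜 (extOfFlat m hR x y) (extOfFlat m hR x' y') = inner 𝕜 x x' + inner 𝕜 y y' := by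
  rw [WithLp.prod_inner_apply]
  exact congrArg₂ (· + ·) ((ofFlat 𝕜 m hR).inner_map_map x x') ((ofFlat 𝕜 m hR).inner_map_map y y')

theorem norm_sq_extOfFlat (hR : 0 < R) (x y : L2Ioi 𝕜 R) :
    ‖extOfFlat m hR x y‖ ^ 2 = ‖x‖ ^ 2 + ‖y‖ ^ 2 := by
  rw [WithLp.prod_norm_sq_eq_of_L2, ← (ofFlat 𝕜 m hR).norm_map x, ← (ofFlat 𝕜 m hR).norm_map y]
  rfl

/-- After multiplication by r^m, the derivative of r^(2k-d) has exponent 2k - 2 - m = 2j + 1 - (m+1)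
with j = k - 1, the form in which powers appear in the defect for n = m+1. -/
theorem toExt_deriv_powFun (hd : Odd (2 * m + 1)) (hR : 0 < R) {k : ℕ}
    (hk : k ∈ Icc 1 ((2 * m + 1 + 2) / 4)) :
    toExt (memLp_deriv_powFun 𝕜 hd hR hk) (memLp_null 𝕜 (2 * m + 1) R) =
      extOfFlat m hR (((2 * k - (2 * m + 1 : ℕ) : ℤ) : 𝕜) • powLp 𝕜 R (2 * k - 2 - m)) 0 := by
  refine toExt_eq_extOfFlat hR _ _ ?_ ?_
  · have hk' := hk.2
    filter_upwards [Lp.coeFn_smul ((2 * k - (2 * m + 1 : ℕ) : ℤ) : 𝕜) (powLp 𝕜 R (2 * k - 2 - m)),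
      coeFn_powLp (𝕜 := 𝕜) hR (k := 2 * k - 2 - m) (by omega), ae_restrict_mem measurableSet_Ioi]
      with r h1 h2 hr
    have hr0 : r ≠ 0 := (hR.trans hr).ne'
    have : deriv (powFun (2 * m + 1) k) r =
        ((2 * (k : ℤ) - (2 * m + 1 : ℕ) : ℤ) : ℝ) * r ^ (2 * (k : ℤ) - (2 * m + 1 : ℕ) - 1) :=
      deriv_zpow _ _
    rw [h1, Pi.smul_apply, h2, this, RCLike.real_smul_eq_coe_mul, smul_eq_mul, ← RCLike.ofReal_mul,
      mul_left_comm, ← zpow_natCast r m, ← zpow_add₀ hr0, RCLike.ofReal_mul, RCLike.ofReal_intCast]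
    congr 3
    push_cast
    ring
  · filter_upwards [Lp.coeFn_zero 𝕜 2 (volume.restrict (Ioi R))] with r hr
    rw [hr, smul_zero]
    rfl

theorem toExt_powFun (hd : Odd (2 * m + 1)) (hR : 0 < R) {k : ℕ} (hk : k ∈ Icc 1 ((2 * m + 1) / 4)) :
    toExt (memLp_null 𝕜 (2 * m + 1) R) (memLp_powFun 𝕜 hd hR hk) =
      extOfFlat m hR 0 (powLp 𝕜 R (2 * k - 1 - m)) := by
  refine toExt_eq_extOfFlat hR _ _ ?_ ?_
  · filter_upwards [Lp.coeFn_zero 𝕜 2 (volume.restrict (Ioi R))] with r hr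
    rw [hr, smul_zero]
    rfl
  · have hk' := hk.2
    filter_upwards [coeFn_powLp (𝕜 := 𝕜) hR (k := 2 * k - 1 - m) (by omega),
      ae_restrict_mem measurableSet_Ioi] with r h2 hr
    have hr0 : r ≠ 0 := (hR.trans hr).ne'
    rw [h2, powFun, RCLike.real_smul_eq_coe_mul, ← RCLike.ofReal_mul, ← zpow_natCast r m,
      ← zpow_add₀ hr0]
    congr 2
    push_cast
    ring

/-- The surviving exponents 2j + 1 - n are negative, and with k = j + 1 this is exactly k ≤ (d+2)/4
for n = m+1 and k ≤ d/4 for n = m. -/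
theorem extOfFlat_defect_mem (hd : Odd (2 * m + 1)) (hR : 0 < R) (a b : L2Ioi 𝕜 R) :
    extOfFlat m hR (defect (m + 1) R a) (defect m R b) ∈ P 𝕜 hd hR := by
  let ι₁ : L2Ioi 𝕜 R →ₗ[𝕜] ExtSpace 𝕜 (2 * m + 1) R :=
    { toFun := fun x => extOfFlat m hR x 0
      map_add' := fun x y => by simp [extOfFlat, ← WithLp.toLp_add]
      map_smul' := fun c x => by simp [extOfFlat, ← WithLp.toLp_smul] }
  let ι₂ : L2Ioi 𝕜 R →ₗ[𝕜] ExtSpace 𝕜 (2 * m + 1) R :=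
    { toFun := fun x => extOfFlat m hR 0 x
      map_add' := fun x y => by simp [extOfFlat, ← WithLp.toLp_add]
      map_smul' := fun c x => by simp [extOfFlat, ← WithLp.toLp_smul] }
  have hsum : extOfFlat m hR (defect (m + 1) R a) (defect m R b) =
      ι₁ (defect (m + 1) R a) + ι₂ (defect m R b) := by
    simp [ι₁, ι₂, extOfFlat, ← WithLp.toLp_add]
  rw [hsum]
  obtain ⟨α, hα, ha⟩ := exists_defect_eq_sum (m + 1) hR a
  obtain ⟨β, hβ, hb⟩ := exists_defect_eq_sum m hR b
  rw [ha, hb, map_sum, map_sum]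
  refine add_mem (Submodule.sum_mem _ fun j hj => ?_) (Submodule.sum_mem _ fun j hj => ?_)
  · rw [map_smul]
    by_cases h : m + 1 ≤ 2 * j + 1
    · rw [hα j (Finset.mem_range.1 hj) h, zero_smul]
      exact zero_mem _
    · have hk : j + 1 ∈ Icc 1 ((2 * m + 1 + 2) / 4) := ⟨by omega, by omega⟩
      -- The factor 2k - d from differentiation is nonzero because d is odd.
      have hc : ((2 * (j + 1 : ℕ) - (2 * m + 1 : ℕ) : ℤ) : 𝕜) ≠ 0 := Int.cast_ne_zero.2 (by omega)
      have hmem : extOfFlat m hR (((2 * (j + 1 : ℕ) - (2 * m + 1 : ℕ) : ℤ) : 𝕜) •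
          powLp 𝕜 R (2 * (j + 1 : ℕ) - 2 - m)) 0 ∈ P 𝕜 hd hR := by
        rw [← toExt_deriv_powFun hd hR hk]
        exact Submodule.subset_span (Or.inl ⟨⟨j + 1, hk⟩, rfl⟩)
      refine Submodule.smul_mem _ _ ((Submodule.smul_mem_iff _ hc).1 ?_)
      rw [← map_smul]
      rw [show (2 * (j + 1 : ℕ) - 2 - m : ℤ) = 2 * j + 1 - (m + 1 : ℕ) by push_cast; ring] at hmem
      exact hmem
  · rw [map_smul]
    by_cases h : m ≤ 2 * j + 1
    · rw [hβ j (Finset.mem_range.1 hj) h, zero_smul]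
      exact zero_mem _
    · have hk : j + 1 ∈ Icc 1 ((2 * m + 1) / 4) := ⟨by omega, by omega⟩
      have hmem : extOfFlat m hR 0 (powLp 𝕜 R (2 * (j + 1 : ℕ) - 1 - m)) ∈ P 𝕜 hd hR := by
        rw [← toExt_powFun hd hR hk]
        exact Submodule.subset_span (Or.inr ⟨⟨j + 1, hk⟩, rfl⟩)
      refine Submodule.smul_mem _ _ ?_
      rw [show (2 * (j + 1 : ℕ) - 1 - m : ℤ) = 2 * j + 1 - m by push_cast; ring] at hmem
      exact hmem

theorem extOfFlat_transmutation_mem (hd : Odd (2 * m + 1)) (hR : 0 < R) (a b : L2Ioi 𝕜 R) :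
    extOfFlat m hR (transmutation 𝕜 (m + 1) R a) (transmutation 𝕜 m R b) ∈ (P 𝕜 hd hR)ᗮ := by
  rw [P, Submodule.mem_orthogonal]
  intro w hw
  induction hw using Submodule.span_induction with
  | mem w hw =>
    rcases hw with ⟨⟨k, hk⟩, rfl⟩ | ⟨⟨k, hk⟩, rfl⟩
    · have hk1 := hk.1
      have hk2 := hk.2
      dsimp only
      rw [toExt_deriv_powFun hd hR hk, inner_extOfFlat, inner_zero_left, add_zero, inner_smul_left,
        inner_xpow_transmutation (j := k - 1) hR.le (by omega), mul_zero]
      simp only [show (2 * (k - 1 : ℕ) + 1 - (m + 1 : ℕ) : ℤ) = 2 * k - 2 - m by omega]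
      exact coeFn_powLp hR (by omega)
    · have hk1 := hk.1
      have hk2 := hk.2
      dsimp only
      rw [toExt_powFun hd hR hk, inner_extOfFlat, inner_zero_left, zero_add,
        inner_xpow_transmutation (j := k - 1) hR.le (by omega)]
      simp only [show (2 * (k - 1 : ℕ) + 1 - m : ℤ) = 2 * k - 1 - m by omega]
      exact coeFn_powLp hR (by omega)
  | zero => rw [inner_zero_left]
  | add w w' _ _ h h' => rw [inner_add_left, h, h', add_zero]
  | smul c w _ h => rw [inner_smul_left, h, mul_zero]

/-- Each component splits as T T^* of itself plus its defect. The first parts lie in P(R)^⊥ and the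
defects in P(R), so the projection is T T^* componentwise, and T preserves norms. -/
theorem norm_sq_projPerp (hd : Odd (2 * m + 1)) (hR : 0 < R) (a b : L2Ioi 𝕜 R) :
    ‖projPerp 𝕜 hd hR (extOfFlat m hR a b)‖ ^ 2 =
      ‖(transmutation 𝕜 (m + 1) R).adjoint a‖ ^ 2 + ‖(transmutation 𝕜 m R).adjoint b‖ ^ 2 := by
  have h : projPerp 𝕜 hd hR (extOfFlat m hR a b) = extOfFlat m hR
      (transmutation 𝕜 (m + 1) R ((transmutation 𝕜 (m + 1) R).adjoint a))
      (transmutation 𝕜 m R ((transmutation 𝕜 m R).adjoint b)) := by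
    refine Submodule.eq_starProjection_of_mem_orthogonal'
      (extOfFlat_transmutation_mem hd hR _ _)
      (Submodule.le_orthogonal_orthogonal _ (extOfFlat_defect_mem hd hR a b)) ?_
    simp [extOfFlat, defect, ← WithLp.toLp_add]
  rw [h, norm_sq_extOfFlat, norm_transmutation hR.le, norm_transmutation hR.le]

theorem projPerp_eq_zero_iff (hd : Odd (2 * m + 1)) (hR : 0 < R) (X : ExtSpace 𝕜 (2 * m + 1) R) :
    projPerp 𝕜 hd hR X = 0 ↔ X ∈ P 𝕜 hd hR := by
  rw [projPerp, Submodule.starProjection_apply_eq_zero_iff, Submodule.orthogonal_orthogonal]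

section Energy

theorem setIntegral_flat {ρ : ℝ} (hρ : 0 < ρ) {h : ℝ → 𝕜}
    (hh : MemLp (radial (2 * m + 1) h) 2 volume) :
    IntegrableOn (fun r => ‖h r‖ ^ 2 * r ^ (2 * m)) (Ioi ρ) ∧
      ∫ r in Ioi ρ, ‖h r‖ ^ 2 * r ^ (2 * m) = ‖restrictIoi 𝕜 ρ (flat hh)‖ ^ 2 := by
  have hae : (fun r => ‖flat hh r‖ ^ 2) =ᵐ[volume.restrict (Ioi ρ)]
      fun r => ‖h r‖ ^ 2 * r ^ (2 * m) := by
    filter_upwards [ae_restrict_of_ae (coeFn_flat hh), ae_restrict_mem measurableSet_Ioi]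
      with r h1 hr
    have hr0 : 0 < r := hρ.trans hr
    rw [h1, indicator_of_mem (mem_Ioi.2 hr0), norm_smul, mul_pow, norm_pow, Real.norm_eq_abs, abs_of_pos hr0,
      ← pow_mul, mul_comm m, mul_comm]
  refine ⟨(integrable_norm_sq (flat hh)).integrableOn.congr_fun_ae hae, ?_⟩
  rw [norm_sq_restrictIoi, integral_congr_ae hae]

theorem coeFn_restrictIoi_flat (hR : 0 < R) {h : ℝ → 𝕜}
    (hh : MemLp (radial (2 * m + 1) h) 2 volume) :
    restrictIoi 𝕜 R (flat hh) =ᵐ[volume.restrict (Ioi R)] fun r => r ^ m • h r := by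
  filter_upwards [coeFn_restrictIoi R (flat hh), ae_restrict_of_ae (coeFn_flat hh),
    ae_restrict_mem measurableSet_Ioi] with r h1 h2 hr
  rw [h1, h2, indicator_of_mem (mem_Ioi.2 (hR.trans hr))]

theorem energyDensity_integrable {ur ut : ℝ → ℝ → 𝕜} {t ρ : ℝ} (hρ : 0 < ρ)
    (hA : MemLp (radial (2 * m + 1) (ur t)) 2 volume)
    (hB : MemLp (radial (2 * m + 1) (ut t)) 2 volume) :
    IntegrableOn (energyDensity (2 * m + 1) ur ut t) (Ici ρ) volume ∧
      ∫ r in Ici ρ, energyDensity (2 * m + 1) ur ut t r =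
        ‖restrictIoi 𝕜 ρ (flat hA)‖ ^ 2 + ‖restrictIoi 𝕜 ρ (flat hB)‖ ^ 2 := by
  have he : energyDensity (2 * m + 1) ur ut t =
      fun r => ‖ur t r‖ ^ 2 * r ^ (2 * m) + ‖ut t r‖ ^ 2 * r ^ (2 * m) := by
    ext r
    rw [energyDensity, add_mul, Nat.add_sub_cancel]
  rw [integrableOn_Ici_iff_integrableOn_Ioi, integral_Ici_eq_integral_Ioi, he]
  exact ⟨(setIntegral_flat hρ hA).1.add (setIntegral_flat hρ hB).1, by
    rw [integral_add (setIntegral_flat hρ hA).1 (setIntegral_flat hρ hB).1,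
      (setIntegral_flat hρ hA).2, (setIntegral_flat hρ hB).2]⟩

end Energy

/-- The identity behind the sharp constant: the two limits of the exterior energy add up to the
norm of the projection. -/
theorem add_norm_sq_radiation (hd : Odd (2 * m + 1)) (hR : 0 < R)
    (A B : Lp 𝕜 2 (volume : Measure ℝ)) :
    1 / 2 * ‖radiation m R A B‖ ^ 2 + 1 / 2 * ‖radiation m R A (-B)‖ ^ 2 =
      ‖projPerp 𝕜 hd hR (extOfFlat m hR (restrictIoi 𝕜 R A) (restrictIoi 𝕜 R B))‖ ^ 2 := by
  rw [norm_sq_projPerp, ← mul_add, norm_sq_radiation_add]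
  ring

/-- If one component vanishes on r > R, changing the sign of B alters the radiation at most by a
sign. This is the source of the equality case. -/
theorem norm_radiation_neg_eq {A B : Lp 𝕜 2 (volume : Measure ℝ)}
    (h : restrictIoi 𝕜 R A = 0 ∨ restrictIoi 𝕜 R B = 0) :
    ‖radiation m R A (-B)‖ = ‖radiation m R A B‖ := by
  rw [radiation, radiation, map_neg, map_neg]
  rcases h with h | h <;> simp [h]

theorem restrictIoi_flat_eq_zero (hR : 0 < R) {hr : ℝ → 𝕜}
    (hh : HasDotH1Gradient (radial (2 * m + 1) (0 : ℝ → 𝕜)) (radialGrad (2 * m + 1) hr))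
    (hhr : MemLp (radial (2 * m + 1) hr) 2 volume) : restrictIoi 𝕜 R (flat hhr) = 0 := by
  rw [← map_zero (restrictIoi 𝕜 R)]
  refine eq_of_inner_complexify hR.le fun ζ => ?_
  rw [inner_flat_radialGrad hh]
  simp

end

end RadialWave

end

/-! ### The main theorem. -/

theorem theorem1 {𝕜 : Type*} [RCLike 𝕜] {d : ℕ} (hd : Odd d) {R : ℝ} (hR : 0 < R)
    -- radial data `(f, g)` in `Ḣ¹ × L²(ℝ^d)`; `fr` is the radial derivative of `f`
    (f fr g : ℝ → 𝕜)
    (hf : RadialWave.HasDotH1Gradient (RadialWave.radial d f) (RadialWave.radialGrad d fr))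
    (hg : MemLp (RadialWave.radial d g) 2 volume)
    -- a radial energy solution `u(t, r)` with these data; `ur = ∂_r u` and `ut = ∂_t u`
    (u ur ut : ℝ → ℝ → 𝕜)
    (hu : RadialWave.IsEnergySolution (RadialWave.radial d f) (RadialWave.radial d g)
      (fun t => RadialWave.radial d (u t)) (fun t => RadialWave.radialGrad d (ur t))
      (fun t => RadialWave.radial d (ut t))) :
    (∀ t : ℝ, IntegrableOn (RadialWave.energyDensity d ur ut t) (Set.Ici (|t| + R)) volume) ∧
    ∃ (hfr : MemLp fr 2 (RadialWave.extMeasure d R)) (hgr : MemLp g 2 (RadialWave.extMeasure d R))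
      (Lplus Lminus : ℝ),
      Tendsto (RadialWave.extEnergy d R ur ut) atTop (𝓝 Lplus) ∧
      Tendsto (RadialWave.extEnergy d R ur ut) atBot (𝓝 Lminus) ∧
      1 / 2 * ‖RadialWave.projPerp 𝕜 hd hR (RadialWave.toExt hfr hgr)‖ ^ 2 ≤ max Lplus Lminus ∧
      ((f = 0 ∨ g = 0) →
        max Lplus Lminus =
          1 / 2 * ‖RadialWave.projPerp 𝕜 hd hR (RadialWave.toExt hfr hgr)‖ ^ 2) ∧
      (max Lplus Lminus = 0 ↔ RadialWave.toExt hfr hgr ∈ RadialWave.P 𝕜 hd hR) := by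
  open RadialWave in
  obtain ⟨m, rfl⟩ := id hd
  have hA : ∀ t, MemLp (radial (2 * m + 1) (ur t)) 2 volume := fun t =>
    (memLp_radial_of_radialGrad (hu.dotH1 t).gradient_memLp).1
  have hfr' : MemLp (radial (2 * m + 1) fr) 2 volume :=
    (memLp_radial_of_radialGrad hf.gradient_memLp).1
  have hρ : ∀ t : ℝ, 0 < |t| + R := fun t => by positivity
  have hsol := hu.isRadialSolution hA
  have hA0 : restrictIoi 𝕜 R (flat (hA 0)) = restrictIoi 𝕜 R (flat hfr') :=
    restrictIoi_flat_eq_of_ae_eq (hu.dotH1 0) hf (hA 0) hfr' hu.initial_position hR.le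
  have hB0 : flat (hu.memLp_timeDeriv 0) = flat hg := flat_eq_of_ae_eq _ hg hu.initial_velocity
  have hE : ∀ t, extEnergy (2 * m + 1) R ur ut t =
      ‖restrictIoi 𝕜 (|t| + R) (flat (hA t))‖ ^ 2 +
        ‖restrictIoi 𝕜 (|t| + R) (flat (hu.memLp_timeDeriv t))‖ ^ 2 := fun t =>
    (energyDensity_integrable (hρ t) (hA t) (hu.memLp_timeDeriv t)).2
  refine ⟨fun t => (energyDensity_integrable (hρ t) (hA t) (hu.memLp_timeDeriv t)).1,
    memLp_extMeasure hR (Lp.memLp _) (coeFn_restrictIoi_flat hR hfr'),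
    memLp_extMeasure hR (Lp.memLp _) (coeFn_restrictIoi_flat hR hg),
    1 / 2 * ‖radiation m R (flat (hA 0)) (flat (hu.memLp_timeDeriv 0))‖ ^ 2,
    1 / 2 * ‖radiation m R (flat (hA 0)) (-flat (hu.memLp_timeDeriv 0))‖ ^ 2, ?_, ?_, ?_⟩
  · refine (hsol.tendsto_exteriorEnergy hR).congr' ?_
    filter_upwards [eventually_ge_atTop 0] with t ht
    rw [hE, abs_of_nonneg ht, add_comm t]
  · refine (hsol.tendsto_exteriorEnergy_atBot hR).congr' ?_
    filter_upwards [eventually_le_atBot 0] with t ht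
    rw [hE, abs_of_nonpos ht, add_comm (-t)]
  rw [toExt_eq_extOfFlat hR _ _ (coeFn_restrictIoi_flat hR hfr') (coeFn_restrictIoi_flat hR hg)]
  have hsum := add_norm_sq_radiation hd hR (flat (hA 0)) (flat (hu.memLp_timeDeriv 0))
  have hneg : f = 0 ∨ g = 0 → ‖radiation m R (flat (hA 0)) (-flat (hu.memLp_timeDeriv 0))‖ =
      ‖radiation m R (flat (hA 0)) (flat (hu.memLp_timeDeriv 0))‖ := fun h => by
    refine norm_radiation_neg_eq (h.imp (fun h => ?_) fun h => ?_)
    · subst h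
      rw [hA0, restrictIoi_flat_eq_zero hR hf]
    · subst h
      have h0 : flat hg = 0 := by
        have := norm_sq_flat hg
        have hz : radial (2 * m + 1) (0 : ℝ → 𝕜) = 0 := rfl
        rw [hz, eLpNorm_zero, ENNReal.toReal_zero, zero_pow two_ne_zero, mul_eq_zero,
          or_iff_right (sphereVolume_pos m).ne', sq_eq_zero_iff, norm_eq_zero] at this
        exact this
      rw [hB0, h0, map_zero]
  rw [hA0, hB0] at hsum
  rw [hB0] at hneg ⊢
  set X := extOfFlat m hR (restrictIoi 𝕜 R (flat hfr')) (restrictIoi 𝕜 R (flat hg))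
  have hX : X ∈ P 𝕜 hd hR ↔ ‖projPerp 𝕜 hd hR X‖ ^ 2 = 0 := by
    rw [sq_eq_zero_iff, norm_eq_zero, projPerp_eq_zero_iff]
  rw [hX, ← hsum]
  set p := ‖radiation m R (flat (hA 0)) (flat hg)‖
  set q := ‖radiation m R (flat (hA 0)) (-flat hg)‖
  have hp : 0 ≤ 1 / 2 * p ^ 2 := by positivity
  have hq : 0 ≤ 1 / 2 * q ^ 2 := by positivity
  have h1 := le_max_left (1 / 2 * p ^ 2) (1 / 2 * q ^ 2)
  have h2 := le_max_right (1 / 2 * p ^ 2) (1 / 2 * q ^ 2)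
  -- The two limits are nonnegative with sum the squared norm of the projection; the remaining
  -- claims compare the maximum with this sum.
  refine ⟨by linarith, fun h => ?_, fun h => by linarith, fun h => ?_⟩
  · rw [hneg h, max_self]
    ring
  · exact le_antisymm (max_le (by linarith) (by linarith)) (by linarith)
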